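/- Let $R>0$ and consider in the plane the constant magnetic field whose unit-speed trajectories are the counterclockwise circles of radius $R$, i.e. the solutions of $\ddot x=\frac1R J\dot x$, $|\dot x|=1$, $J(v_1,v_2)=(-v_2,v_1)$. The Finsler length of a curve $\gamma$ is $\mathcal L(\gamma)=\int L(\gamma,\gamma')\,dt$, where $L(x,v)=|v|+\frac1{2R}[v,x]$ and $[v,x]=v_1x_2-v_2x_1$. Let $\Gamma$ be an oriented smooth closed convex curve, and let $K$ be the closed convex region that it bounds; if $\Gamma$ is oriented counterclockwise, assume that its curvature is everywhere greater than $1/R$ (no further condition is imposed if $\Gamma$ is oriented clockwise). Let $\Omega$ be the set of points $X\notin K$ such that $\Gamma\cup\{X\}$ lies in some open disc of radius $R$. For $X\in\Omega$ let $F(X)$ be the Finsler length of the shortest closed curve from $X$ to $X$ around the obstacle $K$, that is, the minimum of $\mathcal L(\gamma)$ over the closed piecewise $C^1$ curves $\gamma$ that start and end at $X$, do not enter the interior of $K$, have the same winding number as $\Gamma$ about the interior points of $K$, and lie together with $\Gamma$ in some open disc of radius $R$. A magnetic billiard table is a bounded connected open set $T$ whose boundary is a regular smooth simple closed curve; the particle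 moves in $T$ along magnetic trajectories and is reflected elastically at $\partial T$ (the tangential component of the velocity is kept, the normal component changes sign). The table $T$ has $\Gamma$ as a caustic if $K\subset T$ and, whenever a segment of a billiard trajectory between consecutive impacts is tangent to $\Gamma$ with the velocity in the direction of the orientation of $\Gamma$, the reflected segment is also tangent to $\Gamma$ in this way. Then: 1. the minimum defining $F(X)$ is attained for every $X\in\Omega$; 2. if $\Gamma$ is oriented counterclockwise, every level set $\{X\in\Omega: F(X)=c\}$ is compact; 3. a set $S$ is a nonempty compact level set of $F$ if and only if $S\subset\Omega$ and $S$ is the boundary of a magnetic billiard table that has $\Gamma$ as a caustic. -/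

import Mathlib

open scoped ContDiff

noncomputable section

/-! The plane is `ℂ`; rotation by a right angle, `J (v₁, v₂) = (-v₂, v₁)`, is multiplication
by `Complex.I`. -/

/-- The cross product `[v, x] = v₁ x₂ - v₂ x₁`. -/
def cross (v x : ℂ) : ℝ := v.re * x.im - v.im * x.re

/-- The Lagrangian `L(x, v) = |v| + [v, x] / (2R)` of the constant magnetic field. -/
def magneticLagrangian (R : ℝ) (x v : ℂ) : ℝ := ‖v‖ + 1 / (2 * R) * cross v x

/-- The Finsler length of a curve `γ : [0, 1] → ℂ`. -/
def finslerLength (R : ℝ) (γ : ℝ → ℂ) : ℝ :=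
  ∫ s in (0 : ℝ)..1, magneticLagrangian R (γ s) (deriv γ s)

/-- A regular smooth simple closed curve, parametrized by `ℝ / ℤ`. -/
structure IsSmoothSimpleClosedCurve (g : ℝ → ℂ) : Prop where
  smooth : ContDiff ℝ ∞ g
  periodic : Function.Periodic g 1
  regular : ∀ t, deriv g t ≠ 0
  injOn : Set.InjOn g (Set.Ico 0 1)

/-- A smooth closed convex curve: a smooth simple closed curve which is the boundary of its
convex hull. It is oriented by its parametrization. -/
structure IsConvexClosedCurve (g : ℝ → ℂ) : Prop extends IsSmoothSimpleClosedCurve g where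
  convex : Set.range g = frontier (convexHull ℝ (Set.range g))

/-- The open region bounded by a closed convex curve. -/
def insideOf (g : ℝ → ℂ) : Set ℂ := interior (convexHull ℝ (Set.range g))

/-- A closed convex curve is counterclockwise if the region it bounds lies on its left. -/
def IsCounterclockwise (g : ℝ → ℂ) : Prop :=
  ∀ t, ∀ z ∈ insideOf g, 0 < cross (deriv g t) (z - g t)

/-- The curvature of an oriented plane curve, positive where the curve turns left. -/
def signedCurvature (g : ℝ → ℂ) (t : ℝ) : ℝ :=
  cross (deriv g t) (deriv (deriv g) t) / ‖deriv g t‖ ^ 3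

/-- The closed curve `γ : [0, 1] → ℂ` has winding number `n` about the point `z`:
a continuous polar angle of `γ` about `z` increases by `2πn`. -/
def HasWindingNumber (γ : ℝ → ℂ) (z : ℂ) (n : ℤ) : Prop :=
  ∃ θ : ℝ → ℝ, ContinuousOn θ (Set.Icc 0 1) ∧
    (∀ s ∈ Set.Icc (0 : ℝ) 1, γ s ≠ z ∧
      γ s - z = (‖γ s - z‖ : ℂ) * Complex.exp ((θ s : ℂ) * Complex.I)) ∧
    θ 1 - θ 0 = 2 * Real.pi * n

/-- A closed curve from `X` to `X` around the obstacle bounded by `g`, with the orientation of `g`,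
which lies together with `g` in an open disc of the Larmor radius `R`. As the velocity may vanish,
the `C¹` paths include all piecewise `C¹` curves, after a change of the parameter. -/
structure IsLoopAround (R : ℝ) (g : ℝ → ℂ) (X : ℂ) (γ : ℝ → ℂ) : Prop where
  contDiffOn : ContDiffOn ℝ 1 γ (Set.Icc 0 1)
  source : γ 0 = X
  target : γ 1 = X
  avoids : ∀ s ∈ Set.Icc (0 : ℝ) 1, γ s ∉ insideOf g
  winding : ∀ z ∈ insideOf g, ∃ n : ℤ, HasWindingNumber γ z n ∧ HasWindingNumber g z n
  small : ∃ p : ℂ, Set.range g ⊆ Metric.ball p R ∧ γ '' Set.Icc 0 1 ⊆ Metric.ball p R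

/-- The Finsler lengths of all closed curves from `X` around `g`. -/
def loopLengths (R : ℝ) (g : ℝ → ℂ) (X : ℂ) : Set ℝ :=
  {l | ∃ γ, IsLoopAround R g X γ ∧ finslerLength R γ = l}

/-- The function `F`: the Finsler length of the shortest closed curve from `X` around `g`. -/
def stringFunction (R : ℝ) (g : ℝ → ℂ) (X : ℂ) : ℝ := sInf (loopLengths R g X)

/-- The domain of `F`: the points outside `g` that lie together with `g` in an open disc of
radius `R`. -/
def stringDomain (R : ℝ) (g : ℝ → ℂ) : Set ℂ :=
  {X | X ∉ convexHull ℝ (Set.range g) ∧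
    ∃ p : ℂ, Set.range g ⊆ Metric.ball p R ∧ X ∈ Metric.ball p R}

/-- The level sets of `F`. -/
def stringLevel (R : ℝ) (g : ℝ → ℂ) (c : ℝ) : Set ℂ :=
  {X | X ∈ stringDomain R g ∧ stringFunction R g X = c}

/-- The motion with unit speed in the constant field of strength `1 / R`: a solution of
`x'' = (1 / R) J x'` with `|x'| = 1`. -/
structure IsMagneticTrajectory (R : ℝ) (q : ℝ → ℂ) : Prop where
  differentiable : Differentiable ℝ q
  speed : ∀ s, ‖deriv q s‖ = 1
  equation : ∀ s, HasDerivAt (deriv q) (((1 / R : ℝ) : ℂ) * (Complex.I * deriv q s)) s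

/-- `T` is a billiard table with boundary curve `N`. -/
structure IsBilliardTable (T : Set ℂ) (N : ℝ → ℂ) : Prop where
  isOpen : IsOpen T
  isBounded : Bornology.IsBounded T
  isConnected : IsConnected T
  curve : IsSmoothSimpleClosedCurve N
  boundary : frontier T = Set.range N

/-- The trajectory `q` restricted to `[a, b]` is a segment of a magnetic billiard trajectory in `T`,
from one impact at the boundary to the next. -/
structure IsSegment (R : ℝ) (T : Set ℂ) (q : ℝ → ℂ) (a b : ℝ) : Prop where
  trajectory : IsMagneticTrajectory R q
  lt : a < b
  start_mem : q a ∈ frontier T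
  end_mem : q b ∈ frontier T
  inside : ∀ s ∈ Set.Ioo a b, q s ∈ T

/-- The segment `q` on `[a, b]` is tangent to `g`, the orientations at the point of contact
agreeing. -/
def IsTangentTo (q : ℝ → ℂ) (a b : ℝ) (g : ℝ → ℂ) : Prop :=
  ∃ s ∈ Set.Ioo a b, ∃ t k : ℝ, q s = g t ∧ 0 < k ∧ deriv g t = (k : ℂ) * deriv q s

/-- Elastic reflection in a line of direction `τ`: the tangential component of the velocity is
kept and the normal component changes sign. -/
def IsElasticReflection (τ v w : ℂ) : Prop :=
  inner ℝ w τ = inner ℝ v τ ∧ inner ℝ w (Complex.I * τ) = -inner ℝ v (Complex.I * τ)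

/-- The oriented curve `g` is a caustic of the magnetic billiard in the table `T` with boundary
curve `N`: it lies, with the region it bounds, inside `T`, and whenever a segment of a billiard
trajectory is tangent to `g`, then so is the reflected segment. -/
def HasCaustic (R : ℝ) (T : Set ℂ) (N g : ℝ → ℂ) : Prop :=
  convexHull ℝ (Set.range g) ⊆ T ∧
  ∀ (q : ℝ → ℂ) (a b : ℝ), IsSegment R T q a b → IsTangentTo q a b g →
    ∀ (q' : ℝ → ℂ) (u : ℝ), IsMagneticTrajectory R q' → N u = q b → q' b = q b →
      IsElasticReflection (deriv N u) (deriv q b) (deriv q' b) →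
      ∃ c, IsSegment R T q' b c ∧ IsTangentTo q' b c g

end

/-!
The extremals of the Lagrangian `L` are the Larmor circles, run through
counterclockwise. The obstacle `K` lies on one side of each Larmor circle that is tangent to
`Γ` (`IsObstacle.disc`: inside for a counterclockwise curve, by Blaschke's rolling theorem, and
outside for a clockwise one). Therefore each point `X` of `Ω` is reached by exactly one tangent
arc shorter than a half circle that arrives from `Γ`, and by exactly one that departs from
`X` towards `Γ` (`IsObstacle.exists_larmorArc_eq`, `IsObstacle.larmorArc_unique`). These two
arcs and the part of `Γ` between their contacts form the taut string of `X` (`IsTautString`).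

Let `W` be the action of the path along `Γ` and then along a tangent arc (`arcPotential`). Its
differential is the momentum `∂L/∂v` at the end point
(`IsSmoothSimpleClosedCurve.hasFDerivAt_arcPotential`),
so that the tangent arcs are calibrated by `W` (`momentum_le`). The length of the taut
string is the difference `W q - W q'` for its arriving arc `q` and its departing arc `q'`,
and no admissible loop is shorter. To see this, the arriving arc is followed along the loop,
in a continuous lift that is determined by the polar angle about a point inside. Until its
contact is that of the departing arc at `X`, the loop is compared with a single Larmor arc,
which is the shortest path in a disc of radius `R` (`chordAction_le_integral`); afterwards
it is compared with `W` (`IsTautString.le_finslerLength_of_notMem_hull`). Loops that touch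
`K` are limits of dilated ones. Thus `F X = W q - W q'`, and the differential of `F` is the
inner product with `v - v'`, where `v` and `v'` are the velocities of the two arcs at `X`
(`IsTautString.hasFDerivAt_stringFunction`). In particular, `F` is strictly monotone along
the tangent arcs.

For a counterclockwise curve, `Ω` is bounded by `Γ`, where `F` tends to the length of `Γ`,
and by points at the distance `2R` from some point of `Γ`, where `F` tends to `πR`. By
monotonicity `F` lies strictly between these values in `Ω`, hence its level sets are compact.

The tangential components of `v` and `v'` along a curve agree if and only if the curve is
orthogonal to the gradient of `F`; as `v ≠ v'` are unit vectors, this is the reflection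
law. By monotonicity and compactness, a compact level set is a graph over the arriving arcs
(`IsObstacle.exists_level_section`); it bounds the region swept out by the parts of the arcs
below it, and this table has `Γ` as a caustic. Conversely, in a table with the caustic `Γ`,
whose boundary lies in `Ω`, the reflection law says that `F` is locally constant along the
boundary, and that the arriving arcs meet the boundary transversally. So the times of first
exit are continuous, the table is swept out by the arriving arcs, and its boundary is the
whole level set, again by monotonicity (`IsObstacle.exists_eq_stringLevel`).
-/


/-! ### Cross product and inner product in complex notation -/

theorem cross_eq_im (v x : ℂ) : cross v x = (starRingEnd ℂ v * x).im := by
  simp [cross]; ring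

theorem inner_eq_re (v x : ℂ) : inner ℝ v x = v.re * x.re + v.im * x.im := by
  simp [Complex.inner]; ring

@[simp] theorem cross_same (v : ℂ) : cross v v = 0 := by simp [cross]; ring

@[simp] theorem cross_zero_right (v : ℂ) : cross v 0 = 0 := by simp [cross]

@[simp] theorem cross_zero_left (v : ℂ) : cross 0 v = 0 := by simp [cross]

theorem cross_add_right (v x y : ℂ) : cross v (x + y) = cross v x + cross v y := by
  simp [cross]; ring

theorem cross_add_left (v x y : ℂ) : cross (x + y) v = cross x v + cross y v := by
  simp [cross]; ring

theorem cross_sub_right (v x y : ℂ) : cross v (x - y) = cross v x - cross v y := by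
  simp [cross]; ring

theorem cross_sub_left (v x y : ℂ) : cross (x - y) v = cross x v - cross y v := by
  simp [cross]; ring

theorem cross_smul_left (k : ℝ) (v x : ℂ) : cross ((k : ℂ) * v) x = k * cross v x := by
  simp [cross]; ring

theorem cross_smul_right (k : ℝ) (v x : ℂ) : cross v ((k : ℂ) * x) = k * cross v x := by
  simp [cross]; ring

theorem cross_comm (v x : ℂ) : cross v x = -cross x v := by simp [cross]; ring

theorem cross_I_mul_right (v x : ℂ) : cross v (Complex.I * x) = inner ℝ v x := by
  rw [inner_eq_re]; simp [cross]

theorem abs_cross_le (v x : ℂ) : |cross v x| ≤ ‖v‖ * ‖x‖ := by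
  rw [cross_eq_im]
  refine (Complex.abs_im_le_norm _).trans ?_
  simp

theorem norm_sq_eq_inner_sq_add_cross_sq {v : ℂ} (hv : ‖v‖ = 1) (x : ℂ) :
    ‖x‖ ^ 2 = inner ℝ v x ^ 2 + cross v x ^ 2 := by
  have h : v.re ^ 2 + v.im ^ 2 = 1 := by
    have := Complex.sq_norm v; rw [hv, Complex.normSq_apply] at this; nlinarith
  rw [Complex.sq_norm, Complex.normSq_apply, inner_eq_re, cross]
  linear_combination (-(x.re ^ 2 + x.im ^ 2)) * h

theorem ContDiff.cross {E : Type*} [NormedAddCommGroup E] [NormedSpace ℝ E] {n : WithTop ℕ∞}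
    {f h : E → ℂ} (hf : ContDiff ℝ n f) (hh : ContDiff ℝ n h) :
    ContDiff ℝ n fun x => cross (f x) (h x) := by
  unfold _root_.cross
  have h1 : ∀ {f : E → ℂ}, ContDiff ℝ n f → ContDiff ℝ n fun x => (f x).re :=
    fun hf => Complex.reCLM.contDiff.comp hf
  have h2 : ∀ {f : E → ℂ}, ContDiff ℝ n f → ContDiff ℝ n fun x => (f x).im :=
    fun hf => Complex.imCLM.contDiff.comp hf
  exact ((h1 hf).mul (h2 hh)).sub ((h2 hf).mul (h1 hh))

/-- The cross product as a bilinear map. -/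
noncomputable def crossCLM : ℂ →L[ℝ] ℂ →L[ℝ] ℝ :=
  LinearMap.toContinuousLinearMap
    { toFun := fun v => LinearMap.toContinuousLinearMap
        { toFun := fun x => cross v x
          map_add' := cross_add_right v
          map_smul' := fun k x => by simpa using cross_smul_right k v x }
      map_add' := fun v w => ContinuousLinearMap.ext fun x => cross_add_left x v w
      map_smul' := fun k v => ContinuousLinearMap.ext fun x => by
        simpa using cross_smul_left k v x }

@[simp] theorem crossCLM_apply (v x : ℂ) : crossCLM v x = cross v x := rfl

theorem HasDerivAt.cross {f h : ℝ → ℂ} {f' h' : ℂ} {t : ℝ} (hf : HasDerivAt f f' t)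
    (hh : HasDerivAt h h' t) :
    HasDerivAt (fun s => cross (f s) (h s)) (cross f' (h t) + cross (f t) h') t := by
  have := (crossCLM.hasFDerivAt_of_bilinear hf.hasFDerivAt hh.hasFDerivAt).hasDerivAt
  simpa [add_comm] using this

theorem HasFDerivAt.cross {E : Type*} [NormedAddCommGroup E] [NormedSpace ℝ E] {f h : E → ℂ}
    {f' h' : E →L[ℝ] ℂ} {t : E} (hf : HasFDerivAt f f' t) (hh : HasFDerivAt h h' t) :
    HasFDerivAt (fun s => cross (f s) (h s))
      (crossCLM.precompR E (f t) h' + crossCLM.precompL E f' (h t)) t := by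
  exact crossCLM.hasFDerivAt_of_bilinear hf hh

/-! ### The moving frame of a closed curve -/

/-- The speed `|g'|`. -/
noncomputable def speed (g : ℝ → ℂ) (t : ℝ) : ℝ := ‖deriv g t‖

/-- The unit tangent vector. -/
noncomputable def unitTangent (g : ℝ → ℂ) (t : ℝ) : ℂ := deriv g t / (speed g t : ℂ)

/-- The angular velocity of the unit tangent vector: the curvature multiplied by the speed. -/
noncomputable def turningRate (g : ℝ → ℂ) (t : ℝ) : ℝ :=
  cross (deriv g t) (deriv (deriv g) t) / speed g t ^ 2

/-- The center of the Larmor circle which is tangent to `g` at `g t`, with the same orientation. -/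
noncomputable def larmorCenter (R : ℝ) (g : ℝ → ℂ) (t : ℝ) : ℂ :=
  g t + R * (Complex.I * unitTangent g t)

namespace IsSmoothSimpleClosedCurve

variable {g : ℝ → ℂ}

theorem contDiff_deriv (hg : IsSmoothSimpleClosedCurve g) : ContDiff ℝ ∞ (deriv g) :=
  (contDiff_infty_iff_deriv.1 hg.smooth).2

theorem hasDerivAt (hg : IsSmoothSimpleClosedCurve g) (t : ℝ) : HasDerivAt g (deriv g t) t :=
  ((hg.smooth.differentiable (by simp)) t).hasDerivAt

theorem speed_pos (hg : IsSmoothSimpleClosedCurve g) (t : ℝ) : 0 < speed g t :=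
  norm_pos_iff.2 (hg.regular t)

theorem contDiff_speed (hg : IsSmoothSimpleClosedCurve g) : ContDiff ℝ ∞ (speed g) :=
  hg.contDiff_deriv.norm ℝ hg.regular

theorem contDiff_unitTangent (hg : IsSmoothSimpleClosedCurve g) :
    ContDiff ℝ ∞ (unitTangent g) := by
  have h : ContDiff ℝ ∞ fun t => (speed g t : ℂ) :=
    Complex.ofRealCLM.contDiff.comp hg.contDiff_speed
  unfold unitTangent
  simp only [div_eq_mul_inv]
  exact hg.contDiff_deriv.mul (h.inv fun t => by exact_mod_cast (hg.speed_pos t).ne')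

theorem contDiff_turningRate (hg : IsSmoothSimpleClosedCurve g) :
    ContDiff ℝ ∞ (turningRate g) := by
  have h : ContDiff ℝ ∞ (deriv (deriv g)) := (contDiff_infty_iff_deriv.1 hg.contDiff_deriv).2
  exact (hg.contDiff_deriv.cross h).div (hg.contDiff_speed.pow 2)
    fun t => by have := hg.speed_pos t; positivity

theorem deriv_eq (hg : IsSmoothSimpleClosedCurve g) (t : ℝ) :
    deriv g t = (speed g t : ℂ) * unitTangent g t := by
  have : (speed g t : ℂ) ≠ 0 := by exact_mod_cast (hg.speed_pos t).ne'
  rw [unitTangent]; field_simp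

theorem norm_unitTangent (hg : IsSmoothSimpleClosedCurve g) (t : ℝ) : ‖unitTangent g t‖ = 1 := by
  have := hg.speed_pos t
  rw [unitTangent, norm_div, Complex.norm_real, Real.norm_of_nonneg this.le, ← speed,
    div_self this.ne']

theorem deriv_periodic (hg : IsSmoothSimpleClosedCurve g) :
    Function.Periodic (deriv g) 1 := fun t => by
  rw [← deriv_comp_add_const, show (fun x => g (x + 1)) = g from funext hg.periodic]

theorem speed_periodic (hg : IsSmoothSimpleClosedCurve g) : Function.Periodic (speed g) 1 :=
  fun t => by rw [speed, hg.deriv_periodic, speed]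

theorem unitTangent_periodic (hg : IsSmoothSimpleClosedCurve g) :
    Function.Periodic (unitTangent g) 1 :=
  fun t => by rw [unitTangent, hg.deriv_periodic, hg.speed_periodic, unitTangent]

theorem larmorCenter_periodic (hg : IsSmoothSimpleClosedCurve g) (R : ℝ) :
    Function.Periodic (larmorCenter R g) 1 :=
  fun t => by rw [larmorCenter, hg.periodic, hg.unitTangent_periodic, larmorCenter]

theorem hasDerivAt_unitTangent (hg : IsSmoothSimpleClosedCurve g) (t : ℝ) :
    HasDerivAt (unitTangent g) (turningRate g t * (Complex.I * unitTangent g t)) t := by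
  have h1 : HasDerivAt (deriv g) (deriv (deriv g) t) t :=
    ((hg.contDiff_deriv.differentiable (by simp)) t).hasDerivAt
  have hs := hg.speed_pos t
  have h2 : HasDerivAt (speed g) (inner ℝ (deriv g t) (deriv (deriv g) t) / speed g t) t := by
    have h3 := (h1.norm_sq).sqrt (by have := hg.regular t; positivity)
    have h4 : (fun s => √(‖deriv g s‖ ^ 2)) = speed g := by
      funext s; rw [Real.sqrt_sq (norm_nonneg _), speed]
    rw [h4] at h3
    convert h3 using 1
    rw [Real.sqrt_sq (norm_nonneg _), speed]; field_simp
  have hs' : (speed g t : ℂ) ≠ 0 := by exact_mod_cast hs.ne'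
  have h5 := h1.div h2.ofReal_comp hs'
  refine h5.congr_deriv ?_
  have hsq : ((speed g t : ℝ) : ℂ) ^ 2 = starRingEnd ℂ (deriv g t) * deriv g t := by
    rw [speed, mul_comm, Complex.mul_conj, Complex.normSq_eq_norm_sq]; push_cast; rfl
  have h6 : starRingEnd ℂ (deriv g t) * deriv (deriv g) t =
      ((inner ℝ (deriv g t) (deriv (deriv g) t) : ℝ) : ℂ) +
        Complex.I * (cross (deriv g t) (deriv (deriv g) t) : ℝ) := by
    rw [inner_eq_re]
    apply Complex.ext <;> simp [cross] ; ring
  rw [turningRate, unitTangent]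
  push_cast
  field_simp
  linear_combination (deriv (deriv g) t) * hsq + (deriv g t) * h6

theorem hasDerivAt_larmorCenter (hg : IsSmoothSimpleClosedCurve g) (R t : ℝ) :
    HasDerivAt (larmorCenter R g)
      (((speed g t - R * turningRate g t : ℝ) : ℂ) * unitTangent g t) t := by
  refine ((hg.hasDerivAt t).add
    (((hg.hasDerivAt_unitTangent t).const_mul Complex.I).const_mul (R : ℂ))).congr_deriv ?_
  rw [hg.deriv_eq]
  push_cast
  linear_combination (R * turningRate g t * unitTangent g t : ℂ) * Complex.I_sq

theorem eq_add_int (hg : IsSmoothSimpleClosedCurve g) {t u : ℝ} (h : g t = g u) :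
    ∃ k : ℤ, t = u + k := by
  have h1 : ∀ x, g (Int.fract x) = g x := fun x => by
    have := hg.periodic.sub_int_mul_eq (x := x) ⌊x⌋
    rwa [mul_one] at this
  have h2 : Int.fract t = Int.fract u :=
    hg.injOn ⟨Int.fract_nonneg _, Int.fract_lt_one _⟩ ⟨Int.fract_nonneg _, Int.fract_lt_one _⟩
      (by rw [h1, h1, h])
  refine ⟨⌊t⌋ - ⌊u⌋, ?_⟩
  have := Int.floor_add_fract t
  have := Int.floor_add_fract u
  push_cast; linarith

theorem isCompact_range (hg : IsSmoothSimpleClosedCurve g) : IsCompact (Set.range g) :=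
  hg.periodic.compact_of_continuous one_ne_zero hg.smooth.continuous

end IsSmoothSimpleClosedCurve

/-! ### Convex curves and their supporting lines -/

theorem exists_smul_of_cross_eq_zero {u w : ℂ} (hu : u ≠ 0) (h : cross u w = 0) :
    ∃ r : ℝ, w = (r : ℂ) * u := by
  have hn : Complex.normSq u ≠ 0 := by simpa [Complex.normSq_eq_zero] using hu
  refine ⟨inner ℝ u w / Complex.normSq u, ?_⟩
  rw [cross] at h
  rw [inner_eq_re]
  apply Complex.ext
  · simp only [Complex.re_ofReal_mul]
    field_simp
    rw [Complex.normSq_apply]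
    linear_combination (-u.im) * h
  · simp only [Complex.im_ofReal_mul]
    field_simp
    rw [Complex.normSq_apply]
    linear_combination (u.re) * h

/-- In the plane the kernel of a nonzero functional is a line. -/
theorem cross_eq_zero_of_apply_eq_zero {f : ℂ →L[ℝ] ℝ} (hf : f ≠ 0) {u w : ℂ} (hu : f u = 0)
    (hw : f w = 0) : cross u w = 0 := by
  by_contra h
  apply hf
  ext x
  have hx : ((cross u w : ℝ) : ℂ) * x = (cross x w : ℝ) * u + (cross u x : ℝ) * w := by
    apply Complex.ext <;> simp [cross] <;> ring
  have h1 := congrArg f hx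
  simp only [← Complex.real_smul, map_add, map_smul, hu, hw, smul_eq_mul] at h1
  simpa [h] using h1

theorem second_deriv_nonneg_of_isLocalMin {f f' : ℝ → ℝ} {t c : ℝ}
    (hf : ∀ s, HasDerivAt f (f' s) s) (hf' : HasDerivAt f' c t) (h : IsLocalMin f t) : 0 ≤ c := by
  by_contra! hc
  have hd : deriv f = f' := funext fun s => (hf s).deriv
  have h0 : deriv f t = 0 := h.deriv_eq_zero
  have h1 : IsLocalMax f t := isLocalMax_of_deriv_deriv_neg (by rwa [hd, hf'.deriv]) h0
    (hf t).continuousAt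
  have h2 : f =ᶠ[nhds t] fun _ => f t := by
    filter_upwards [h, h1] with s hs hs'
    exact le_antisymm hs' hs
  have h3 : f' =ᶠ[nhds t] fun _ => 0 := by
    filter_upwards [h2.eventuallyEq_nhds] with s hs
    rw [← (hf s).deriv, hs.deriv_eq, deriv_const]
  have := hf'.unique ((hasDerivAt_const t (0 : ℝ)).congr_of_eventuallyEq h3)
  linarith

namespace IsConvexClosedCurve

variable {g : ℝ → ℂ}

theorem mem_hull (g : ℝ → ℂ) (t : ℝ) : g t ∈ convexHull ℝ (Set.range g) :=
  subset_convexHull ℝ _ ⟨t, rfl⟩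

theorem isClosed_hull (hg : IsConvexClosedCurve g) : IsClosed (convexHull ℝ (Set.range g)) := by
  rw [← closure_eq_iff_isClosed, closure_eq_self_union_frontier, ← hg.convex]
  exact Set.union_eq_self_of_subset_right (subset_convexHull ℝ _)

theorem isCompact_hull (hg : IsConvexClosedCurve g) : IsCompact (convexHull ℝ (Set.range g)) :=
  Metric.isCompact_of_isClosed_isBounded hg.isClosed_hull
    (isBounded_convexHull.2 hg.isCompact_range.isBounded)

theorem notMem_insideOf (hg : IsConvexClosedCurve g) (t : ℝ) : g t ∉ insideOf g := by
  have h : g t ∈ frontier (convexHull ℝ (Set.range g)) := hg.convex ▸ ⟨t, rfl⟩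
  exact h.2

theorem mem_hull_iff (hg : IsConvexClosedCurve g) {z : ℂ} :
    z ∈ convexHull ℝ (Set.range g) ↔ z ∈ insideOf g ∨ ∃ t, g t = z := by
  have hm : (∃ t, g t = z) ↔ z ∈ frontier (convexHull ℝ (Set.range g)) := by
    rw [← hg.convex, Set.mem_range]
  rw [hm]
  constructor
  · intro h
    by_cases hz : z ∈ interior (convexHull ℝ (Set.range g))
    · exact Or.inl hz
    · exact Or.inr ⟨subset_closure h, hz⟩
  · rintro (h | h)
    · exact interior_subset h
    · exact hg.isClosed_hull.closure_eq ▸ h.1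

/-- A functional that supports the curve at `g t` vanishes on the tangent vector. -/
theorem apply_deriv_eq_zero (hg : IsConvexClosedCurve g) {f : ℂ →L[ℝ] ℝ} {t : ℝ}
    (h : ∀ s, f (g s) ≤ f (g t)) : f (deriv g t) = 0 := by
  have h1 : HasDerivAt (fun s => f (g s)) (f (deriv g t)) t :=
    f.hasFDerivAt.comp_hasDerivAt t (hg.hasDerivAt t)
  have h2 : IsLocalMax (fun s => f (g s)) t := Filter.Eventually.of_forall h
  exact h2.hasDerivAt_eq_zero h1

theorem exists_apply_max (hg : IsConvexClosedCurve g) (f : ℂ →L[ℝ] ℝ) :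
    ∃ t, ∀ s, f (g s) ≤ f (g t) := by
  obtain ⟨_, ⟨t, rfl⟩, ht⟩ := hg.isCompact_range.exists_isMaxOn ⟨g 0, 0, rfl⟩
    f.continuous.continuousOn
  exact ⟨t, fun s => ht ⟨s, rfl⟩⟩

/-- Otherwise the curve would lie on a line, and its velocity would vanish at an end point. -/
theorem insideOf_nonempty (hg : IsConvexClosedCurve g) : (insideOf g).Nonempty := by
  by_contra hemp
  have h1 : affineSpan ℝ (Set.range g) ≠ ⊤ := by
    rwa [insideOf, interior_convexHull_nonempty_iff_affineSpan_eq_top] at hemp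
  have h2 : (affineSpan ℝ (Set.range g)).direction < ⊤ := by
    rw [lt_top_iff_ne_top]
    intro h
    have h0 : g 0 ∈ affineSpan ℝ (Set.range g) := subset_affineSpan ℝ _ ⟨0, rfl⟩
    exact h1 ((AffineSubspace.direction_eq_top_iff_of_nonempty ⟨g 0, h0⟩).1 h)
  obtain ⟨f, hf0, hf⟩ := Submodule.exists_le_ker_of_lt_top _ h2
  set F : ℂ →L[ℝ] ℝ := LinearMap.toContinuousLinearMap f with hF
  have hF0 : F ≠ 0 := fun h => hf0 (by simpa [hF] using h)
  have hconst : ∀ s t, F (g s) = F (g t) := fun s t => by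
    have : g s - g t ∈ (affineSpan ℝ (Set.range g)).direction :=
      AffineSubspace.vsub_mem_direction (subset_affineSpan ℝ _ ⟨s, rfl⟩)
        (subset_affineSpan ℝ _ ⟨t, rfl⟩)
    have h3 := hf this
    rw [LinearMap.mem_ker, map_sub, sub_eq_zero] at h3
    exact h3
  have hd : ∀ t, F (deriv g t) = 0 := fun t => hg.apply_deriv_eq_zero fun s => (hconst s t).le
  obtain ⟨t, ht⟩ := hg.exists_apply_max (innerSL ℝ (deriv g 0))
  have h4 := hg.apply_deriv_eq_zero ht
  obtain ⟨r, hr⟩ := exists_smul_of_cross_eq_zero (hg.regular 0)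
    (cross_eq_zero_of_apply_eq_zero hF0 (hd 0) (hd t))
  have h5 : r * ‖deriv g 0‖ ^ 2 = 0 := by
    rw [hr, ← Complex.real_smul, map_smul, innerSL_apply_apply, real_inner_self_eq_norm_sq] at h4
    simpa using h4
  have h6 : r = 0 := by
    have := hg.regular 0
    rcases mul_eq_zero.1 h5 with h | h
    · exact h
    · simp_all
  exact hg.regular t (by rw [hr, h6]; simp)

theorem isConnected_insideOf (hg : IsConvexClosedCurve g) : IsConnected (insideOf g) :=
  ⟨hg.insideOf_nonempty, (convex_convexHull ℝ _).interior.isPreconnected⟩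

theorem closure_insideOf (hg : IsConvexClosedCurve g) :
    closure (insideOf g) = convexHull ℝ (Set.range g) := by
  rw [insideOf, (convex_convexHull ℝ _).closure_interior_eq_closure_of_nonempty_interior
    hg.insideOf_nonempty, hg.isClosed_hull.closure_eq]

/-- The tangent lines are supporting lines: they do not meet the interior of the region. -/
theorem cross_ne_zero (hg : IsConvexClosedCurve g) (t : ℝ) {z : ℂ} (hz : z ∈ insideOf g) :
    cross (deriv g t) (z - g t) ≠ 0 := by
  intro h
  obtain ⟨f, hf⟩ := geometric_hahn_banach_open_point (convex_convexHull ℝ _).interior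
    isOpen_interior (hg.notMem_insideOf t)
  have hle : ∀ y ∈ convexHull ℝ (Set.range g), f y ≤ f (g t) := by
    rw [← hg.closure_insideOf]
    exact fun y hy => closure_minimal (fun y hy => (hf y hy).le)
      (isClosed_le f.continuous continuous_const) hy
  have h0 := hg.apply_deriv_eq_zero fun s => hle _ (mem_hull g s)
  obtain ⟨r, hr⟩ := exists_smul_of_cross_eq_zero (hg.regular t) h
  have h1 : f (z - g t) = 0 := by rw [hr, ← Complex.real_smul, map_smul, h0, smul_zero]
  have h2 := hf z hz
  rw [map_sub] at h1
  linarith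

/-- A closed convex curve is either counterclockwise or clockwise. -/
theorem counterclockwise_or_clockwise (hg : IsConvexClosedCurve g) :
    IsCounterclockwise g ∨ ∀ t, ∀ z ∈ insideOf g, cross (deriv g t) (z - g t) < 0 := by
  have hc : Continuous fun p : ℝ × ℂ => cross (deriv g p.1) (p.2 - g p.1) := by
    have h1 := hg.contDiff_deriv.continuous
    have h2 := hg.smooth.continuous
    unfold cross
    fun_prop
  have hconn : IsPreconnected ((Set.univ : Set ℝ) ×ˢ insideOf g) :=
    isPreconnected_univ.prod hg.isConnected_insideOf.isPreconnected
  by_contra! hcon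
  obtain ⟨h1, t, z, hz, h⟩ := hcon
  simp only [IsCounterclockwise, not_forall, not_lt] at h1
  obtain ⟨t', z', hz', h'⟩ := h1
  obtain ⟨p, hp, hp0⟩ := hconn.intermediate_value (a := (t', z')) (b := (t, z))
    ⟨trivial, hz'⟩ ⟨trivial, hz⟩ hc.continuousOn ⟨h', h⟩
  exact hg.cross_ne_zero p.1 hp.2 hp0

end IsConvexClosedCurve

/-- The standing assumptions, in both orientations: `g` is a closed convex curve, `ε` is `1` if it
is counterclockwise and `-1` if it is clockwise, and its curvature, as seen from the region, is
greater than `ε / R`. -/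
structure IsObstacle (R : ℝ) (g : ℝ → ℂ) (ε : ℝ) : Prop extends IsConvexClosedCurve g where
  pos : 0 < R
  sign : ε = 1 ∨ ε = -1
  side : ∀ t, ∀ z ∈ insideOf g, 0 < ε * cross (deriv g t) (z - g t)
  curved : ∀ t, 0 < ε * (R * turningRate g t - speed g t)

theorem turningRate_eq {g : ℝ → ℂ} (hg : IsConvexClosedCurve g) (t : ℝ) :
    turningRate g t = signedCurvature g t * speed g t := by
  have := hg.speed_pos t
  rw [turningRate, signedCurvature, ← speed]
  field_simp

/-- For a clockwise curve no condition is needed: convexity makes the curvature nonpositive. -/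
theorem exists_isObstacle {R : ℝ} {g : ℝ → ℂ} (hR : 0 < R) (hg : IsConvexClosedCurve g)
    (hcurv : IsCounterclockwise g → ∀ t, 1 / R < signedCurvature g t) :
    ∃ ε, IsObstacle R g ε ∧ (IsCounterclockwise g → ε = 1) := by
  rcases hg.counterclockwise_or_clockwise with h | h
  · refine ⟨1, ⟨hg, hR, Or.inl rfl, fun t z hz => by simpa using h t z hz, fun t => ?_⟩,
      fun _ => rfl⟩
    have h1 := hcurv h t
    rw [div_lt_iff₀ hR] at h1
    have h2 := hg.speed_pos t
    rw [turningRate_eq hg]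
    nlinarith
  · refine ⟨-1, ⟨hg, hR, Or.inr rfl, fun t z hz => by simpa using h t z hz, fun t => ?_⟩,
      fun h' => ?_⟩
    · have hle : ∀ s, 0 ≤ -cross (deriv g t) (g s - g t) := by
        have : ∀ z ∈ convexHull ℝ (Set.range g), 0 ≤ -cross (deriv g t) (z - g t) := by
          rw [← hg.closure_insideOf]
          have hcl : IsClosed {z | 0 ≤ -cross (deriv g t) (z - g t)} :=
            isClosed_le continuous_const (by unfold cross; fun_prop)
          refine fun y hy => closure_minimal (fun y hy => ?_) hcl hy
          have := h t y hy
          simp only [Set.mem_ofPred_eq]; linarith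
        exact fun s => this _ (IsConvexClosedCurve.mem_hull g s)
      have h1 : ∀ s, HasDerivAt (fun s => -cross (deriv g t) (g s - g t))
          (-cross (deriv g t) (deriv g s)) s := fun s => by
        simpa using ((hasDerivAt_const s (deriv g t)).cross
          ((hg.hasDerivAt s).sub_const (g t))).fun_neg
      have h2 : HasDerivAt (fun s => -cross (deriv g t) (deriv g s))
          (-cross (deriv g t) (deriv (deriv g) t)) t := by
        have h3 : HasDerivAt (deriv g) (deriv (deriv g) t) t :=
          ((hg.contDiff_deriv.differentiable (by simp)) t).hasDerivAt
        simpa using ((hasDerivAt_const t (deriv g t)).cross h3).fun_neg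
      have h3 := second_deriv_nonneg_of_isLocalMin h1 h2
        (Filter.Eventually.of_forall fun s => by simpa using hle s)
      have h4 := hg.speed_pos t
      have h5 : turningRate g t ≤ 0 := by
        rw [turningRate]
        exact div_nonpos_of_nonpos_of_nonneg (by linarith) (by positivity)
      nlinarith
    · obtain ⟨z, hz⟩ := hg.insideOf_nonempty
      have := h 0 z hz
      have := h' 0 z hz
      linarith


/-! ### The Larmor discs of the curve -/

theorem cross_mul_mul (m z w : ℂ) : cross (m * z) (m * w) = ‖m‖ ^ 2 * cross z w := by
  rw [Complex.sq_norm, Complex.normSq_apply]; simp [cross]; ring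

theorem inner_mul_mul (m z w : ℂ) : inner ℝ (m * z) (m * w) = ‖m‖ ^ 2 * inner ℝ z w := by
  rw [Complex.sq_norm, Complex.normSq_apply, inner_eq_re, inner_eq_re]; simp; ring

theorem inner_I_mul_left (v x : ℂ) : inner ℝ (Complex.I * v) x = cross v x := by
  rw [inner_eq_re]; simp [cross]; ring

theorem eq_inner_add_cross {τ : ℂ} (hτ : ‖τ‖ = 1) (x : ℂ) :
    x = (inner ℝ τ x : ℝ) * τ + (cross τ x : ℝ) * (Complex.I * τ) := by
  have h : τ.re ^ 2 + τ.im ^ 2 = 1 := by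
    have := Complex.sq_norm τ; rw [hτ, Complex.normSq_apply] at this; nlinarith
  rw [inner_eq_re]
  apply Complex.ext
  · simp [cross]; linear_combination (-x.re) * h
  · simp [cross]; linear_combination (-x.im) * h

namespace IsObstacle

variable {R ε : ℝ} {g : ℝ → ℂ}

theorem sign_mul_self (h : IsObstacle R g ε) : ε * ε = 1 := by
  rcases h.sign with h | h <;> simp [h]

theorem side_unitTangent (h : IsObstacle R g ε) (t : ℝ) {z : ℂ} (hz : z ∈ insideOf g) :
    0 < ε * cross (unitTangent g t) (z - g t) := by
  have h1 := h.side t z hz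
  rw [h.deriv_eq, cross_smul_left] at h1
  have := h.speed_pos t
  exact pos_of_mul_pos_right (by linarith) this.le

theorem side_nonneg (h : IsObstacle R g ε) (t : ℝ) {z : ℂ}
    (hz : z ∈ convexHull ℝ (Set.range g)) : 0 ≤ ε * cross (unitTangent g t) (z - g t) := by
  rw [← h.closure_insideOf] at hz
  have hcl : IsClosed {z | 0 ≤ ε * cross (unitTangent g t) (z - g t)} :=
    isClosed_le continuous_const (by unfold cross; fun_prop)
  exact closure_minimal (fun y hy => (h.side_unitTangent t hy).le) hcl hz

/-- Pythagoras, in the frame that consists of the unit tangent vector and the inner normal at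
`g t`. -/
theorem sub_larmorCenter (h : IsObstacle R g ε) (t : ℝ) (z : ℂ) :
    ‖z - larmorCenter R g t‖ ^ 2 = inner ℝ (unitTangent g t) (z - g t) ^ 2 +
      (cross (unitTangent g t) (z - g t) - R) ^ 2 := by
  have hτ := h.norm_unitTangent t
  rw [norm_sq_eq_inner_sq_add_cross_sq hτ, larmorCenter]
  have h1 : z - (g t + R * (Complex.I * unitTangent g t)) =
    z - g t - R * (Complex.I * unitTangent g t) := by ring
  rw [h1, cross_sub_right, cross_smul_right, cross_I_mul_right, inner_sub_right,
    real_inner_self_eq_norm_sq, hτ, ← Complex.real_smul, inner_smul_right,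
    show inner ℝ (unitTangent g t) (Complex.I * unitTangent g t) = 0 by
      rw [real_inner_comm, inner_I_mul_left, cross_same]]
  ring

theorem norm_sub_larmorCenter (h : IsObstacle R g ε) (t : ℝ) :
    ‖g t - larmorCenter R g t‖ = R := by
  have := h.sub_larmorCenter t (g t)
  simp only [sub_self, inner_zero_right, cross_zero_right] at this
  have h2 := h.pos
  exact (sq_eq_sq₀ (norm_nonneg _) h2.le).1 (by linarith)

theorem hasDerivAt_norm_sq_sub_larmorCenter (h : IsObstacle R g ε) (z : ℂ) (t : ℝ) :
    HasDerivAt (fun t => ‖z - larmorCenter R g t‖ ^ 2)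
      (-2 * (speed g t - R * turningRate g t) *
        inner ℝ (unitTangent g t) (z - larmorCenter R g t)) t := by
  refine ((h.hasDerivAt_larmorCenter R t).const_sub z).norm_sq.congr_deriv ?_
  rw [inner_neg_right, ← Complex.real_smul, inner_smul_right, real_inner_comm]
  ring

/-- The region lies on the same side of each Larmor circle as of the tangent line.
In the counterclockwise case this is Blaschke's rolling theorem. -/
theorem disc (h : IsObstacle R g ε) (t : ℝ) {z : ℂ} (hz : z ∈ convexHull ℝ (Set.range g))
    (hzt : z ≠ g t) : 0 < ε * (R - ‖z - larmorCenter R g t‖) := by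
  have hR := h.pos
  rcases h.sign with rfl | rfl
  · -- where `|z - P|` is maximal, the second derivative of `|z - P|²` decides
    have key : ∀ t, R ≤ ‖z - larmorCenter R g t‖ →
        (∀ s, ‖z - larmorCenter R g s‖ ≤ ‖z - larmorCenter R g t‖) → z = g t := by
      intro t hRt hmax
      have hτ := h.norm_unitTangent t
      have hd := fun s => (h.hasDerivAt_norm_sq_sub_larmorCenter z s).fun_neg
      have hmin : IsLocalMin (fun s => -‖z - larmorCenter R g s‖ ^ 2) t :=
        Filter.Eventually.of_forall fun s => by
          have := pow_le_pow_left₀ (norm_nonneg _) (hmax s) 2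
          simpa using this
      have hcurv := h.curved t
      have h0 := hmin.hasDerivAt_eq_zero (hd t)
      have h0' : inner ℝ (unitTangent g t) (z - larmorCenter R g t) = 0 := by
        rcases mul_eq_zero.1 (neg_eq_zero.1 h0) with h1 | h1
        · nlinarith
        · exact h1
      have hlam : HasDerivAt (fun s => speed g s - R * turningRate g s)
          (deriv (speed g) t - R * deriv (turningRate g) t) t :=
        ((h.contDiff_speed.differentiable (by simp)) t).hasDerivAt.sub
          (((h.contDiff_turningRate.differentiable (by simp)) t).hasDerivAt.const_mul R)
      have hin := (h.hasDerivAt_unitTangent t).inner ℝ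
        ((h.hasDerivAt_larmorCenter R t).const_sub z)
      have h2 := second_deriv_nonneg_of_isLocalMin hd
        (((hlam.const_mul (-2)).mul hin).fun_neg) hmin
      simp only [h0', inner_neg_right, ← Complex.real_smul, inner_smul_right, inner_smul_left,
        real_inner_self_eq_norm_sq, hτ, inner_I_mul_left] at h2
      have hcr : cross (unitTangent g t) (z - larmorCenter R g t) =
          cross (unitTangent g t) (z - g t) - R := by
        rw [larmorCenter, ← sub_sub, cross_sub_right, cross_smul_right, cross_I_mul_right,
          real_inner_self_eq_norm_sq, hτ]; ring
      have hs := h.side_nonneg t hz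
      have hn := norm_sq_eq_inner_sq_add_cross_sq hτ (z - larmorCenter R g t)
      rw [h0', hcr] at hn
      rw [hcr] at h2
      set c := cross (unitTangent g t) (z - g t)
      have hσ := h.speed_pos t
      have hω : 0 < turningRate g t := by
        by_contra! hω; nlinarith
      simp only [starRingEnd_apply, star_trivial] at h2
      have h3 : c - R < 0 := by
        by_contra! h3
        nlinarith [mul_nonneg hω.le h3]
      have h4 : c = 0 := by nlinarith
      have h5 : inner ℝ (unitTangent g t) (z - g t) = 0 := by
        have h6 := h.sub_larmorCenter t z
        change _ = _ + (c - R) ^ 2 at h6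
        rw [hn, h4] at h6
        nlinarith
      have h6 := eq_inner_add_cross hτ (z - g t)
      rw [h5, show cross (unitTangent g t) (z - g t) = 0 from h4] at h6
      rw [← sub_eq_zero, h6]; simp
    by_contra! hcon
    have hRt : R ≤ ‖z - larmorCenter R g t‖ := by linarith
    have hcont : Continuous (fun t => ‖z - larmorCenter R g t‖) := by
      have : Continuous (larmorCenter R g) := by
        have := h.smooth.continuous
        have := h.contDiff_unitTangent.continuous
        unfold larmorCenter; fun_prop
      fun_prop
    have hper : Function.Periodic (fun t => ‖z - larmorCenter R g t‖) 1 := fun t => by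
      simp only [h.larmorCenter_periodic R t]
    obtain ⟨_, ⟨u, rfl⟩, hu⟩ := (hper.compact_of_continuous one_ne_zero hcont).exists_isGreatest
      ⟨_, 0, rfl⟩
    have hu' : ∀ s, ‖z - larmorCenter R g s‖ ≤ ‖z - larmorCenter R g u‖ := fun s => hu ⟨s, rfl⟩
    have hzu := key u (hRt.trans (hu' t)) hu'
    refine hzt (key t hRt fun s => (hu' s).trans ?_)
    rw [hzu, h.norm_sub_larmorCenter]
    rwa [← hzu]
  · -- the tangent line separates the region from the Larmor disc
    have h1 := h.sub_larmorCenter t z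
    have h2 := h.side_nonneg t hz
    have h3 : inner ℝ (unitTangent g t) (z - g t) ≠ 0 ∨ cross (unitTangent g t) (z - g t) ≠ 0 := by
      by_contra! hcon
      apply hzt
      have h6 := eq_inner_add_cross (h.norm_unitTangent t) (z - g t)
      rw [hcon.1, hcon.2] at h6
      rw [← sub_eq_zero, h6]; simp
    have h4 : R ^ 2 < ‖z - larmorCenter R g t‖ ^ 2 := by
      rw [h1]
      rcases h3 with h3 | h3
      · have := pow_pos (abs_pos.2 h3) 2
        rw [sq_abs] at this
        nlinarith
      · have := pow_pos (abs_pos.2 h3) 2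
        rw [sq_abs] at this
        nlinarith [sq_nonneg (inner ℝ (unitTangent g t) (z - g t))]
    have := lt_of_pow_lt_pow_left₀ 2 (norm_nonneg _) h4
    linarith

theorem eq_of_norm_sub_larmorCenter (h : IsObstacle R g ε) {t : ℝ} {z : ℂ}
    (hz : z ∈ convexHull ℝ (Set.range g)) (hR : ‖z - larmorCenter R g t‖ = R) : z = g t := by
  by_contra hne
  have := h.disc t hz hne
  rw [hR] at this
  simp at this

theorem norm_sub_ne_of_mem_insideOf (h : IsObstacle R g ε) (t : ℝ) {z : ℂ}
    (hz : z ∈ insideOf g) : ‖z - larmorCenter R g t‖ ≠ R := fun hR => by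
  have := h.eq_of_norm_sub_larmorCenter (interior_subset hz) hR
  exact h.notMem_insideOf t (this ▸ hz)

end IsObstacle


/-! ### Larmor arcs tangent to the curve -/

/-- The velocity, at time `s` after the contact, of the magnetic trajectory that touches `g` at
`g t` at time `0`, with the same orientation. The argument is the pair `(t, s)`. -/
noncomputable def arcVelocity (R : ℝ) (g : ℝ → ℂ) (p : ℝ × ℝ) : ℂ :=
  unitTangent g p.1 * Complex.exp ((p.2 / R : ℝ) * Complex.I)

/-- The position, at time `s` after the contact, of the magnetic trajectory that touches `g` at
`g t` at time `0`, with the same orientation. The argument is the pair `(t, s)`. -/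
noncomputable def larmorArc (R : ℝ) (g : ℝ → ℂ) (p : ℝ × ℝ) : ℂ :=
  larmorCenter R g p.1 - R * (Complex.I * arcVelocity R g p)

/-- The partial derivative of `larmorArc R g` in the direction of the curve parameter. -/
noncomputable def arcVariation (R : ℝ) (g : ℝ → ℂ) (p : ℝ × ℝ) : ℂ :=
  ((speed g p.1 - R * turningRate g p.1 : ℝ) : ℂ) * unitTangent g p.1 +
    ((R * turningRate g p.1 : ℝ) : ℂ) * arcVelocity R g p

theorem larmorArc_zero (R : ℝ) (g : ℝ → ℂ) (t : ℝ) : larmorArc R g (t, 0) = g t := by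
  simp [larmorArc, larmorCenter, arcVelocity]

theorem arcVelocity_zero (R : ℝ) (g : ℝ → ℂ) (t : ℝ) :
    arcVelocity R g (t, 0) = unitTangent g t := by
  simp [arcVelocity]

theorem cross_mul_exp (τ : ℂ) (φ : ℝ) :
    cross τ (τ * Complex.exp (φ * Complex.I)) = ‖τ‖ ^ 2 * Real.sin φ := by
  have := cross_mul_mul τ 1 (Complex.exp (φ * Complex.I))
  rw [mul_one] at this
  rw [this, cross, Complex.exp_ofReal_mul_I_im]; simp

/-- A periodic function that changes sign has an upward zero. -/
theorem exists_zero_of_periodic {f f' : ℝ → ℝ} (hf : ∀ t, HasDerivAt f (f' t) t)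
    (hp : Function.Periodic f 1) {a b : ℝ} (ha : f a < 0) (hb : 0 < f b) :
    ∃ c, f c = 0 ∧ 0 ≤ f' c := by
  obtain ⟨k, hk⟩ := exists_nat_gt (a - b)
  have hb' : 0 < f (b + k) := by
    have := hp.nat_mul_eq k
    have h2 : f (b + k) = f b := by
      have := hp.nat_mul k b
      simpa using this
    rwa [h2]
  have hab : a ≤ b + k := by linarith
  set B := b + k
  have hcont : Continuous f := continuous_iff_continuousAt.2 fun t => (hf t).continuousAt
  have hS : IsCompact (Set.Icc a B ∩ {x | f x ≤ 0}) :=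
    isCompact_Icc.inter_right (isClosed_le hcont continuous_const)
  obtain ⟨c, ⟨⟨hac, hcB⟩, hc0⟩, hmax⟩ := hS.exists_isGreatest ⟨a, ⟨le_rfl, hab⟩, ha.le⟩
  have hc0 : f c ≤ 0 := hc0
  have hcB' : c < B := lt_of_le_of_ne hcB fun h => by rw [h] at hc0; linarith
  have hpos : ∀ x ∈ Set.Ioc c B, 0 < f x := fun x hx => by
    by_contra! hx0
    exact absurd (hmax ⟨⟨hac.trans hx.1.le, hx.2⟩, hx0⟩) (not_le.2 hx.1)
  have hev : ∀ᶠ x in nhdsWithin c (Set.Ioi c), 0 < f x := by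
    filter_upwards [Ioc_mem_nhdsGT hcB'] with x hx using hpos x hx
  have h0 : f c = 0 := le_antisymm hc0 (ge_of_tendsto
    (hcont.continuousAt.tendsto.mono_left nhdsWithin_le_nhds) (hev.mono fun _ h => h.le))
  refine ⟨c, h0, ?_⟩
  have hsl := (hasDerivWithinAt_iff_tendsto_slope' (s := Set.Ioi c) (by simp)).1
    (hf c).hasDerivWithinAt
  refine ge_of_tendsto hsl ?_
  filter_upwards [hev, self_mem_nhdsWithin] with x hx hxc
  rw [slope_def_field, h0, sub_zero]
  exact div_nonneg hx.le (sub_nonneg.2 (le_of_lt hxc))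

/-- The trigonometric form of the statement that there is at most one tangent arc, for a clockwise
curve: the hypotheses say that each of two contacts lies on the allowed side of the tangent line at
the other. -/
theorem eq_zero_and_eq_of_sin_sq_le {a b η : ℝ} (ha : 0 < a) (ha' : a < Real.pi / 2) (hb : 0 < b)
    (hb' : b < Real.pi / 2) (hη : |η| ≤ Real.pi)
    (h1 : Real.sin b ^ 2 ≤ Real.sin a * Real.sin (η + b))
    (h2 : Real.sin a ^ 2 ≤ Real.sin b * Real.sin (a - η)) : η = 0 ∧ a = b := by
  have hπ := Real.pi_pos
  obtain ⟨hη1, hη2⟩ := abs_le.1 hη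
  have sa : 0 < Real.sin a := Real.sin_pos_of_pos_of_lt_pi ha (by linarith)
  have sb : 0 < Real.sin b := Real.sin_pos_of_pos_of_lt_pi hb (by linarith)
  have range : ∀ x, -Real.pi ≤ x → x ≤ 3 * Real.pi / 2 → 0 < Real.sin x →
      0 < x ∧ x < Real.pi := by
    intro x hx1 hx2 hx
    constructor
    · by_contra! hc
      linarith [Real.sin_nonpos_of_nonpos_of_neg_pi_le hc hx1]
    · by_contra! hc
      have : 0 ≤ Real.sin (x - Real.pi) :=
        Real.sin_nonneg_of_nonneg_of_le_pi (by linarith) (by linarith)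
      rw [Real.sin_sub_pi] at this
      linarith
  have s1 : 0 < Real.sin (η + b) := by
    by_contra! hc; nlinarith [pow_pos sb 2]
  have s2 : 0 < Real.sin (a - η) := by
    by_contra! hc; nlinarith [pow_pos sa 2]
  obtain ⟨r1, r1'⟩ := range _ (by linarith) (by linarith) s1
  obtain ⟨r2, r2'⟩ := range _ (by linarith) (by linarith) s2
  have h3 : Real.sin a * Real.sin b ≤ Real.sin (η + b) * Real.sin (a - η) := by
    by_contra! hc
    have e1 := mul_le_mul h1 h2 (by positivity) (by positivity)
    have e2 : (Real.sin a * Real.sin b) * (Real.sin (η + b) * Real.sin (a - η)) <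
        (Real.sin a * Real.sin b) * (Real.sin a * Real.sin b) :=
      mul_lt_mul_of_pos_left hc (by positivity)
    nlinarith
  have h4 : Real.cos (a - b) ≤ Real.cos (2 * η + b - a) := by
    have e1 : 2 * Real.sin a * Real.sin b = Real.cos (a - b) - Real.cos (a + b) :=
      Real.two_mul_sin_mul_sin a b
    have e2 : 2 * Real.sin (η + b) * Real.sin (a - η) =
        Real.cos ((η + b) - (a - η)) - Real.cos ((η + b) + (a - η)) :=
      Real.two_mul_sin_mul_sin _ _
    rw [show (η + b) - (a - η) = 2 * η + b - a by ring,
      show (η + b) + (a - η) = a + b by ring] at e2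
    linarith
  have h5 : |2 * η + b - a| ≤ |a - b| := by
    by_contra! hc
    have := Real.cos_lt_cos_of_nonneg_of_le_pi (abs_nonneg _) (y := |2 * η + b - a|)
      (abs_le.2 ⟨by linarith, by linarith⟩) hc
    rw [Real.cos_abs, Real.cos_abs] at this
    linarith
  rcases le_total b a with hab | hab
  · rw [abs_of_nonneg (sub_nonneg.2 hab), abs_le] at h5
    have h6 : Real.sin (a - η) ≤ Real.sin a :=
      Real.sin_le_sin_of_le_of_le_pi_div_two (by linarith) (by linarith) (by linarith)
    have h7 : Real.sin a ≤ Real.sin b := by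
      by_contra! hc
      nlinarith
    have h8 : a ≤ b := by
      by_contra! hc
      linarith [Real.sin_lt_sin_of_lt_of_le_pi_div_two (x := b) (y := a) (by linarith)
        (by linarith) hc]
    constructor <;> linarith
  · rw [abs_of_nonpos (sub_nonpos.2 hab), abs_le] at h5
    have h6 : Real.sin (η + b) ≤ Real.sin b :=
      Real.sin_le_sin_of_le_of_le_pi_div_two (by linarith) (by linarith) (by linarith)
    have h7 : Real.sin b ≤ Real.sin a := by
      by_contra! hc
      nlinarith
    have h8 : b ≤ a := by
      by_contra! hc
      linarith [Real.sin_lt_sin_of_lt_of_le_pi_div_two (x := a) (y := b) (by linarith)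
        (by linarith) hc]
    constructor <;> linarith

/-- The trigonometric form of the statement that there is at most one tangent arc, for a
counterclockwise curve: the hypotheses say that each of two contacts lies in the Larmor disc of the
other. -/
theorem eq_sub_of_sin_le {a b η : ℝ} (ha : 0 < a) (ha' : a < Real.pi / 2) (hb : 0 < b)
    (hb' : b < Real.pi / 2) (hη : |η| ≤ Real.pi) (h1 : Real.sin a ≤ Real.sin (b - η))
    (h2 : Real.sin b ≤ Real.sin (a + η)) : η = b - a := by
  have hπ := Real.pi_pos
  obtain ⟨hη1, hη2⟩ := abs_le.1 hη
  have key : ∀ a x, 0 < a → a < Real.pi / 2 → -Real.pi ≤ x → Real.sin a ≤ Real.sin x → a ≤ x := by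
    intro a x ha ha' hx hs
    have sa : 0 < Real.sin a := Real.sin_pos_of_pos_of_lt_pi ha (by linarith)
    by_contra! hc
    rcases le_total x 0 with h0 | h0
    · linarith [Real.sin_nonpos_of_nonpos_of_neg_pi_le h0 hx]
    · linarith [Real.sin_lt_sin_of_lt_of_le_pi_div_two (x := x) (y := a) (by linarith)
        (by linarith) hc]
  have := key a _ ha ha' (by linarith) h1
  have := key b _ hb hb' (by linarith) h2
  linarith

namespace IsSmoothSimpleClosedCurve

variable {R : ℝ} {g : ℝ → ℂ}

theorem norm_arcVelocity (h : IsSmoothSimpleClosedCurve g) (R : ℝ) (p : ℝ × ℝ) :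
    ‖arcVelocity R g p‖ = 1 := by
  rw [arcVelocity, norm_mul, h.norm_unitTangent, Complex.norm_exp_ofReal_mul_I, mul_one]

theorem norm_larmorArc_sub (h : IsSmoothSimpleClosedCurve g) (hR : 0 < R) (p : ℝ × ℝ) :
    ‖larmorArc R g p - larmorCenter R g p.1‖ = R := by
  rw [larmorArc]
  simp [h.norm_arcVelocity, abs_of_pos hR]

theorem cross_unitTangent_arcVelocity (h : IsSmoothSimpleClosedCurve g) (R : ℝ) (p : ℝ × ℝ) :
    cross (unitTangent g p.1) (arcVelocity R g p) = Real.sin (p.2 / R) := by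
  rw [arcVelocity, cross_mul_exp, h.norm_unitTangent]; ring

theorem larmorArc_add_int (h : IsSmoothSimpleClosedCurve g) (R : ℝ) (t s : ℝ) (k : ℤ) :
    larmorArc R g (t + k, s) = larmorArc R g (t, s) := by
  have h1 := (h.larmorCenter_periodic R).int_mul k t
  have h2 := h.unitTangent_periodic.int_mul k t
  simp only [mul_one] at h1 h2
  simp only [larmorArc, arcVelocity, h1, h2]

theorem arcVelocity_add_int (h : IsSmoothSimpleClosedCurve g) (R : ℝ) (t s : ℝ) (k : ℤ) :
    arcVelocity R g (t + k, s) = arcVelocity R g (t, s) := by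
  have h2 := h.unitTangent_periodic.int_mul k t
  simp only [mul_one] at h2
  simp only [arcVelocity, h2]

theorem contDiff_arcVelocity (h : IsSmoothSimpleClosedCurve g) (R : ℝ) :
    ContDiff ℝ ∞ (arcVelocity R g) := by
  have h1 : ContDiff ℝ ∞ fun p : ℝ × ℝ => ((p.2 / R : ℝ) : ℂ) :=
    Complex.ofRealCLM.contDiff.comp (contDiff_snd.div_const R)
  exact (h.contDiff_unitTangent.comp contDiff_fst).mul (h1.mul contDiff_const).cexp

theorem contDiff_larmorCenter (h : IsSmoothSimpleClosedCurve g) (R : ℝ) :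
    ContDiff ℝ ∞ (larmorCenter R g) :=
  h.smooth.add (contDiff_const.mul (contDiff_const.mul h.contDiff_unitTangent))

theorem contDiff_larmorArc (h : IsSmoothSimpleClosedCurve g) (R : ℝ) :
    ContDiff ℝ ∞ (larmorArc R g) :=
  ((h.contDiff_larmorCenter R).comp contDiff_fst).sub
    (contDiff_const.mul (contDiff_const.mul (h.contDiff_arcVelocity R)))

theorem hasFDerivAt_larmorArc (h : IsSmoothSimpleClosedCurve g) (hR : 0 < R) (p : ℝ × ℝ) :
    HasFDerivAt (larmorArc R g)
      ((ContinuousLinearMap.fst ℝ ℝ ℝ).smulRight (arcVariation R g p) +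
        (ContinuousLinearMap.snd ℝ ℝ ℝ).smulRight (arcVelocity R g p)) p := by
  have h1 := (h.hasDerivAt_larmorCenter R p.1).hasFDerivAt.comp p
    (hasFDerivAt_fst (𝕜 := ℝ) (E := ℝ) (F := ℝ) (p := p))
  have h2 := (h.hasDerivAt_unitTangent p.1).hasFDerivAt.comp p
    (hasFDerivAt_fst (𝕜 := ℝ) (E := ℝ) (F := ℝ) (p := p))
  have h3 : HasDerivAt (fun s : ℝ => Complex.exp ((s / R : ℝ) * Complex.I))
      (Complex.exp ((p.2 / R : ℝ) * Complex.I) * ((1 / R : ℝ) * Complex.I)) p.2 :=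
    ((((hasDerivAt_id p.2).div_const R).ofReal_comp).mul_const Complex.I).cexp
  have h4 := h3.hasFDerivAt.comp p (hasFDerivAt_snd (𝕜 := ℝ) (E := ℝ) (F := ℝ) (p := p))
  have h5 := h1.sub (((h2.mul h4).const_mul Complex.I).const_mul (R : ℂ))
  refine h5.congr_fderiv ?_
  have hR' : (R : ℂ) ≠ 0 := by exact_mod_cast hR.ne'
  ext
  · simp [arcVariation, arcVelocity]
    linear_combination (-(R * (turningRate g p.1) * unitTangent g p.1 *
      Complex.exp (↑p.2 / ↑R * Complex.I) : ℂ)) * Complex.I_sq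
  · simp [arcVelocity]
    field_simp
    linear_combination (-(unitTangent g p.1)) * Complex.I_sq

end IsSmoothSimpleClosedCurve

namespace IsObstacle

variable {R ε : ℝ} {g : ℝ → ℂ}

/-- The distances of a point on the normal at `g t` from the Larmor center and from `g t`. -/
theorem sub_larmorCenter_of_orthogonal (h : IsObstacle R g ε) {t : ℝ} {z : ℂ}
    (h0 : inner ℝ (unitTangent g t) (z - g t) = 0) :
    ‖z - larmorCenter R g t‖ = |cross (unitTangent g t) (z - g t) - R| ∧
      ‖z - g t‖ = |cross (unitTangent g t) (z - g t)| := by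
  have h1 := h.sub_larmorCenter t z
  have h2 := norm_sq_eq_inner_sq_add_cross_sq (h.norm_unitTangent t) (z - g t)
  rw [h0] at h1 h2
  constructor
  · rw [← abs_of_nonneg (norm_nonneg (z - _)), ← sq_eq_sq_iff_abs_eq_abs]; linarith
  · rw [← abs_of_nonneg (norm_nonneg (z - _)), ← sq_eq_sq_iff_abs_eq_abs]; linarith

/-- Seen from the point of the curve nearest to `z`, the point `z` lies outside the Larmor disc in
the counterclockwise case and inside in the clockwise case. -/
theorem exists_nearest (h : IsObstacle R g ε) {z : ℂ} (hz : z ∉ convexHull ℝ (Set.range g))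
    (hd : ∀ t, ‖z - g t‖ < 2 * R) : ∃ t, 0 < ε * (‖z - larmorCenter R g t‖ ^ 2 - R ^ 2) := by
  have hR := h.pos
  obtain ⟨y, hy, hmin⟩ := h.isCompact_hull.exists_isMinOn (f := fun y => ‖z - y‖)
    ⟨g 0, IsConvexClosedCurve.mem_hull g 0⟩ (by fun_prop)
  have hmin : ∀ x ∈ convexHull ℝ (Set.range g), ‖z - y‖ ≤ ‖z - x‖ := fun x hx => hmin hx
  have hineq : ∀ x ∈ convexHull ℝ (Set.range g), inner ℝ (z - y) (x - y) ≤ 0 := by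
    intro x hx
    by_contra! hpos
    have hn : ∀ μ ∈ Set.Ioo (0 : ℝ) 1, 2 * inner ℝ (z - y) (x - y) ≤ μ * ‖x - y‖ ^ 2 := by
      intro μ hμ
      have h1 := hmin (y + μ • (x - y)) ((convex_convexHull ℝ _).add_smul_sub_mem hy hx
        ⟨hμ.1.le, hμ.2.le⟩)
      have h2 := pow_le_pow_left₀ (norm_nonneg _) h1 2
      rw [show z - (y + μ • (x - y)) = (z - y) - μ • (x - y) by abel, norm_sub_sq_real (z - y),
        inner_smul_right, norm_smul, Real.norm_of_nonneg hμ.1.le] at h2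
      have := hμ.1
      by_contra! hc
      nlinarith
    have ht : Filter.Tendsto (fun μ : ℝ => μ * ‖x - y‖ ^ 2) (nhdsWithin 0 (Set.Ioi 0))
        (nhds (0 * ‖x - y‖ ^ 2)) :=
      (Continuous.tendsto (by fun_prop) 0).mono_left nhdsWithin_le_nhds
    have := ge_of_tendsto ht (Filter.mem_of_superset (Ioo_mem_nhdsGT one_pos) hn)
    linarith
  rcases h.mem_hull_iff.1 hy with hin | ⟨t, rfl⟩
  · exfalso
    obtain ⟨δ, hδ, hball⟩ := Metric.isOpen_iff.1 isOpen_interior y hin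
    have hzy : z - y ≠ 0 := fun h0 => hz (by rw [sub_eq_zero.1 h0]; exact hy)
    have hn := norm_pos_iff.2 hzy
    have h1 := hineq (y + (δ / (2 * ‖z - y‖)) • (z - y)) (interior_subset (hball (by
      rw [Metric.mem_ball, dist_eq_norm, add_sub_cancel_left, norm_smul,
        Real.norm_of_nonneg (by positivity)]
      field_simp; linarith)))
    rw [add_sub_cancel_left, inner_smul_right, real_inner_self_eq_norm_sq] at h1
    have : 0 < δ / (2 * ‖z - y‖) * ‖z - y‖ ^ 2 := by positivity
    linarith
  · refine ⟨t, ?_⟩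
    have hmin' : IsLocalMin (fun s => ‖z - g s‖ ^ 2) t := Filter.Eventually.of_forall fun s =>
      pow_le_pow_left₀ (norm_nonneg _) (hmin (g s) (IsConvexClosedCurve.mem_hull g s)) 2
    have h1 := hmin'.hasDerivAt_eq_zero ((h.hasDerivAt t).const_sub z).norm_sq
    rw [h.deriv_eq, inner_neg_right, ← Complex.real_smul, inner_smul_right,
      real_inner_comm] at h1
    have h0 : inner ℝ (unitTangent g t) (z - g t) = 0 := by
      have := h.speed_pos t
      rcases mul_eq_zero.1 h1 with h1 | h1
      · norm_num at h1
      · rcases mul_eq_zero.1 (neg_eq_zero.1 h1) with h1 | h1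
        · linarith
        · exact h1
    obtain ⟨e1, e2⟩ := h.sub_larmorCenter_of_orthogonal h0
    obtain ⟨x, hx⟩ := h.insideOf_nonempty
    have h2 := hineq x (interior_subset hx)
    have h3 := h.side_unitTangent t hx
    have h4 := eq_inner_add_cross (h.norm_unitTangent t) (z - g t)
    rw [h0] at h4
    have h5 : inner ℝ (z - g t) (x - g t) =
        cross (unitTangent g t) (z - g t) * cross (unitTangent g t) (x - g t) := by
      rw [h4]
      simp only [Complex.ofReal_zero, zero_mul, zero_add, ← Complex.real_smul, inner_smul_left,
        inner_I_mul_left, starRingEnd_apply, star_trivial]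
      rw [Complex.real_smul, cross_smul_right, cross_I_mul_right, real_inner_self_eq_norm_sq,
        h.norm_unitTangent]
      ring
    have h6 : cross (unitTangent g t) (z - g t) ≠ 0 := fun h7 => by
      rw [h7, abs_zero, norm_eq_zero, sub_eq_zero] at e2
      exact hz (e2 ▸ hy)
    have h7 := hd t
    rw [h5] at h2
    rw [e2] at h7
    rw [e1, sq_abs]
    set d := cross (unitTangent g t) (z - g t)
    set q := cross (unitTangent g t) (x - g t)
    rcases h.sign with rfl | rfl
    · have : d < 0 := lt_of_le_of_ne (by nlinarith) h6
      nlinarith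
    · have : 0 < d := lt_of_le_of_ne (by nlinarith) h6.symm
      rw [abs_of_pos this] at h7
      nlinarith

/-- Seen from the point of the curve farthest from `z`, the point `z` lies inside the Larmor disc
in the counterclockwise case and outside in the clockwise case. -/
theorem exists_farthest (h : IsObstacle R g ε) {z : ℂ} (hd : ∀ t, ‖z - g t‖ < 2 * R) :
    ∃ t, ε * (‖z - larmorCenter R g t‖ ^ 2 - R ^ 2) < 0 := by
  have hR := h.pos
  obtain ⟨_, ⟨t, rfl⟩, hmax⟩ := h.isCompact_range.exists_isMaxOn (f := fun y => ‖z - y‖)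
    ⟨g 0, 0, rfl⟩ (by fun_prop)
  have hmax : ∀ s, ‖z - g s‖ ≤ ‖z - g t‖ := fun s => hmax ⟨s, rfl⟩
  have hmaxK : ∀ x ∈ convexHull ℝ (Set.range g), ‖z - x‖ ≤ ‖z - g t‖ := by
    intro x hx
    have : convexHull ℝ (Set.range g) ⊆ Metric.closedBall z ‖z - g t‖ :=
      convexHull_min (by rintro _ ⟨s, rfl⟩; simpa [dist_eq_norm, norm_sub_rev] using hmax s)
        (convex_closedBall _ _)
    simpa [dist_eq_norm, norm_sub_rev] using this hx
  refine ⟨t, ?_⟩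
  have hmax' : IsLocalMax (fun s => ‖z - g s‖ ^ 2) t := Filter.Eventually.of_forall fun s =>
    pow_le_pow_left₀ (norm_nonneg _) (hmax s) 2
  have h1 := hmax'.hasDerivAt_eq_zero ((h.hasDerivAt t).const_sub z).norm_sq
  rw [h.deriv_eq, inner_neg_right, ← Complex.real_smul, inner_smul_right, real_inner_comm] at h1
  have h0 : inner ℝ (unitTangent g t) (z - g t) = 0 := by
    have := h.speed_pos t
    rcases mul_eq_zero.1 h1 with h1 | h1
    · norm_num at h1
    · rcases mul_eq_zero.1 (neg_eq_zero.1 h1) with h1 | h1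
      · linarith
      · exact h1
  obtain ⟨e1, e2⟩ := h.sub_larmorCenter_of_orthogonal h0
  obtain ⟨x, hx⟩ := h.insideOf_nonempty
  have h2 := pow_le_pow_left₀ (norm_nonneg _) (hmaxK x (interior_subset hx)) 2
  have h3 := h.side_unitTangent t hx
  have h4 := norm_sq_eq_inner_sq_add_cross_sq (h.norm_unitTangent t) (z - x)
  have h5 : cross (unitTangent g t) (z - x) =
      cross (unitTangent g t) (z - g t) - cross (unitTangent g t) (x - g t) := by
    rw [← cross_sub_right]; congr 1; ring
  have h7 := hd t
  rw [e2, sq_abs, h4, h5] at h2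
  rw [e2] at h7
  rw [e1, sq_abs]
  set d := cross (unitTangent g t) (z - g t)
  set q := cross (unitTangent g t) (x - g t)
  have h8 : q ^ 2 ≤ 2 * d * q := by nlinarith [sq_nonneg (inner ℝ (unitTangent g t) (z - x))]
  rcases h.sign with rfl | rfl
  · have : 0 < d := by by_contra! hc; nlinarith
    rw [abs_of_pos this] at h7
    nlinarith
  · have : d < 0 := by by_contra! hc; nlinarith
    nlinarith

/-- From a point outside the region and at distance less than `2 * R` from all points of the curve
there is a Larmor arc, shorter than a half circle, tangent to the curve; it arrives at the point
if `ς = 1` and departs from it if `ς = -1`. -/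
theorem exists_larmorArc_eq (h : IsObstacle R g ε) {z : ℂ}
    (hz : z ∉ convexHull ℝ (Set.range g)) (hd : ∀ t, ‖z - g t‖ < 2 * R) {ς : ℝ}
    (hς : ς = 1 ∨ ς = -1) :
    ∃ t s, 0 < ς * s ∧ |s| < Real.pi * R ∧ larmorArc R g (t, s) = z := by
  have hR := h.pos
  have hπ := Real.pi_pos
  set f : ℝ → ℝ := fun t => ‖z - larmorCenter R g t‖ ^ 2 - R ^ 2 with hf
  have hfd : ∀ t, HasDerivAt f _ t := fun t =>
    (h.hasDerivAt_norm_sq_sub_larmorCenter z t).sub_const (R ^ 2)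
  have hper : Function.Periodic f 1 := fun t => by simp only [hf, h.larmorCenter_periodic R t]
  obtain ⟨a, ha⟩ := h.exists_farthest hd
  obtain ⟨b, hb⟩ := h.exists_nearest hz hd
  -- a zero of `f` at which the sign of the derivative is the one wanted
  obtain ⟨c, hc0, hc⟩ : ∃ c, f c = 0 ∧ 0 ≤ ς * (ε * (-2 * (speed g c - R * turningRate g c) *
      inner ℝ (unitTangent g c) (z - larmorCenter R g c))) := by
    rcases hς with rfl | rfl
    · obtain ⟨c, hc0, hc⟩ := exists_zero_of_periodic (fun t => (hfd t).const_mul ε)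
        (fun t => by simp only [hper t]) ha hb
      refine ⟨c, ?_, by simpa using hc⟩
      rcases h.sign with rfl | rfl <;> simpa using hc0
    · obtain ⟨c, hc0, hc⟩ := exists_zero_of_periodic (fun t => ((hfd t).const_mul ε).fun_neg)
        (fun t => by simp only [hper t]) (neg_lt_zero.2 hb) (neg_pos.2 ha)
      refine ⟨c, ?_, by simpa using hc⟩
      rcases h.sign with rfl | rfl <;> simpa using hc0
  -- `z` lies on the Larmor circle of `c`; its position there is given by an angle `φ`, whose sign
  -- is the sign of the derivative of `f`
  have hn : ‖z - larmorCenter R g c‖ = R :=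
    (sq_eq_sq₀ (norm_nonneg _) hR.le).1 (by simp only [hf] at hc0; linarith)
  have hτ := h.norm_unitTangent c
  have hτ0 : unitTangent g c ≠ 0 := fun h0 => by rw [h0] at hτ; simp at hτ
  have hR' : (R : ℂ) ≠ 0 := by exact_mod_cast hR.ne'
  set w : ℂ := (larmorCenter R g c - z) / (R * (Complex.I * unitTangent g c)) with hw
  have hwn : ‖w‖ = 1 := by
    rw [hw, norm_div, norm_sub_rev, hn]
    simp [hτ, abs_of_pos hR, hR.ne']
  have hwe : w = Complex.exp (Complex.arg w * Complex.I) := by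
    have := Complex.norm_mul_exp_arg_mul_I w
    rw [hwn] at this
    simpa using this.symm
  set φ := Complex.arg w
  have hzE : larmorArc R g (c, R * φ) = z := by
    rw [larmorArc, arcVelocity]
    simp only [mul_div_cancel_left₀ φ hR.ne']
    rw [← hwe, hw]
    field_simp
    ring
  have hin : inner ℝ (unitTangent g c) (z - larmorCenter R g c) = R * Real.sin φ := by
    have h1 : z - larmorCenter R g c = -(R * (Complex.I * arcVelocity R g (c, R * φ))) := by
      rw [← hzE, larmorArc]; ring
    have h2 := h.cross_unitTangent_arcVelocity R (c, R * φ)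
    simp only [mul_div_cancel_left₀ φ hR.ne'] at h2
    rw [h1, inner_neg_right, ← Complex.real_smul, inner_smul_right, real_inner_comm,
      inner_I_mul_left, cross_comm, h2]
    ring
  rw [hin] at hc
  have hcurv := h.curved c
  have hsin : 0 ≤ ς * Real.sin φ := by
    have h1 : ς * (ε * (-2 * (speed g c - R * turningRate g c) * (R * Real.sin φ))) =
      (2 * R * (ε * (R * turningRate g c - speed g c))) * (ς * Real.sin φ) := by ring
    rw [h1] at hc
    exact nonneg_of_mul_nonneg_right hc (by positivity)
  have hφ1 := Complex.neg_pi_lt_arg w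
  have hφ2 := Complex.arg_le_pi w
  change -Real.pi < φ at hφ1
  change φ ≤ Real.pi at hφ2
  have hφ0 : φ ≠ 0 := fun h0 => by
    rw [h0, mul_zero, larmorArc_zero] at hzE
    exact hz (hzE ▸ IsConvexClosedCurve.mem_hull g c)
  -- a half circle would bring `z` to the distance `2 * R` from the contact
  have hφπ : φ ≠ Real.pi := fun h0 => by
    have h1 := hd c
    have h2 : z - g c = 2 * R * (Complex.I * unitTangent g c) := by
      rw [← hzE, larmorArc, larmorCenter, arcVelocity]
      simp only [mul_div_cancel_left₀ φ hR.ne']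
      rw [h0, Complex.exp_pi_mul_I]
      ring
    rw [h2] at h1
    simp [hτ, abs_of_pos hR] at h1
  have hφπ' : φ < Real.pi := lt_of_le_of_ne hφ2 hφπ
  refine ⟨c, R * φ, ?_, ?_, hzE⟩
  · rcases hς with rfl | rfl
    · have : 0 < φ := by
        by_contra! hcon
        have := Real.sin_neg_of_neg_of_neg_pi_lt (lt_of_le_of_ne hcon hφ0) hφ1
        linarith
      simp only [one_mul]; positivity
    · have : φ < 0 := by
        by_contra! hcon
        have := Real.sin_pos_of_pos_of_lt_pi (lt_of_le_of_ne hcon hφ0.symm) hφπ'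
        linarith
      nlinarith
  · rw [abs_mul, abs_of_pos hR, mul_comm]
    exact mul_lt_mul_of_pos_right (abs_lt.2 ⟨hφ1, hφπ'⟩) hR

end IsObstacle


/-! ### Uniqueness of tangent arcs and local coordinates -/

theorem eq_of_exp_mul_I_eq {x y : ℝ} (hxy : |x - y| < 2 * Real.pi)
    (h : Complex.exp (x * Complex.I) = Complex.exp (y * Complex.I)) : x = y := by
  obtain ⟨n, hn⟩ := Complex.exp_eq_exp_iff_exists_int.1 h
  have h1 : x = y + n * (2 * Real.pi) := by
    have h2 : (x : ℂ) * Complex.I = ((y + n * (2 * Real.pi) : ℝ) : ℂ) * Complex.I := by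
      rw [hn]; push_cast; ring
    exact_mod_cast mul_right_cancel₀ Complex.I_ne_zero h2
  have h3 : n = 0 := by
    rw [h1, add_sub_cancel_left, abs_mul, abs_of_pos Real.two_pi_pos] at hxy
    have h4 : |(n : ℝ)| < 1 := by
      by_contra! hc
      nlinarith [Real.two_pi_pos]
    have h5 : |n| < 1 := by exact_mod_cast h4
    exact Int.abs_lt_one_iff.1 h5
  rw [h1, h3]; simp

/-- The variant of `eq_sub_of_sin_le` for two angles of the same sign. -/
theorem eq_sub_of_mul_sin_le {a b η : ℝ} (hab : 0 < a * b) (ha : |a| < Real.pi / 2)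
    (hb : |b| < Real.pi / 2) (hη : |η| ≤ Real.pi)
    (h1 : Real.sin a * (Real.sin a - Real.sin (b - η)) ≤ 0)
    (h2 : Real.sin b * (Real.sin b - Real.sin (a - -η)) ≤ 0) : η = b - a := by
  rw [abs_lt] at ha hb
  rcases pos_and_pos_or_neg_and_neg_of_mul_pos hab with ⟨ha0, hb0⟩ | ⟨ha0, hb0⟩
  · have sa : 0 < Real.sin a := Real.sin_pos_of_pos_of_lt_pi ha0 (by linarith)
    have sb : 0 < Real.sin b := Real.sin_pos_of_pos_of_lt_pi hb0 (by linarith)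
    have i1 := nonpos_of_mul_nonpos_right h1 sa
    have i2 := nonpos_of_mul_nonpos_right h2 sb
    rw [sub_neg_eq_add] at i2
    exact eq_sub_of_sin_le ha0 ha.2 hb0 hb.2 hη (by linarith) (by linarith)
  · have sa : Real.sin a < 0 := Real.sin_neg_of_neg_of_neg_pi_lt ha0 (by linarith)
    have sb : Real.sin b < 0 := Real.sin_neg_of_neg_of_neg_pi_lt hb0 (by linarith)
    have i1 := nonneg_of_mul_nonpos_right h1 sa
    have i2 := nonneg_of_mul_nonpos_right h2 sb
    have := eq_sub_of_sin_le (a := -a) (b := -b) (η := -η) (by linarith) (by linarith)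
      (by linarith) (by linarith) (by rwa [abs_neg])
      (by rw [show -b - -η = -(b - η) by ring, Real.sin_neg, Real.sin_neg]; linarith)
      (by rw [show -a + -η = -(a - -η) by ring, Real.sin_neg, Real.sin_neg]; linarith)
    linarith

/-- The variant of `eq_zero_and_eq_of_sin_sq_le` for two angles of the same sign. -/
theorem eq_zero_and_eq_of_sin_sq_le' {a b η : ℝ} (hab : 0 < a * b) (ha : |a| < Real.pi / 2)
    (hb : |b| < Real.pi / 2) (hη : |η| ≤ Real.pi)
    (h1 : Real.sin b ^ 2 ≤ Real.sin a * Real.sin (η + b))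
    (h2 : Real.sin a ^ 2 ≤ Real.sin b * Real.sin (a - η)) : η = 0 ∧ a = b := by
  rw [abs_lt] at ha hb
  rcases pos_and_pos_or_neg_and_neg_of_mul_pos hab with ⟨ha0, hb0⟩ | ⟨ha0, hb0⟩
  · exact eq_zero_and_eq_of_sin_sq_le ha0 ha.2 hb0 hb.2 hη h1 h2
  · have := eq_zero_and_eq_of_sin_sq_le (a := -a) (b := -b) (η := -η) (by linarith)
      (by linarith) (by linarith) (by linarith) (by rwa [abs_neg])
      (by rw [show -η + -b = -(η + b) by ring, Real.sin_neg, Real.sin_neg, Real.sin_neg]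
          linarith)
      (by rw [show -a - -η = -(a - η) by ring, Real.sin_neg, Real.sin_neg, Real.sin_neg]
          linarith)
    constructor <;> linarith

theorem inner_ofReal_mul_right (k : ℝ) (v x : ℂ) :
    inner ℝ v ((k : ℂ) * x) = k * inner ℝ v x := by
  rw [← Complex.real_smul, inner_smul_right]

/-- Two Larmor arcs lead from contacts on the curve to the same point; their half-angles are `b` and
`a`, and their chords have the lengths `2 * R * sin b`, `2 * R * sin a` and the directions `m`,
`m * exp (η * I)`. Then `D` is the vector from the first contact to the second, and `τ` is the
tangent vector at the first. The identities give the position of the second contact relative to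
the tangent line and to the Larmor circle of the first. -/
theorem chord_identities {m τ D : ℂ} {R a b η : ℝ} (hm : ‖m‖ = 1)
    (hτ : τ = m * Complex.exp ((-b : ℝ) * Complex.I))
    (hD : D = (2 * R : ℝ) * (m * (Real.sin b - Real.sin a * Complex.exp (η * Complex.I)))) :
    cross τ D = 2 * R * (Real.sin b ^ 2 - Real.sin a * Real.sin (η + b)) ∧
      inner ℝ τ D ^ 2 + (cross τ D - R) ^ 2 - R ^ 2 =
        4 * R ^ 2 * (Real.sin a * (Real.sin a - Real.sin (b - η))) := by
  have h1 : cross τ D = 2 * R * (Real.sin b ^ 2 - Real.sin a * Real.sin (η + b)) := by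
    rw [hτ, hD, cross_smul_right, cross_mul_mul, hm, cross, Complex.exp_ofReal_mul_I_re,
      Complex.exp_ofReal_mul_I_im]
    simp only [Complex.sub_re, Complex.sub_im, Complex.ofReal_re, Complex.ofReal_im,
      Complex.re_ofReal_mul, Complex.im_ofReal_mul, Complex.exp_ofReal_mul_I_re,
      Complex.exp_ofReal_mul_I_im, Real.cos_neg, Real.sin_neg, Real.sin_add]
    ring
  have h2 : inner ℝ τ D =
      2 * R * (Real.sin b * Real.cos b - Real.sin a * Real.cos (η + b)) := by
    rw [hτ, hD, inner_ofReal_mul_right, inner_mul_mul, hm, inner_eq_re,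
      Complex.exp_ofReal_mul_I_re, Complex.exp_ofReal_mul_I_im]
    simp only [Complex.sub_re, Complex.sub_im, Complex.ofReal_re, Complex.ofReal_im,
      Complex.re_ofReal_mul, Complex.im_ofReal_mul, Complex.exp_ofReal_mul_I_re,
      Complex.exp_ofReal_mul_I_im, Real.cos_neg, Real.sin_neg, Real.cos_add]
    ring
  refine ⟨h1, ?_⟩
  rw [h1, h2, Real.sin_add, Real.cos_add, Real.sin_sub]
  have e1 := Real.sin_sq_add_cos_sq b
  have e2 := Real.sin_sq_add_cos_sq η
  set sb := Real.sin b
  set cb := Real.cos b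
  set sa := Real.sin a
  set se := Real.sin η
  set ce := Real.cos η
  linear_combination (4 * R ^ 2 * (sb ^ 2 + sa ^ 2 * (ce ^ 2 + se ^ 2) - 2 * sa * sb * ce)) * e1 +
    4 * R ^ 2 * sa ^ 2 * e2

namespace IsObstacle

variable {R ε : ℝ} {g : ℝ → ℂ}

theorem disc_nonneg (h : IsObstacle R g ε) (t : ℝ) {z : ℂ}
    (hz : z ∈ convexHull ℝ (Set.range g)) : 0 ≤ ε * (R - ‖z - larmorCenter R g t‖) := by
  by_cases hzt : z = g t
  · rw [hzt, h.norm_sub_larmorCenter]; simp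
  · exact (h.disc t hz hzt).le

/-- Two short Larmor arcs to the same point, both arriving or both departing, coincide. -/
theorem larmorArc_unique (h : IsObstacle R g ε) {t s t' s' : ℝ} (hs : |s| < Real.pi * R)
    (hs' : |s'| < Real.pi * R) (hss : 0 < s * s')
    (heq : larmorArc R g (t, s) = larmorArc R g (t', s')) : (∃ k : ℤ, t = t' + k) ∧ s = s' := by
  have hR := h.pos
  have hπ := Real.pi_pos
  have hR' : (R : ℂ) ≠ 0 := by exact_mod_cast hR.ne'
  -- the half-angles `b`, `a` of the arcs, the directions `m`, `m'` of their chords, and the angle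
  -- `η` from the first direction to the second
  obtain ⟨b, hb⟩ : ∃ b, b = s / (2 * R) := ⟨_, rfl⟩
  obtain ⟨a, ha⟩ : ∃ a, a = s' / (2 * R) := ⟨_, rfl⟩
  have hsb : s / R = 2 * b := by rw [hb]; field_simp
  have hsa : s' / R = 2 * a := by rw [ha]; field_simp
  obtain ⟨m, hm⟩ : ∃ m, m = unitTangent g t * Complex.exp (b * Complex.I) := ⟨_, rfl⟩
  obtain ⟨m', hm'⟩ : ∃ m', m' = unitTangent g t' * Complex.exp (a * Complex.I) := ⟨_, rfl⟩
  have hmn : ‖m‖ = 1 := by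
    rw [hm, norm_mul, h.norm_unitTangent, Complex.norm_exp_ofReal_mul_I, one_mul]
  have hmn' : ‖m'‖ = 1 := by
    rw [hm', norm_mul, h.norm_unitTangent, Complex.norm_exp_ofReal_mul_I, one_mul]
  have hm0 : m ≠ 0 := fun h0 => by rw [h0] at hmn; simp at hmn
  obtain ⟨η, hη⟩ : ∃ η, η = Complex.arg (m' / m) := ⟨_, rfl⟩
  have hηπ : |η| ≤ Real.pi := hη ▸ Complex.abs_arg_le_pi _
  have hmm : m' = m * Complex.exp (η * Complex.I) := by
    have h1 := Complex.norm_mul_exp_arg_mul_I (m' / m)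
    rw [norm_div, hmn, hmn', ← hη] at h1
    simp only [div_one, Complex.ofReal_one, one_mul] at h1
    rw [h1]; field_simp
  have hmm' : m = m' * Complex.exp ((-η : ℝ) * Complex.I) := by
    rw [hmm, mul_assoc, ← Complex.exp_add]; simp
  have hτ : unitTangent g t = m * Complex.exp ((-b : ℝ) * Complex.I) := by
    rw [hm, mul_assoc, ← Complex.exp_add]; simp
  have hτ' : unitTangent g t' = m' * Complex.exp ((-a : ℝ) * Complex.I) := by
    rw [hm', mul_assoc, ← Complex.exp_add]; simp
  have hv : arcVelocity R g (t, s) = m * Complex.exp (b * Complex.I) := by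
    simp only [arcVelocity]
    rw [hm, mul_assoc, ← Complex.exp_add, hsb]; push_cast; ring_nf
  have hv' : arcVelocity R g (t', s') = m' * Complex.exp (a * Complex.I) := by
    simp only [arcVelocity]
    rw [hm', mul_assoc, ← Complex.exp_add, hsa]; push_cast; ring_nf
  have esin : ∀ x : ℝ, Complex.exp (x * Complex.I) - Complex.exp ((-x : ℝ) * Complex.I) =
      2 * Real.sin x * Complex.I := fun x => by
    rw [Complex.exp_mul_I, Complex.exp_mul_I]; push_cast
    rw [Complex.cos_neg, Complex.sin_neg]; ring
  have hD : g t' - g t = (2 * R : ℝ) * (m * (Real.sin b - Real.sin a *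
      Complex.exp (η * Complex.I))) := by
    have h1 := heq
    simp only [larmorArc, larmorCenter, hv, hv'] at h1
    rw [hτ, hτ'] at h1
    have e1 := esin a
    have e2 := esin b
    push_cast at e1 e2 h1 ⊢
    rw [hmm] at h1
    linear_combination -h1 + (R * Complex.I * (m * Complex.exp (η * Complex.I))) * e1 -
      (R * Complex.I * m) * e2 + (2 * R * m * (Complex.exp (η * Complex.I) * Complex.sin a -
        Complex.sin b)) * Complex.I_sq
  have hD' : g t - g t' = (2 * R : ℝ) * (m' * (Real.sin a - Real.sin b *
      Complex.exp ((-η : ℝ) * Complex.I))) := by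
    have h1 : m' * Complex.exp ((-η : ℝ) * Complex.I) = m := hmm'.symm
    rw [← neg_sub, hD]
    push_cast at h1 ⊢
    linear_combination (2 * R * Complex.sin b : ℂ) * h1 - (2 * R * Complex.sin a : ℂ) * hmm
  obtain ⟨c1, d1⟩ := chord_identities hmn hτ hD
  obtain ⟨c2, d2⟩ := chord_identities hmn' hτ' hD'
  have hab : 0 < a * b := by
    rw [ha, hb]
    have : s' / (2 * R) * (s / (2 * R)) = s * s' / (4 * R ^ 2) := by
      field_simp; ring
    rw [this]; positivity
  have ha2 : |a| < Real.pi / 2 := by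
    rw [ha, abs_div, abs_of_pos (by positivity : 0 < 2 * R), div_lt_iff₀ (by positivity)]
    linarith
  have hb2 : |b| < Real.pi / 2 := by
    rw [hb, abs_div, abs_of_pos (by positivity : 0 < 2 * R), div_lt_iff₀ (by positivity)]
    linarith
  rw [abs_lt] at ha2 hb2
  have hsame : g t = g t' ∧ m * Complex.exp (b * Complex.I) = m' * Complex.exp (a * Complex.I) := by
    have center : m * Complex.exp (b * Complex.I) = m' * Complex.exp (a * Complex.I) →
        larmorCenter R g t = larmorCenter R g t' := fun h1 => by
      have h2 := heq
      simp only [larmorArc, hv, hv', h1] at h2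
      exact sub_left_injective h2
    rcases h.sign with rfl | rfl
    · -- each contact lies in the Larmor disc of the other
      have i1 : Real.sin a * (Real.sin a - Real.sin (b - η)) ≤ 0 := by
        have h1 := h.disc_nonneg t (IsConvexClosedCurve.mem_hull g t')
        have h2 := h.sub_larmorCenter t (g t')
        have h3 := pow_le_pow_left₀ (norm_nonneg _) (by linarith : _ ≤ R) 2
        by_contra! hc
        have : 0 < 4 * R ^ 2 * (Real.sin a * (Real.sin a - Real.sin (b - η))) := by positivity
        linarith
      have i2 : Real.sin b * (Real.sin b - Real.sin (a - -η)) ≤ 0 := by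
        have h1 := h.disc_nonneg t' (IsConvexClosedCurve.mem_hull g t)
        have h2 := h.sub_larmorCenter t' (g t)
        have h3 := pow_le_pow_left₀ (norm_nonneg _) (by linarith : _ ≤ R) 2
        by_contra! hc
        have : 0 < 4 * R ^ 2 * (Real.sin b * (Real.sin b - Real.sin (a - -η))) := by positivity
        linarith
      have hres : η = b - a :=
        eq_sub_of_mul_sin_le hab (abs_lt.2 ha2) (abs_lt.2 hb2) hηπ i1 i2
      have hvv : m * Complex.exp (b * Complex.I) = m' * Complex.exp (a * Complex.I) := by
        rw [hmm, mul_assoc, ← Complex.exp_add, hres]; push_cast; ring_nf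
      refine ⟨?_, hvv⟩
      refine h.eq_of_norm_sub_larmorCenter (IsConvexClosedCurve.mem_hull g t) ?_
      rw [← center hvv, h.norm_sub_larmorCenter]
    · -- each contact lies on the right of the tangent line at the other
      have i1 : Real.sin b ^ 2 ≤ Real.sin a * Real.sin (η + b) := by
        have h1 := h.side_nonneg t (IsConvexClosedCurve.mem_hull g t')
        rw [c1] at h1
        by_contra! hc
        have : 0 < 2 * R * (Real.sin b ^ 2 - Real.sin a * Real.sin (η + b)) :=
          mul_pos (by positivity) (by linarith)
        linarith
      have i2 : Real.sin a ^ 2 ≤ Real.sin b * Real.sin (a - η) := by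
        have h1 := h.side_nonneg t' (IsConvexClosedCurve.mem_hull g t)
        rw [c2, neg_add_eq_sub] at h1
        by_contra! hc
        have : 0 < 2 * R * (Real.sin a ^ 2 - Real.sin b * Real.sin (a - η)) :=
          mul_pos (by positivity) (by linarith)
        linarith
      obtain ⟨r1, r2⟩ : η = 0 ∧ a = b :=
        eq_zero_and_eq_of_sin_sq_le' hab (abs_lt.2 ha2) (abs_lt.2 hb2) hηπ i1 i2
      have hmm2 : m' = m := by rw [hmm, r1]; simp
      have hvv : m * Complex.exp (b * Complex.I) = m' * Complex.exp (a * Complex.I) := by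
        rw [hmm2, r2]
      refine ⟨?_, hvv⟩
      have h1 := center hvv
      have h2 : unitTangent g t = unitTangent g t' := by rw [hτ, hτ', hmm2, r2]
      simpa [larmorCenter, h2] using h1
  obtain ⟨k, hk⟩ := h.eq_add_int hsame.1
  refine ⟨⟨k, hk⟩, ?_⟩
  have h1 : unitTangent g t = unitTangent g t' := by
    have := h.unitTangent_periodic.int_mul k t'
    rw [hk, ← this, mul_one]
  have h2 := hsame.2
  rw [← hv, ← hv', arcVelocity, arcVelocity, h1] at h2
  have hτ0 : unitTangent g t' ≠ 0 := fun h0 => by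
    have := h.norm_unitTangent t'; rw [h0] at this; simp at this
  have h3 := eq_of_exp_mul_I_eq (x := s / R) (y := s' / R) (by
    rw [hsb, hsa, abs_lt]; constructor <;> linarith [ha2.1, ha2.2, hb2.1, hb2.2])
    (mul_left_cancel₀ hτ0 h2)
  field_simp at h3
  exact h3

/-- The Jacobian determinant of `larmorArc R g`. -/
theorem cross_arcVariation_arcVelocity (h : IsObstacle R g ε) (p : ℝ × ℝ) :
    cross (arcVariation R g p) (arcVelocity R g p) =
      (speed g p.1 - R * turningRate g p.1) * Real.sin (p.2 / R) := by
  rw [arcVariation, cross_add_left, cross_smul_left, cross_smul_left, cross_same,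
    h.cross_unitTangent_arcVelocity]
  ring

theorem sin_ne_zero (h : IsObstacle R g ε) {s : ℝ} (hs : s ≠ 0) (hs' : |s| < Real.pi * R) :
    Real.sin (s / R) ≠ 0 := by
  have hR := h.pos
  have h1 : |s / R| < Real.pi := by rwa [abs_div, abs_of_pos hR, div_lt_iff₀ hR]
  rw [abs_lt] at h1
  rcases lt_or_gt_of_ne hs with h0 | h0
  · exact (Real.sin_neg_of_neg_of_neg_pi_lt (div_neg_of_neg_of_pos h0 hR) h1.1).ne
  · exact (Real.sin_pos_of_pos_of_lt_pi (div_pos h0 hR) h1.2).ne'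

theorem cross_arcVariation_ne_zero (h : IsObstacle R g ε) {t s : ℝ} (hs : s ≠ 0)
    (hs' : |s| < Real.pi * R) : cross (arcVariation R g (t, s)) (arcVelocity R g (t, s)) ≠ 0 := by
  rw [h.cross_arcVariation_arcVelocity]
  refine mul_ne_zero (fun h0 => ?_) (h.sin_ne_zero hs hs')
  have := h.curved t
  rw [← neg_sub, show speed g t - R * turningRate g t = 0 from h0] at this
  simp at this

/-- Away from the contact and short of a half circle, `larmorArc R g` is a local diffeomorphism. -/
theorem exists_localInverse (h : IsObstacle R g ε) {t s : ℝ} (hs : s ≠ 0)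
    (hs' : |s| < Real.pi * R) :
    ∃ e : ℂ → ℝ × ℝ, ContDiffAt ℝ ∞ e (larmorArc R g (t, s)) ∧
      e (larmorArc R g (t, s)) = (t, s) ∧
      (∀ᶠ Y in nhds (larmorArc R g (t, s)), larmorArc R g (e Y) = Y) ∧
      ∀ᶠ q in nhds (t, s), e (larmorArc R g q) = q := by
  set L : ℝ × ℝ →L[ℝ] ℂ := (ContinuousLinearMap.fst ℝ ℝ ℝ).smulRight (arcVariation R g (t, s)) +
    (ContinuousLinearMap.snd ℝ ℝ ℝ).smulRight (arcVelocity R g (t, s)) with hL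
  have hc := h.cross_arcVariation_ne_zero (t := t) hs hs'
  have hinj : Function.Injective (L : ℝ × ℝ →ₗ[ℝ] ℂ) := by
    rw [← LinearMap.ker_eq_bot, LinearMap.ker_eq_bot']
    rintro ⟨x, y⟩ hxy
    have h0 : (x : ℂ) * arcVariation R g (t, s) + (y : ℂ) * arcVelocity R g (t, s) = 0 := by
      simpa [hL] using hxy
    have hx : x = 0 := by
      have := congrArg (fun w => cross w (arcVelocity R g (t, s))) h0
      simp only [cross_add_left, cross_smul_left, cross_same, cross_zero_left, mul_zero,
        add_zero] at this
      exact (mul_eq_zero.1 this).resolve_right hc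
    have hy : y = 0 := by
      have := congrArg (fun w => cross (arcVariation R g (t, s)) w) h0
      simp only [cross_add_right, cross_smul_right, cross_same, cross_zero_right, mul_zero,
        zero_add] at this
      exact (mul_eq_zero.1 this).resolve_right hc
    rw [hx, hy]; rfl
  set Le : (ℝ × ℝ) ≃L[ℝ] ℂ := (LinearMap.linearEquivOfInjective (L : ℝ × ℝ →ₗ[ℝ] ℂ) hinj
    (by simp)).toContinuousLinearEquiv with hLe
  have hd : HasFDerivAt (larmorArc R g) (Le : ℝ × ℝ →L[ℝ] ℂ) (t, s) := by
    refine (h.hasFDerivAt_larmorArc h.pos (t, s)).congr_fderiv ?_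
    ext <;> rfl
  have hcd : ContDiffAt ℝ ∞ (larmorArc R g) (t, s) := (h.contDiff_larmorArc R).contDiffAt
  have hstrict := hcd.hasStrictFDerivAt' hd (by simp)
  exact ⟨hcd.localInverse hd (by simp), hcd.to_localInverse hd (by simp),
    hcd.localInverse_apply_image hd (by simp), hstrict.eventually_right_inverse,
    hstrict.eventually_left_inverse⟩

end IsObstacle

/-! ### The action along the curve and along a tangent arc -/

/-- The derivative `∂L/∂v` of the Lagrangian at the point `x` and the unit vector `v`. -/
noncomputable def momentum (R : ℝ) (x v : ℂ) : ℂ →L[ℝ] ℝ :=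
  innerSL ℝ v + (1 / (2 * R)) • crossCLM.flip x

theorem momentum_apply (R : ℝ) (x v w : ℂ) :
    momentum R x v w = inner ℝ v w + 1 / (2 * R) * cross w x := rfl

/-- The Fenchel inequality for the Lagrangian, which makes each field of extremals a
calibration. -/
theorem momentum_le (R : ℝ) (x : ℂ) {v : ℂ} (hv : ‖v‖ = 1) (w : ℂ) :
    momentum R x v w ≤ magneticLagrangian R x w := by
  rw [momentum_apply, magneticLagrangian]
  have := real_inner_le_norm v w
  rw [hv, one_mul] at this
  linarith

/-- The action of the path that follows the curve from the parameter `0` to the parameter `t`,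
and then the tangent Larmor arc for the time `s` (backwards if `s < 0`). -/
noncomputable def arcPotential (R : ℝ) (g : ℝ → ℂ) (p : ℝ × ℝ) : ℝ :=
  (∫ u in (0 : ℝ)..p.1, magneticLagrangian R (g u) (deriv g u)) + p.2 / 2 +
    1 / (2 * R) * cross (larmorArc R g p - g p.1) (larmorCenter R g p.1)

namespace IsSmoothSimpleClosedCurve

variable {R : ℝ} {g : ℝ → ℂ}

theorem contDiff_lagrangian (h : IsSmoothSimpleClosedCurve g) (R : ℝ) :
    ContDiff ℝ ∞ fun u => magneticLagrangian R (g u) (deriv g u) :=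
  h.contDiff_speed.add (contDiff_const.mul (h.contDiff_deriv.cross h.smooth))

theorem hasDerivAt_integral_lagrangian (h : IsSmoothSimpleClosedCurve g) (R t : ℝ) :
    HasDerivAt (fun t => ∫ u in (0 : ℝ)..t, magneticLagrangian R (g u) (deriv g u))
      (magneticLagrangian R (g t) (deriv g t)) t :=
  ((h.contDiff_lagrangian R).continuous.integral_hasStrictDerivAt 0 t).hasDerivAt

theorem contDiff_arcPotential (h : IsSmoothSimpleClosedCurve g) (R : ℝ) :
    ContDiff ℝ ∞ (arcPotential R g) := by
  have h1 : ContDiff ℝ ∞ fun t => ∫ u in (0 : ℝ)..t, magneticLagrangian R (g u) (deriv g u) := by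
    rw [contDiff_infty_iff_deriv]
    refine ⟨fun t => (h.hasDerivAt_integral_lagrangian R t).differentiableAt, ?_⟩
    rw [show deriv (fun t => ∫ u in (0 : ℝ)..t, magneticLagrangian R (g u) (deriv g u)) = _ from
      funext fun t => (h.hasDerivAt_integral_lagrangian R t).deriv]
    exact h.contDiff_lagrangian R
  exact ((h1.comp contDiff_fst).add (contDiff_snd.div_const 2)).add (contDiff_const.mul
    (((h.contDiff_larmorArc R).sub (h.smooth.comp contDiff_fst)).cross
      ((h.contDiff_larmorCenter R).comp contDiff_fst)))

/-- First variation: the differential of the action is the momentum at the end point. -/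
theorem hasFDerivAt_arcPotential (h : IsSmoothSimpleClosedCurve g) (hR : 0 < R) (p : ℝ × ℝ) :
    HasFDerivAt (arcPotential R g)
      ((momentum R (larmorArc R g p) (arcVelocity R g p)).comp
        ((ContinuousLinearMap.fst ℝ ℝ ℝ).smulRight (arcVariation R g p) +
          (ContinuousLinearMap.snd ℝ ℝ ℝ).smulRight (arcVelocity R g p))) p := by
  have hfst := hasFDerivAt_fst (𝕜 := ℝ) (E := ℝ) (F := ℝ) (p := p)
  have hsnd := hasFDerivAt_snd (𝕜 := ℝ) (E := ℝ) (F := ℝ) (p := p)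
  have h1 := (h.hasDerivAt_integral_lagrangian R p.1).hasFDerivAt.comp p hfst
  have h2 := ((hasDerivAt_id p.2).div_const 2).hasFDerivAt.comp p hsnd
  have h3 := (h.hasFDerivAt_larmorArc hR p).sub ((h.hasDerivAt p.1).hasFDerivAt.comp p hfst)
  have h4 := (h.hasDerivAt_larmorCenter R p.1).hasFDerivAt.comp p hfst
  have h5 := (h1.add h2).add ((h3.cross h4).const_mul (1 / (2 * R)))
  refine h5.congr_fderiv ?_
  have hτ : (unitTangent g p.1).re ^ 2 + (unitTangent g p.1).im ^ 2 = 1 := by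
    have := Complex.sq_norm (unitTangent g p.1)
    rw [h.norm_unitTangent, Complex.normSq_apply] at this; nlinarith
  have hv : (arcVelocity R g p).re ^ 2 + (arcVelocity R g p).im ^ 2 = 1 := by
    have := Complex.sq_norm (arcVelocity R g p)
    rw [h.norm_arcVelocity, Complex.normSq_apply] at this; nlinarith
  have hE : larmorArc R g p = g p.1 + R * (Complex.I * unitTangent g p.1) -
    R * (Complex.I * arcVelocity R g p) := rfl
  have hP : larmorCenter R g p.1 = g p.1 + R * (Complex.I * unitTangent g p.1) := rfl
  have hd := h.deriv_eq p.1
  ext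
  · simp [momentum_apply, ContinuousLinearMap.precompR_apply, ContinuousLinearMap.precompL_apply]
    have hn : ‖deriv g p.1‖ = speed g p.1 := rfl
    rw [magneticLagrangian, hn, hd, arcVariation, hE, hP]
    set τ := unitTangent g p.1
    set v := arcVelocity R g p
    set σ := speed g p.1
    set κ := turningRate g p.1
    simp [cross]
    field_simp
    linear_combination (-(2 * σ - R * κ) * R) * hτ - R ^ 2 * κ * hv
  · simp [momentum_apply, ContinuousLinearMap.precompR_apply, ContinuousLinearMap.precompL_apply]
    rw [h.norm_arcVelocity, hE, hP]
    set v := arcVelocity R g p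
    simp [cross]
    field_simp
    linear_combination R * hv

end IsSmoothSimpleClosedCurve


/-! ### The domain of the string function -/

/-- The superlevel sets of a combination of sine and cosine, at nonnegative levels, meet an arc
that is shorter than a half circle in an interval. -/
theorem sin_combination_lt {A B k φ r : ℝ} (hφ : |φ| < Real.pi) (hk : 0 ≤ k) (h0 : k < A)
    (h1 : k < A * Real.cos φ + B * Real.sin φ) (hr : r ∈ Set.Icc (0 : ℝ) 1) :
    k < A * Real.cos (r * φ) + B * Real.sin (r * φ) := by
  wlog hpos : 0 ≤ φ generalizing φ B
  · have := this (φ := -φ) (B := -B) (by rwa [abs_neg])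
      (by rw [Real.cos_neg, Real.sin_neg]; linarith) (by linarith)
    rw [mul_neg, Real.cos_neg, Real.sin_neg] at this
    linarith
  rcases hpos.eq_or_lt with rfl | hpos
  · simpa using h0
  rw [abs_of_pos hpos] at hφ
  obtain ⟨hr0, hr1⟩ := hr
  have hs : 0 < Real.sin φ := Real.sin_pos_of_pos_of_lt_pi hpos hφ
  have hu : 0 ≤ Real.sin (r * φ) :=
    Real.sin_nonneg_of_nonneg_of_le_pi (by positivity) (by nlinarith)
  have hw : 0 ≤ Real.sin ((1 - r) * φ) :=
    Real.sin_nonneg_of_nonneg_of_le_pi (mul_nonneg (by linarith) hpos.le) (by nlinarith)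
  have e : φ = (1 - r) * φ + r * φ := by ring
  have e1 : Real.sin φ = Real.sin ((1 - r) * φ) * Real.cos (r * φ) +
      Real.cos ((1 - r) * φ) * Real.sin (r * φ) := by
    conv_lhs => rw [e]
    exact Real.sin_add _ _
  have e2 : Real.cos φ = Real.cos ((1 - r) * φ) * Real.cos (r * φ) -
      Real.sin ((1 - r) * φ) * Real.sin (r * φ) := by
    conv_lhs => rw [e]
    exact Real.cos_add _ _
  -- the value at `r * φ` is the combination of the values at `0` and `φ` with the weights
  -- `sin ((1 - r) * φ) / sin φ` and `sin (r * φ) / sin φ`, whose sum is at least `1`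
  have e3 : Real.sin φ * (A * Real.cos (r * φ) + B * Real.sin (r * φ)) =
      Real.sin ((1 - r) * φ) * A + Real.sin (r * φ) * (A * Real.cos φ + B * Real.sin φ) := by
    rw [e1, e2]
    linear_combination (Real.sin ((1 - r) * φ) * A) * (Real.sin_sq_add_cos_sq (r * φ))
  have e4 : Real.sin φ ≤ Real.sin ((1 - r) * φ) + Real.sin (r * φ) := by
    rw [e1]
    nlinarith [Real.cos_le_one (r * φ), Real.cos_le_one ((1 - r) * φ)]
  have e5 : 0 < Real.sin ((1 - r) * φ) + Real.sin (r * φ) := by linarith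
  have e6 : k * (Real.sin ((1 - r) * φ) + Real.sin (r * φ)) <
      Real.sin ((1 - r) * φ) * A + Real.sin (r * φ) * (A * Real.cos φ + B * Real.sin φ) := by
    rcases hu.eq_or_lt with hu | hu
    · rw [← hu] at e5 ⊢; nlinarith
    · nlinarith
  have e7 : k * Real.sin φ ≤ k * (Real.sin ((1 - r) * φ) + Real.sin (r * φ)) :=
    mul_le_mul_of_nonneg_left e4 hk
  by_contra! hc
  nlinarith

namespace IsObstacle

variable {R ε : ℝ} {g : ℝ → ℂ}

/-- On a Larmor circle, an open disc of the same radius cuts out the points at which a certain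
combination of sine and cosine exceeds a nonnegative constant. -/
theorem mem_ball_larmorArc_iff (h : IsObstacle R g ε) (p : ℂ) (t s : ℝ) :
    larmorArc R g (t, s) ∈ Metric.ball p R ↔
      ‖p - larmorCenter R g t‖ ^ 2 / (2 * R) <
        -cross (unitTangent g t) (p - larmorCenter R g t) * Real.cos (s / R) +
          inner ℝ (unitTangent g t) (p - larmorCenter R g t) * Real.sin (s / R) := by
  have hR := h.pos
  have h1 : ‖larmorArc R g (t, s) - p‖ ^ 2 = ‖p - larmorCenter R g t‖ ^ 2 + R ^ 2 +
      2 * R * cross (arcVelocity R g (t, s)) (p - larmorCenter R g t) := by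
    have h2 : larmorArc R g (t, s) - p = -((p - larmorCenter R g t) +
        (R : ℂ) * (Complex.I * arcVelocity R g (t, s))) := by
      rw [larmorArc]; ring
    rw [h2, norm_neg, norm_add_sq_real, inner_ofReal_mul_right, real_inner_comm,
      inner_I_mul_left, norm_mul, norm_mul, Complex.norm_I, h.norm_arcVelocity,
      Complex.norm_real, Real.norm_of_nonneg hR.le]
    ring
  have h3 : cross (arcVelocity R g (t, s)) (p - larmorCenter R g t) =
      cross (unitTangent g t) (p - larmorCenter R g t) * Real.cos (s / R) -
        inner ℝ (unitTangent g t) (p - larmorCenter R g t) * Real.sin (s / R) := by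
    rw [inner_eq_re]
    simp only [arcVelocity, cross, Complex.mul_re, Complex.mul_im, Complex.exp_ofReal_mul_I_re,
      Complex.exp_ofReal_mul_I_im]
    ring
  rw [Metric.mem_ball, dist_eq_norm, ← sq_lt_sq₀ (norm_nonneg _) hR.le, h1, h3,
    div_lt_iff₀ (by positivity)]
  constructor <;> intro h4 <;> nlinarith

/-- A short Larmor arc between two points of an open disc of radius `R` stays in the disc. -/
theorem larmorArc_mul_mem_ball (h : IsObstacle R g ε) {p : ℂ} {t s r : ℝ}
    (h0 : g t ∈ Metric.ball p R) (hs : |s| < Real.pi * R)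
    (h1 : larmorArc R g (t, s) ∈ Metric.ball p R) (hr : r ∈ Set.Icc (0 : ℝ) 1) :
    larmorArc R g (t, r * s) ∈ Metric.ball p R := by
  have hR := h.pos
  rw [← larmorArc_zero R g t] at h0
  rw [h.mem_ball_larmorArc_iff] at h0 h1 ⊢
  rw [zero_div, Real.cos_zero, Real.sin_zero, mul_one, mul_zero, add_zero] at h0
  rw [mul_div_assoc]
  exact sin_combination_lt (by rwa [abs_div, abs_of_pos hR, div_lt_iff₀ hR]) (by positivity)
    h0 h1 hr

/-- If an arc before the contact and one after it lie in an open disc of radius `R`, then together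
they are shorter than a half circle. -/
theorem add_lt_of_mem_ball (h : IsObstacle R g ε) {p : ℂ} {t s s' : ℝ}
    (h0 : g t ∈ Metric.ball p R) (hs : 0 < s) (hsπ : s < Real.pi * R) (hs' : 0 < s')
    (hs'π : s' < Real.pi * R) (h1 : larmorArc R g (t, s) ∈ Metric.ball p R)
    (h2 : larmorArc R g (t, -s') ∈ Metric.ball p R) : s + s' < Real.pi * R := by
  have hR := h.pos
  rw [← larmorArc_zero R g t] at h0
  rw [h.mem_ball_larmorArc_iff] at h0 h1 h2
  have hk : 0 ≤ ‖p - larmorCenter R g t‖ ^ 2 / (2 * R) := by positivity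
  rw [zero_div, Real.cos_zero, Real.sin_zero, mul_one, mul_zero, add_zero] at h0
  rw [neg_div, Real.cos_neg, Real.sin_neg] at h2
  have a1 : s / R < Real.pi := by rwa [div_lt_iff₀ hR]
  have a2 : s' / R < Real.pi := by rwa [div_lt_iff₀ hR]
  have p1 : 0 < Real.sin (s / R) := Real.sin_pos_of_pos_of_lt_pi (by positivity) a1
  have p2 : 0 < Real.sin (s' / R) := Real.sin_pos_of_pos_of_lt_pi (by positivity) a2
  by_contra! hc
  have a3 : Real.pi ≤ s / R + s' / R := by rw [← add_div, le_div_iff₀ hR]; exact hc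
  have h3 : Real.sin (s / R + s' / R) ≤ 0 := by
    have : 0 ≤ Real.sin (s / R + s' / R - Real.pi) :=
      Real.sin_nonneg_of_nonneg_of_le_pi (by linarith) (by linarith)
    rw [Real.sin_sub_pi] at this
    linarith
  rw [Real.sin_add] at h3
  nlinarith [mul_pos p1 (hk.trans_lt h2), mul_pos p2 (hk.trans_lt h1)]

theorem eq_of_larmorArc_eq (h : IsObstacle R g ε) {t s s' : ℝ}
    (hs : |s - s'| < 2 * Real.pi * R) (heq : larmorArc R g (t, s) = larmorArc R g (t, s')) :
    s = s' := by
  have hR := h.pos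
  have hR' : (R : ℂ) ≠ 0 := by exact_mod_cast hR.ne'
  have hτ0 : unitTangent g t ≠ 0 := fun h0 => by
    have := h.norm_unitTangent t; rw [h0] at this; simp at this
  simp only [larmorArc, sub_right_inj, arcVelocity] at heq
  have h1 := mul_left_cancel₀ hτ0 (mul_left_cancel₀ Complex.I_ne_zero (mul_left_cancel₀ hR' heq))
  have h2 := eq_of_exp_mul_I_eq (by
    rw [← sub_div, abs_div, abs_of_pos hR, div_lt_iff₀ hR]; exact hs) h1
  field_simp at h2
  exact h2

/-- By `IsObstacle.disc`, a Larmor circle of the curve meets the region at the contact only. -/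
theorem larmorArc_notMem_hull (h : IsObstacle R g ε) {t s : ℝ} (hs : s ≠ 0)
    (hs' : |s| < 2 * Real.pi * R) : larmorArc R g (t, s) ∉ convexHull ℝ (Set.range g) := by
  intro hmem
  have h1 := h.eq_of_norm_sub_larmorCenter hmem (h.norm_larmorArc_sub h.pos (t, s))
  rw [← larmorArc_zero R g t] at h1
  exact hs (h.eq_of_larmorArc_eq (by simpa using hs') h1)

theorem norm_sub_lt_of_mem_stringDomain {X : ℂ} (hX : X ∈ stringDomain R g) (t : ℝ) :
    ‖X - g t‖ < 2 * R := by
  obtain ⟨-, p, hp, hXp⟩ := hX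
  have h1 := hp ⟨t, rfl⟩
  rw [Metric.mem_ball] at h1 hXp
  rw [← dist_eq_norm]
  linarith [dist_triangle_right X (g t) p]

theorem exists_larmorArc_eq_of_mem (h : IsObstacle R g ε) {X : ℂ} (hX : X ∈ stringDomain R g)
    {ς : ℝ} (hς : ς = 1 ∨ ς = -1) :
    ∃ t s, 0 < ς * s ∧ |s| < Real.pi * R ∧ larmorArc R g (t, s) = X :=
  h.exists_larmorArc_eq hX.1 (norm_sub_lt_of_mem_stringDomain hX) hς

theorem hull_subset_ball {p : ℂ} (hp : Set.range g ⊆ Metric.ball p R) :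
    convexHull ℝ (Set.range g) ⊆ Metric.ball p R :=
  convexHull_min hp (convex_ball _ _)

theorem isOpen_stringDomain (h : IsObstacle R g ε) : IsOpen (stringDomain R g) := by
  have : stringDomain R g = (convexHull ℝ (Set.range g))ᶜ ∩
      ⋃ p ∈ {p | Set.range g ⊆ Metric.ball p R}, Metric.ball p R := by
    ext X; simp [stringDomain]
  rw [this]
  exact h.isClosed_hull.isOpen_compl.inter (isOpen_biUnion fun _ _ => Metric.isOpen_ball)

theorem larmorArc_mul_mem_stringDomain (h : IsObstacle R g ε) {t s r : ℝ} (hs0 : s ≠ 0)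
    (hs : |s| < Real.pi * R) (h1 : larmorArc R g (t, s) ∈ stringDomain R g)
    (hr : r ∈ Set.Ioc (0 : ℝ) 1) : larmorArc R g (t, r * s) ∈ stringDomain R g := by
  obtain ⟨-, p, hp, hXp⟩ := h1
  have hR := h.pos
  refine ⟨h.larmorArc_notMem_hull (mul_ne_zero hr.1.ne' hs0) ?_, p, hp,
    h.larmorArc_mul_mem_ball (hp ⟨t, rfl⟩) hs hXp ⟨hr.1.le, hr.2⟩⟩
  rw [abs_mul, abs_of_pos hr.1]
  have := abs_nonneg s
  have := hr.2
  nlinarith [Real.pi_pos]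

/-- The arriving and the departing arc at a point have different velocities there. -/
theorem arcVelocity_ne (h : IsObstacle R g ε) {t s t' s' : ℝ} (hs : 0 < s)
    (hsπ : s < Real.pi * R) (hs' : 0 < s') (hsπ' : s' < Real.pi * R)
    (heq : larmorArc R g (t, s) = larmorArc R g (t', -s')) :
    arcVelocity R g (t, s) ≠ arcVelocity R g (t', -s') := by
  intro hv
  have hP : larmorCenter R g t = larmorCenter R g t' := by
    have h2 := heq
    simp only [larmorArc, hv] at h2
    exact sub_left_injective h2
  have h1 : g t = g t' := by
    refine h.eq_of_norm_sub_larmorCenter (IsConvexClosedCurve.mem_hull g t) ?_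
    rw [← hP, h.norm_sub_larmorCenter]
  obtain ⟨k, rfl⟩ := h.eq_add_int h1
  rw [h.larmorArc_add_int] at heq
  have := h.eq_of_larmorArc_eq (by rw [sub_neg_eq_add, abs_of_pos (by positivity)]; linarith)
    heq
  linarith

/-- The arriving and the departing arc at a point have different contacts. -/
theorem ne_add_int (h : IsObstacle R g ε) {t s t' s' : ℝ} (hs : 0 < s)
    (hsπ : s < Real.pi * R) (hs' : 0 < s') (hsπ' : s' < Real.pi * R)
    (heq : larmorArc R g (t, s) = larmorArc R g (t', -s')) (k : ℤ) : t ≠ t' + k := by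
  rintro rfl
  rw [h.larmorArc_add_int] at heq
  have := h.eq_of_larmorArc_eq (by rw [sub_neg_eq_add, abs_of_pos (by positivity)]; linarith)
    heq
  linarith

/-- A full turn adds the length of the curve to the action. -/
theorem arcPotential_add_int (h : IsObstacle R g ε) (t s : ℝ) (k : ℤ) :
    arcPotential R g (t + k, s) = arcPotential R g (t, s) +
      k * ∫ u in (0 : ℝ)..1, magneticLagrangian R (g u) (deriv g u) := by
  have hper : Function.Periodic (fun u => magneticLagrangian R (g u) (deriv g u)) 1 := fun u => by
    simp only [h.periodic u, h.deriv_periodic u]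
  have hc := (h.contDiff_lagrangian R).continuous
  have h1 := hper.intervalIntegral_add_zsmul_eq k t fun a b => hc.intervalIntegrable a b
  have h2 := hper.intervalIntegral_add_eq t 0
  have h3 := intervalIntegral.integral_add_adjacent_intervals (hc.intervalIntegrable 0 t)
    (hc.intervalIntegrable (μ := MeasureTheory.volume) t (t + k))
  have h4 := (h.larmorCenter_periodic R).int_mul k t
  have h5 := h.periodic.int_mul k t
  simp only [zsmul_eq_mul, mul_one, zero_add] at h1 h2 h4 h5
  simp only [arcPotential, h.larmorArc_add_int, h4, h5]
  rw [← h3, h1, h2]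
  ring

end IsObstacle


/-! ### The polar angle along tangent arcs -/

/-- A branch of the logarithm of `larmorArc R g p - z`, continuous in `p`. -/
noncomputable def arcLog (R : ℝ) (g : ℝ → ℂ) (z : ℂ) (p : ℝ × ℝ) : ℂ :=
  Complex.log (g 0 - z) + (∫ u in (0 : ℝ)..p.1, deriv g u / (g u - z)) +
    ∫ u in (0 : ℝ)..p.2, arcVelocity R g (p.1, u) / (larmorArc R g (p.1, u) - z)

/-- A continuous polar angle of `larmorArc R g p` about `z`. -/
noncomputable def polarAngle (R : ℝ) (g : ℝ → ℂ) (z : ℂ) (p : ℝ × ℝ) : ℝ := (arcLog R g z p).im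

/-- The integral of the logarithmic derivative is a logarithm along the path. -/
theorem mul_exp_integral {f f' : ℝ → ℂ} (hf : ∀ t, HasDerivAt f (f' t) t) (hf' : Continuous f')
    (h0 : ∀ t, f t ≠ 0) (t : ℝ) : f 0 * Complex.exp (∫ u in (0 : ℝ)..t, f' u / f u) = f t := by
  have hc : Continuous fun u => f' u / f u :=
    hf'.div (continuous_iff_continuousAt.2 fun t => (hf t).continuousAt) h0
  have hd : ∀ s, HasDerivAt (fun s => f s * Complex.exp (-∫ u in (0 : ℝ)..s, f' u / f u)) 0 s := by
    intro s
    have h1 := (hc.integral_hasStrictDerivAt 0 s).hasDerivAt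
    refine ((hf s).mul h1.fun_neg.cexp).congr_deriv ?_
    have := h0 s
    field_simp
    ring
  have h1 := is_const_of_deriv_eq_zero (fun s => (hd s).differentiableAt)
    (fun s => (hd s).deriv) t 0
  simp only [intervalIntegral.integral_same, neg_zero, Complex.exp_zero, mul_one] at h1
  rw [← h1, mul_assoc, ← Complex.exp_add]
  simp

namespace IsObstacle

variable {R ε : ℝ} {g : ℝ → ℂ}

theorem larmorArc_ne (h : IsObstacle R g ε) {z : ℂ} (hz : z ∈ insideOf g) (p : ℝ × ℝ) :
    larmorArc R g p - z ≠ 0 := fun h0 => by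
  refine h.norm_sub_ne_of_mem_insideOf p.1 hz ?_
  rw [← sub_eq_zero.1 h0, h.norm_larmorArc_sub h.pos]

theorem hasDerivAt_larmorArc_snd (h : IsObstacle R g ε) (t s : ℝ) :
    HasDerivAt (fun s => larmorArc R g (t, s)) (arcVelocity R g (t, s)) s := by
  have h1 : HasDerivAt (fun s : ℝ => (t, s)) (0, 1) s :=
    (hasDerivAt_const s t).prodMk (hasDerivAt_id s)
  have := (h.hasFDerivAt_larmorArc h.pos (t, s)).comp_hasDerivAt s h1
  simpa [Function.comp_def] using this

theorem exp_arcLog (h : IsObstacle R g ε) {z : ℂ} (hz : z ∈ insideOf g) (p : ℝ × ℝ) :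
    Complex.exp (arcLog R g z p) = larmorArc R g p - z := by
  have hv := (h.contDiff_arcVelocity R).continuous
  have hne : ∀ t, g t - z ≠ 0 := fun t => by
    have := h.larmorArc_ne hz (t, 0)
    rwa [larmorArc_zero] at this
  rw [arcLog, Complex.exp_add, Complex.exp_add, Complex.exp_log (hne 0)]
  rw [mul_exp_integral (f := fun u => g u - z) (fun t => (h.hasDerivAt t).sub_const z)
    h.contDiff_deriv.continuous hne p.1]
  have := mul_exp_integral (f := fun u => larmorArc R g (p.1, u) - z)
    (fun s => (h.hasDerivAt_larmorArc_snd p.1 s).sub_const z) (by fun_prop)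
    (fun s => h.larmorArc_ne hz _) p.2
  rwa [larmorArc_zero] at this

theorem continuous_polarAngle (h : IsObstacle R g ε) {z : ℂ} (hz : z ∈ insideOf g) :
    Continuous (polarAngle R g z) := by
  have hv := (h.contDiff_arcVelocity R).continuous
  have hE := (h.contDiff_larmorArc R).continuous
  have hne : ∀ t, g t - z ≠ 0 := fun t => by
    have := h.larmorArc_ne hz (t, 0)
    rwa [larmorArc_zero] at this
  have h1 : Continuous fun p : ℝ × ℝ => ∫ u in (0 : ℝ)..p.1, deriv g u / (g u - z) := by
    have hc : Continuous fun u => deriv g u / (g u - z) :=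
      h.contDiff_deriv.continuous.div (h.smooth.continuous.sub continuous_const) hne
    exact (continuous_iff_continuousAt.2 fun t =>
      (hc.integral_hasStrictDerivAt 0 t).hasDerivAt.continuousAt).comp continuous_fst
  have h2 : Continuous fun p : ℝ × ℝ =>
      ∫ u in (0 : ℝ)..p.2, arcVelocity R g (p.1, u) / (larmorArc R g (p.1, u) - z) :=
    intervalIntegral.continuous_parametric_intervalIntegral_of_continuous
      (f := fun (p : ℝ × ℝ) u => arcVelocity R g (p.1, u) / (larmorArc R g (p.1, u) - z))
      (Continuous.div (by fun_prop) (by fun_prop) fun q => h.larmorArc_ne hz _) continuous_snd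
  exact Complex.continuous_im.comp ((continuous_const.add h1).add h2)

theorem larmorArc_sub_eq (h : IsObstacle R g ε) {z : ℂ} (hz : z ∈ insideOf g) (p : ℝ × ℝ) :
    larmorArc R g p - z =
      (‖larmorArc R g p - z‖ : ℂ) * Complex.exp ((polarAngle R g z p : ℂ) * Complex.I) := by
  rw [← h.exp_arcLog hz p, Complex.norm_exp, Complex.ofReal_exp, ← Complex.exp_add, polarAngle,
    Complex.re_add_im]

theorem hasDerivAt_polarAngle_zero (h : IsObstacle R g ε) {z : ℂ} (hz : z ∈ insideOf g) (t : ℝ) :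
    HasDerivAt (fun t => polarAngle R g z (t, 0))
      (cross (g t - z) (deriv g t) / ‖g t - z‖ ^ 2) t := by
  have hne : ∀ t, g t - z ≠ 0 := fun t => by
    have := h.larmorArc_ne hz (t, 0)
    rwa [larmorArc_zero] at this
  have hc : Continuous fun u => deriv g u / (g u - z) :=
    h.contDiff_deriv.continuous.div (h.smooth.continuous.sub continuous_const) hne
  have h1 : HasDerivAt (fun t => arcLog R g z (t, 0)) (deriv g t / (g t - z)) t := by
    simp only [arcLog, intervalIntegral.integral_same, add_zero]
    exact (hc.integral_hasStrictDerivAt 0 t).hasDerivAt.const_add _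
  have h2 := Complex.imCLM.hasFDerivAt.comp_hasDerivAt t h1
  refine h2.congr_deriv ?_
  simp only [Complex.imCLM_apply, Complex.div_im, Complex.sq_norm, cross]
  ring

/-- The tangent arcs at `t` and `t + 1` being the same, they contribute the same angle. -/
theorem polarAngle_sub (h : IsObstacle R g ε) (z : ℂ) (t s : ℝ) :
    polarAngle R g z (t + 1, s) - polarAngle R g z (t, s) =
      polarAngle R g z (t + 1, 0) - polarAngle R g z (t, 0) := by
  have h1 := fun u => h.larmorArc_add_int R t u 1
  have h2 := fun u => h.arcVelocity_add_int R t u 1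
  simp only [Int.cast_one] at h1 h2
  simp only [polarAngle, arcLog, h1, h2, intervalIntegral.integral_same, add_zero,
    Complex.add_im]
  ring

/-- Two polar angles of a point differ by a multiple of a full turn. -/
theorem polarAngle_eq_add (h : IsObstacle R g ε) {z : ℂ} (hz : z ∈ insideOf g) {p : ℝ × ℝ}
    {θ : ℝ} (hθ : larmorArc R g p - z =
      (‖larmorArc R g p - z‖ : ℂ) * Complex.exp ((θ : ℂ) * Complex.I)) :
    ∃ k : ℤ, polarAngle R g z p = θ + k * (2 * Real.pi) := by
  have h1 := h.larmorArc_sub_eq hz p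
  rw [hθ] at h1
  have hn : (‖larmorArc R g p - z‖ : ℂ) ≠ 0 := by
    exact_mod_cast norm_ne_zero_iff.2 (h.larmorArc_ne hz p)
  have h2 : ‖(‖larmorArc R g p - z‖ : ℂ) * Complex.exp ((θ : ℂ) * Complex.I)‖ =
      ‖larmorArc R g p - z‖ := by rw [← hθ]
  rw [h2] at h1
  obtain ⟨k, hk⟩ := Complex.exp_eq_exp_iff_exists_int.1 (mul_left_cancel₀ hn h1).symm
  refine ⟨k, ?_⟩
  have h3 : (polarAngle R g z p : ℂ) * Complex.I =
      ((θ + k * (2 * Real.pi) : ℝ) : ℂ) * Complex.I := by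
    rw [hk]; push_cast; ring
  exact_mod_cast mul_right_cancel₀ Complex.I_ne_zero h3

/-- A ray from a point inside meets the convex curve only once. -/
theorem eq_of_sub_eq_mul (h : IsObstacle R g ε) {z : ℂ} (hz : z ∈ insideOf g) {t u r : ℝ}
    (hr : 0 < r) (heq : g t - z = (r : ℂ) * (g u - z)) : g t = g u := by
  have key : ∀ {t u r : ℝ}, 0 < r → g t - z = (r : ℂ) * (g u - z) → 1 ≤ r := by
    intro t u r hr heq
    by_contra! hr1
    refine h.notMem_insideOf t ?_
    have h1 := (convex_convexHull ℝ (Set.range g)).combo_interior_self_mem_interior hz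
      (IsConvexClosedCurve.mem_hull g u) (sub_pos.2 hr1) hr.le (by ring)
    have h2 : g t = (1 - r) • z + r • g u := by
      rw [Complex.real_smul, Complex.real_smul]
      push_cast
      linear_combination heq
    rwa [insideOf, h2]
  have h1 := key hr heq
  have h2 := key (t := u) (u := t) (inv_pos.2 hr) (by
    have : (r : ℂ) ≠ 0 := by exact_mod_cast hr.ne'
    rw [heq]; push_cast; field_simp)
  have h3 : r = 1 := le_antisymm ((one_le_inv₀ hr).1 h2) h1
  rw [h3] at heq
  simpa using heq

/-- The winding number of a convex curve about the points inside is `1` or `-1`. -/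
theorem polarAngle_add_one (h : IsObstacle R g ε) {z : ℂ} (hz : z ∈ insideOf g) (t s : ℝ) :
    polarAngle R g z (t + 1, s) = polarAngle R g z (t, s) + ε * (2 * Real.pi) := by
  have hπ := Real.two_pi_pos
  have hε := h.sign_mul_self
  suffices hs : polarAngle R g z (t + 1, 0) = polarAngle R g z (t, 0) + ε * (2 * Real.pi) by
    have := h.polarAngle_sub z t s
    linarith
  set f : ℝ → ℝ := fun u => ε * polarAngle R g z (u, 0) with hf
  have hd : ∀ u, HasDerivAt f _ u := fun u => (h.hasDerivAt_polarAngle_zero hz u).const_mul ε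
  have hmono : StrictMono f := by
    refine strictMono_of_deriv_pos fun u => ?_
    rw [(hd u).deriv, ← mul_div_assoc]
    have h1 := h.side u z hz
    have hne := h.larmorArc_ne hz (u, 0)
    rw [larmorArc_zero] at hne
    have h2 : cross (g u - z) (deriv g u) = cross (deriv g u) (z - g u) := by
      simp [cross]; ring
    rw [h2]
    exact div_pos h1 (by have := norm_pos_iff.2 hne; positivity)
  have hp1 : g (t + 1) = g t := h.periodic t
  have hE : larmorArc R g (t + 1, 0) = larmorArc R g (t, 0) := by
    rw [larmorArc_zero, larmorArc_zero, hp1]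
  obtain ⟨k, hk⟩ := h.polarAngle_eq_add hz (p := (t + 1, 0)) (θ := polarAngle R g z (t, 0))
    (by rw [hE]; exact h.larmorArc_sub_eq hz (t, 0))
  have hlt := hmono (lt_add_one t)
  simp only [hf, hk] at hlt
  -- `ε * k` is a positive integer, and it is not greater than `1`
  have hpos : 0 < ε * (k * (2 * Real.pi)) := by linarith
  have hle : ε * (k * (2 * Real.pi)) ≤ 2 * Real.pi := by
    by_contra! hc
    have hfc : Continuous f := continuous_iff_continuousAt.2 fun u => (hd u).continuousAt
    obtain ⟨u, ⟨hu1, hu2⟩, hu⟩ := intermediate_value_Ioo (a := t) (b := t + 1) (by linarith)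
      hfc.continuousOn (show f t + 2 * Real.pi ∈ Set.Ioo (f t) (f (t + 1)) from
        ⟨by linarith, by simp only [hf, hk]; linarith⟩)
    have hu' : polarAngle R g z (u, 0) = polarAngle R g z (t, 0) + ε * (2 * Real.pi) := by
      simp only [hf] at hu
      linear_combination ε * hu - (polarAngle R g z (u, 0) - polarAngle R g z (t, 0)) * hε
    have hexp : Complex.exp ((polarAngle R g z (u, 0) : ℂ) * Complex.I) =
        Complex.exp ((polarAngle R g z (t, 0) : ℂ) * Complex.I) := by
      rw [Complex.exp_eq_exp_iff_exists_int]
      rcases h.sign with h1 | h1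
      · exact ⟨1, by rw [hu', h1]; push_cast; ring⟩
      · exact ⟨-1, by rw [hu', h1]; push_cast; ring⟩
    have e1 := h.larmorArc_sub_eq hz (u, 0)
    have e2 := h.larmorArc_sub_eq hz (t, 0)
    have n1 := norm_pos_iff.2 (h.larmorArc_ne hz (u, 0))
    have n2 := norm_pos_iff.2 (h.larmorArc_ne hz (t, 0))
    rw [larmorArc_zero] at e1 e2 n1 n2
    have hgu : g u = g t := by
      refine h.eq_of_sub_eq_mul hz (div_pos n1 n2) ?_
      rw [hexp] at e1
      have n2' : (‖g t - z‖ : ℂ) ≠ 0 := by exact_mod_cast n2.ne'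
      push_cast
      rw [div_mul_eq_mul_div, eq_div_iff n2']
      linear_combination (‖g t - z‖ : ℂ) * e1 - (‖g u - z‖ : ℂ) * e2
    obtain ⟨j, hj⟩ := h.eq_add_int hgu
    have j1 : (0 : ℝ) < j := by linarith
    have j2 : (j : ℝ) < 1 := by linarith
    have j1' : 0 < j := by exact_mod_cast j1
    have j2' : j < 1 := by exact_mod_cast j2
    omega
  rw [hk]
  rcases h.sign with h1 | h1
  · rw [h1] at hpos hle ⊢
    have k1 : (0 : ℝ) < k := by
      by_contra! hc; nlinarith
    have k2 : (k : ℝ) ≤ 1 := by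
      by_contra! hc; nlinarith
    have k1' : 0 < k := by exact_mod_cast k1
    have k2' : k ≤ 1 := by exact_mod_cast k2
    rw [show k = 1 by omega]; simp
  · rw [h1] at hpos hle ⊢
    have k1 : (k : ℝ) < 0 := by
      by_contra! hc; nlinarith
    have k2 : -1 ≤ (k : ℝ) := by
      by_contra! hc; nlinarith
    have k1' : k < 0 := by exact_mod_cast k1
    have k2' : -1 ≤ k := by exact_mod_cast k2
    rw [show k = -1 by omega]; simp

theorem polarAngle_add_int (h : IsObstacle R g ε) {z : ℂ} (hz : z ∈ insideOf g) (t s : ℝ)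
    (k : ℤ) :
    polarAngle R g z (t + k, s) = polarAngle R g z (t, s) + k * (ε * (2 * Real.pi)) := by
  have hn : ∀ (n : ℕ) (t : ℝ), polarAngle R g z (t + n, s) =
      polarAngle R g z (t, s) + n * (ε * (2 * Real.pi)) := fun n => by
    induction n with
    | zero => simp
    | succ n ih =>
      intro t
      push_cast
      rw [← add_assoc, h.polarAngle_add_one hz, ih]; ring
  obtain ⟨n, rfl | rfl⟩ := k.eq_nat_or_neg
  · simpa using hn n t
  · have := hn n (t + (-n : ℤ))
    push_cast at this ⊢
    rw [neg_add_cancel_right] at this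
    linarith

/-! ### Lifting of paths -/

/-- A point of the domain with a polar angle determines a tangent arc with a curve parameter in
`ℝ` (not only modulo `1`). -/
theorem exists_arc_polarAngle (h : IsObstacle R g ε) {z : ℂ} (hz : z ∈ insideOf g) {X : ℂ}
    (hX : X ∈ stringDomain R g) {θ : ℝ}
    (hθ : X - z = (‖X - z‖ : ℂ) * Complex.exp ((θ : ℂ) * Complex.I)) {ς : ℝ}
    (hς : ς = 1 ∨ ς = -1) :
    ∃ q : ℝ × ℝ, (0 < ς * q.2 ∧ |q.2| < Real.pi * R) ∧ larmorArc R g q = X ∧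
      polarAngle R g z q = θ := by
  obtain ⟨t, s, hs, hs', rfl⟩ := h.exists_larmorArc_eq_of_mem hX hς
  obtain ⟨k, hk⟩ := h.polarAngle_eq_add hz hθ
  rcases h.sign with h1 | h1
  · refine ⟨(t + (-k : ℤ), s), ⟨hs, hs'⟩, h.larmorArc_add_int R t s _, ?_⟩
    rw [h.polarAngle_add_int hz, hk, h1]; push_cast; ring
  · refine ⟨(t + k, s), ⟨hs, hs'⟩, h.larmorArc_add_int R t s _, ?_⟩
    rw [h.polarAngle_add_int hz, hk, h1]; ring

theorem arc_polarAngle_unique (h : IsObstacle R g ε) {z : ℂ} (hz : z ∈ insideOf g) {ς : ℝ}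
    (hς : ς = 1 ∨ ς = -1) {q q' : ℝ × ℝ} (hq : 0 < ς * q.2 ∧ |q.2| < Real.pi * R)
    (hq' : 0 < ς * q'.2 ∧ |q'.2| < Real.pi * R) (heq : larmorArc R g q = larmorArc R g q')
    (hθ : polarAngle R g z q = polarAngle R g z q') : q = q' := by
  obtain ⟨t, s⟩ := q
  obtain ⟨t', s'⟩ := q'
  have hss : 0 < s * s' := by
    have := mul_pos hq.1 hq'.1
    rcases hς with rfl | rfl <;> nlinarith
  obtain ⟨⟨k, rfl⟩, rfl⟩ := h.larmorArc_unique hq.2 hq'.2 hss heq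
  rw [h.polarAngle_add_int hz] at hθ
  have hε : ε ≠ 0 := fun h0 => by have := h.sign_mul_self; rw [h0] at this; simp at this
  have hk : (k : ℝ) = 0 := by
    by_contra hc
    exact mul_ne_zero hc (mul_ne_zero hε Real.two_pi_pos.ne') (by linarith)
  rw [hk, add_zero]

/-- The tangent arc depends continuously on the point and its polar angle. -/
theorem continuousOn_arc (h : IsObstacle R g ε) {z : ℂ} (hz : z ∈ insideOf g)
    {α : Type*} [TopologicalSpace α] {S : Set α} {X : α → ℂ} {θ : α → ℝ} {c : α → ℝ × ℝ}
    {ς : ℝ} (hς : ς = 1 ∨ ς = -1) (hX : ContinuousOn X S) (hθ : ContinuousOn θ S)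
    (hc : ∀ a ∈ S, (0 < ς * (c a).2 ∧ |(c a).2| < Real.pi * R) ∧ larmorArc R g (c a) = X a ∧
      polarAngle R g z (c a) = θ a) : ContinuousOn c S := by
  intro a ha
  obtain ⟨hca, hXa, hθa⟩ := hc a ha
  have hs0 : (c a).2 ≠ 0 := fun h0 => by rw [h0] at hca; simp at hca
  obtain ⟨e, he1, he2, he3, he4⟩ := h.exists_localInverse (t := (c a).1) hs0 hca.2
  rw [Prod.mk.eta, hXa] at he1 he2 he3
  have hcont : Filter.Tendsto (fun b => e (X b)) (nhdsWithin a S) (nhds (c a)) := by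
    have := he1.continuousAt.tendsto.comp (hX a ha)
    rwa [he2] at this
  have hopen : IsOpen {q : ℝ × ℝ | 0 < ς * q.2 ∧ |q.2| < Real.pi * R} :=
    IsOpen.and (isOpen_lt continuous_const (continuous_const.mul continuous_snd))
      (isOpen_lt (continuous_abs.comp continuous_snd) continuous_const)
  have hang : Filter.Tendsto (fun b => polarAngle R g z (e (X b)) - θ b) (nhdsWithin a S)
      (nhds 0) := by
    have h1 := (((h.continuous_polarAngle hz).tendsto _).comp hcont).sub (hθ a ha)
    rwa [hθa, sub_self] at h1
  have hEq : c =ᶠ[nhdsWithin a S] fun b => e (X b) := by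
    filter_upwards [hcont (hopen.mem_nhds hca), (hX a ha) he3, self_mem_nhdsWithin,
      hang (Metric.ball_mem_nhds 0 Real.two_pi_pos)] with b hb1 hb2 hb3 hb4
    obtain ⟨hcb, hXb, hθb⟩ := hc b hb3
    have hb2 : larmorArc R g (e (X b)) = X b := hb2
    refine h.arc_polarAngle_unique hz hς hcb hb1 (by rw [hXb, hb2]) ?_
    obtain ⟨k, hk⟩ := h.polarAngle_eq_add hz (p := e (X b)) (θ := θ b) (by
      have := h.larmorArc_sub_eq hz (c b)
      rwa [hXb, hθb, ← hb2] at this)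
    have hb4 : polarAngle R g z (e (X b)) - θ b ∈ Metric.ball 0 (2 * Real.pi) := hb4
    rw [hk, mem_ball_zero_iff, Real.norm_eq_abs, add_sub_cancel_left, abs_mul,
      abs_of_pos Real.two_pi_pos] at hb4
    have h5 : |(k : ℝ)| < 1 := by
      by_contra! hcon
      nlinarith [Real.two_pi_pos]
    have h6 : |k| < 1 := by exact_mod_cast h5
    rw [hθb, hk, Int.abs_lt_one_iff.1 h6]; simp
  exact (hcont.congr' hEq.symm)

end IsObstacle


/-! ### Taut strings -/

/-- The data of a taut string from `X` around the curve: `q` is the tangent arc that arrives at `X`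
and `q'` the one that departs from `X`, and the string follows the curve from the parameter `q'.1`
to the parameter `q.1`. -/
structure IsTautString (R : ℝ) (g : ℝ → ℂ) (X : ℂ) (q q' : ℝ × ℝ) : Prop where
  arrive : larmorArc R g q = X
  depart : larmorArc R g q' = X
  pos : 0 < q.2
  lt_pi : q.2 < Real.pi * R
  neg : q'.2 < 0
  neg_pi_lt : -(Real.pi * R) < q'.2
  lt : q'.1 < q.1
  lt_add_one : q.1 < q'.1 + 1

namespace IsObstacle

variable {R ε : ℝ} {g : ℝ → ℂ}

theorem hasDerivAt_inner_larmorArc (h : IsObstacle R g ε) (τ : ℂ) (t s : ℝ) :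
    HasDerivAt (fun s => inner ℝ τ (larmorArc R g (t, s))) (inner ℝ τ (arcVelocity R g (t, s)))
      s :=
  (innerSL ℝ τ).hasFDerivAt.comp_hasDerivAt s (h.hasDerivAt_larmorArc_snd t s)

/-- Close to the contact, the arc that arrives at a point of a departing arc left the curve before
the contact of the departing arc. -/
theorem lt_of_larmorArc_eq (h : IsObstacle R g ε) {z : ℂ} (hz : z ∈ insideOf g) (t₀ : ℝ) :
    ∃ δ > 0, ∀ s' ∈ Set.Ioo (0 : ℝ) δ, ∀ q : ℝ × ℝ, 0 < q.2 → q.2 < Real.pi * R →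
      larmorArc R g q = larmorArc R g (t₀, -s') →
      polarAngle R g z q = polarAngle R g z (t₀, -s') → t₀ - 1 < q.1 ∧ q.1 < t₀ := by
  have hR := h.pos
  have hv := (h.contDiff_arcVelocity R).continuous
  have hE := (h.contDiff_larmorArc R).continuous
  have hΘ := h.continuous_polarAngle hz
  have hg := h.smooth.continuous
  have hg' := h.contDiff_deriv.continuous
  set τ := unitTangent g t₀ with hτ
  have hτn : inner ℝ τ τ = 1 := by rw [real_inner_self_eq_norm_sq, h.norm_unitTangent]; norm_num
  -- a square around `(t₀, 0)` in which everything moves in about the same direction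
  have e1 : ∀ᶠ q : ℝ × ℝ in nhds (t₀, 0), 0 < inner ℝ τ (arcVelocity R g q) := by
    have hc : Continuous fun q => inner ℝ τ (arcVelocity R g q) := by fun_prop
    refine (hc.tendsto (t₀, 0)).eventually (lt_mem_nhds ?_)
    rw [arcVelocity_zero, hτn]; norm_num
  have e2 : ∀ᶠ q : ℝ × ℝ in nhds (t₀, 0), 0 < inner ℝ τ (deriv g q.1) := by
    have hc : Continuous fun q : ℝ × ℝ => inner ℝ τ (deriv g q.1) := by fun_prop
    refine (hc.tendsto (t₀, 0)).eventually (lt_mem_nhds ?_)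
    simp only
    rw [h.deriv_eq, inner_ofReal_mul_right, ← hτ, hτn, mul_one]
    exact h.speed_pos t₀
  have e3 : ∀ᶠ q : ℝ × ℝ in nhds (t₀, 0),
      |polarAngle R g z q - polarAngle R g z (t₀, 0)| < Real.pi := by
    have hc : Continuous fun q => |polarAngle R g z q - polarAngle R g z (t₀, 0)| := by fun_prop
    refine (hc.tendsto (t₀, 0)).eventually (gt_mem_nhds ?_)
    simpa using Real.pi_pos
  obtain ⟨η, hη, hball⟩ := Metric.eventually_nhds_iff.1 (e1.and (e2.and e3))
  set ρ := min η (1 / 2)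
  have hρ : 0 < ρ := by positivity
  have hρη : ρ ≤ η := min_le_left _ _
  have hρ2 : ρ ≤ 1 / 2 := min_le_right _ _
  have hball' : ∀ t s, |t - t₀| < ρ → |s| < ρ → 0 < inner ℝ τ (arcVelocity R g (t, s)) ∧
      0 < inner ℝ τ (deriv g t) ∧
        |polarAngle R g z (t, s) - polarAngle R g z (t₀, 0)| < Real.pi := fun t s ht hs =>
    hball (y := (t, s)) (by
      rw [Prod.dist_eq, max_lt_iff, Real.dist_eq, Real.dist_eq, sub_zero]
      exact ⟨ht.trans_le hρη, hs.trans_le hρη⟩)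
  -- outside the square the arcs keep away from the contact
  set C : Set (ℝ × ℝ) := (Set.Icc (t₀ - 1 / 2) (t₀ + 1 / 2) ×ˢ Set.Icc 0 (Real.pi * R)) \
    Metric.ball (t₀, 0) ρ with hC
  have hCc : IsCompact C := (isCompact_Icc.prod isCompact_Icc).diff Metric.isOpen_ball
  have hCne : ∀ q ∈ C, larmorArc R g q ≠ g t₀ := by
    rintro ⟨t, s⟩ ⟨⟨⟨ht1, ht2⟩, hs1, hs2⟩, hq⟩ heq
    apply hq
    simp only at ht1 ht2 hs1 hs2
    have hs0 : s = 0 := by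
      by_contra hs0
      refine h.larmorArc_notMem_hull (t := t) hs0 ?_ (heq ▸ IsConvexClosedCurve.mem_hull g t₀)
      rw [abs_of_nonneg hs1]; nlinarith [Real.pi_pos]
    rw [hs0, larmorArc_zero] at heq
    obtain ⟨k, hk⟩ := h.eq_add_int heq
    have k1 : (k : ℝ) < 1 := by linarith
    have k2 : -1 < (k : ℝ) := by linarith
    have k1' : k < 1 := by exact_mod_cast k1
    have k2' : -1 < k := by exact_mod_cast k2
    have k0 : k = 0 := by omega
    rw [k0] at hk
    rw [hk, hs0, Metric.mem_ball]
    simpa using hρ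
  have hnb : ∀ᶠ s' in nhds (0 : ℝ), larmorArc R g (t₀, -s') ∉ larmorArc R g '' C := by
    have hcl : IsClosed (larmorArc R g '' C) := (hCc.image hE).isClosed
    have hc : Continuous fun s' => larmorArc R g (t₀, -s') := by fun_prop
    refine (hc.tendsto 0).eventually (hcl.isOpen_compl.mem_nhds ?_)
    rw [neg_zero, larmorArc_zero]
    rintro ⟨q, hq, hq'⟩
    exact hCne q hq hq'
  obtain ⟨δ, hδ, hδ'⟩ := Metric.eventually_nhds_iff.1 hnb
  refine ⟨min δ ρ, by positivity, ?_⟩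
  rintro s' ⟨hs'0, hs'δ⟩ ⟨t, s⟩ hs hsπ heq hang
  simp only at hs hsπ ⊢
  have hs'1 : s' < δ := hs'δ.trans_le (min_le_left _ _)
  have hs'2 : s' < ρ := hs'δ.trans_le (min_le_right _ _)
  have hnot := hδ' (y := s') (by rw [Real.dist_eq, sub_zero, abs_of_pos hs'0]; exact hs'1)
  -- the representative of `t` modulo `1` in the square
  obtain ⟨k, hk⟩ : ∃ k : ℤ, |t + k - t₀| ≤ 1 / 2 := ⟨-round (t - t₀), by
    have := abs_sub_round (t - t₀)
    push_cast
    rwa [show t + -(round (t - t₀) : ℝ) - t₀ = t - t₀ - round (t - t₀) by ring]⟩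
  have hin : |t + k - t₀| < ρ ∧ |s| < ρ := by
    by_contra hcon
    refine hnot ⟨(t + k, s), ⟨⟨⟨?_, ?_⟩, hs.le, hsπ.le⟩, fun hb => hcon ?_⟩, ?_⟩
    · have := (abs_le.1 hk).1; simp only; linarith
    · have := (abs_le.1 hk).2; simp only; linarith
    · rw [Metric.mem_ball, Prod.dist_eq, max_lt_iff, Real.dist_eq, Real.dist_eq, sub_zero] at hb
      exact hb
    · rw [h.larmorArc_add_int, heq]
  have hk0 : k = 0 := by
    have a1 := (hball' _ _ hin.1 hin.2).2.2
    have a2 := (hball' t₀ (-s') (by simpa using hρ) (by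
      rw [abs_neg, abs_of_pos hs'0]; exact hs'2)).2.2
    rw [h.polarAngle_add_int hz, hang] at a1
    have a3 : |(k : ℝ) * (ε * (2 * Real.pi))| < 2 * Real.pi := by
      rw [abs_lt] at a1 a2 ⊢
      constructor <;> linarith [a1.1, a1.2, a2.1, a2.2]
    rw [abs_mul, abs_mul, abs_of_pos Real.two_pi_pos,
      show |ε| = 1 by rcases h.sign with h1 | h1 <;> simp [h1], one_mul] at a3
    have a4 : |(k : ℝ)| < 1 := by
      by_contra! hcon
      nlinarith [Real.two_pi_pos]
    have a5 : |k| < 1 := by exact_mod_cast a4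
    exact Int.abs_lt_one_iff.1 a5
  rw [hk0, Int.cast_zero, add_zero] at hin
  have hin1 := abs_lt.1 hin.1
  refine ⟨by linarith, ?_⟩
  by_contra! hge
  -- otherwise the component along `τ` would increase from the point to `g t₀`, from there to `g t`
  -- and from there back to the point
  have mono : ∀ u, |u - t₀| < ρ → StrictMonoOn (fun s => inner ℝ τ (larmorArc R g (u, s)))
      (Set.Ioo (-ρ) ρ) := fun u hu => by
    refine strictMonoOn_of_deriv_pos (convex_Ioo _ _)
      (fun s _ => (h.hasDerivAt_inner_larmorArc τ u s).continuousAt.continuousWithinAt)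
      fun s hs => ?_
    rw [interior_Ioo] at hs
    rw [(h.hasDerivAt_inner_larmorArc τ u s).deriv]
    exact (hball' u s hu (abs_lt.2 hs)).1
  have b1 : inner ℝ τ (g t) < inner ℝ τ (larmorArc R g (t, s)) := by
    have := mono t hin.1 (a := 0) (b := s) ⟨by linarith, hρ⟩ (abs_lt.1 hin.2) hs
    simpa [larmorArc_zero] using this
  have b2 : inner ℝ τ (larmorArc R g (t₀, -s')) < inner ℝ τ (g t₀) := by
    have := mono t₀ (by simpa using hρ) (a := -s') (b := 0) ⟨by linarith, by linarith⟩
      ⟨by linarith, hρ⟩ (by linarith)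
    simpa [larmorArc_zero] using this
  have b3 : inner ℝ τ (g t₀) ≤ inner ℝ τ (g t) := by
    have hm : MonotoneOn (fun u => inner ℝ τ (g u)) (Set.Ioo (t₀ - ρ) (t₀ + ρ)) := by
      have hd : ∀ u, HasDerivAt (fun u => inner ℝ τ (g u)) (inner ℝ τ (deriv g u)) u := fun u =>
        (innerSL ℝ τ).hasFDerivAt.comp_hasDerivAt u (h.hasDerivAt u)
      refine monotoneOn_of_deriv_nonneg (convex_Ioo _ _)
        (fun u _ => (hd u).continuousAt.continuousWithinAt)
        (fun u _ => (hd u).differentiableAt.differentiableWithinAt) fun u hu => ?_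
      rw [interior_Ioo] at hu
      rw [(hd u).deriv]
      exact (hball' u 0 (abs_lt.2 ⟨by linarith [hu.1], by linarith [hu.2]⟩)
        (by simpa using hρ)).2.1.le
    exact hm ⟨by linarith, by linarith⟩ ⟨by linarith, by linarith⟩ hge
  rw [heq] at b1
  linarith

end IsObstacle

namespace IsTautString

variable {R ε : ℝ} {g : ℝ → ℂ} {X : ℂ} {q q' : ℝ × ℝ}

theorem abs_lt_arrive (hq : IsTautString R g X q q') : |q.2| < Real.pi * R := by
  rw [abs_of_pos hq.pos]; exact hq.lt_pi

theorem abs_lt_depart (hq : IsTautString R g X q q') : |q'.2| < Real.pi * R := by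
  rw [abs_of_neg hq.neg]; linarith [hq.neg_pi_lt]

theorem arcVelocity_ne (h : IsObstacle R g ε) (hq : IsTautString R g X q q') :
    arcVelocity R g q ≠ arcVelocity R g q' := by
  have := h.arcVelocity_ne (t := q.1) (t' := q'.1) (s' := -q'.2) hq.pos hq.lt_pi
    (by linarith [hq.neg]) (by linarith [hq.neg_pi_lt])
    (by rw [neg_neg]; exact hq.arrive.trans hq.depart.symm)
  rwa [neg_neg] at this

theorem inner_lt_one (h : IsObstacle R g ε) (hq : IsTautString R g X q q') :
    inner ℝ (arcVelocity R g q) (arcVelocity R g q') < 1 :=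
  (inner_lt_one_iff_real_of_norm_eq_one (h.norm_arcVelocity R q) (h.norm_arcVelocity R q')).2
    (hq.arcVelocity_ne h)

theorem add_int (h : IsObstacle R g ε) (hq : IsTautString R g X q q') (k : ℤ) :
    IsTautString R g X (q.1 + k, q.2) (q'.1 + k, q'.2) where
  arrive := by rw [h.larmorArc_add_int]; exact hq.arrive
  depart := by rw [h.larmorArc_add_int]; exact hq.depart
  pos := hq.pos
  lt_pi := hq.lt_pi
  neg := hq.neg
  neg_pi_lt := hq.neg_pi_lt
  lt := by have := hq.lt; simp only; linarith
  lt_add_one := by have := hq.lt_add_one; simp only; linarith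

/-- The taut string from a point is unique, up to a shift of the parameters by an integer. -/
theorem unique (h : IsObstacle R g ε) (hq : IsTautString R g X q q') {r r' : ℝ × ℝ}
    (hr : IsTautString R g X r r') :
    ∃ k : ℤ, q = (r.1 + k, r.2) ∧ q' = (r'.1 + k, r'.2) := by
  obtain ⟨⟨k, hk⟩, h1⟩ := h.larmorArc_unique (t := q.1) (t' := r.1) hq.abs_lt_arrive
    hr.abs_lt_arrive (mul_pos hq.pos hr.pos) (hq.arrive.trans hr.arrive.symm)
  obtain ⟨⟨m, hm⟩, h2⟩ := h.larmorArc_unique (t := q'.1) (t' := r'.1) hq.abs_lt_depart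
    hr.abs_lt_depart (mul_pos_of_neg_of_neg hq.neg hr.neg) (hq.depart.trans hr.depart.symm)
  have a1 := hq.lt
  have a2 := hq.lt_add_one
  have a3 := hr.lt
  have a4 := hr.lt_add_one
  have b1 : (k : ℝ) < m + 1 := by linarith
  have b2 : (m : ℝ) < k + 1 := by linarith
  have b1' : k < m + 1 := by exact_mod_cast b1
  have b2' : m < k + 1 := by exact_mod_cast b2
  obtain rfl : k = m := by omega
  exact ⟨k, Prod.ext hk h1, Prod.ext hm h2⟩

/-- Along a taut string the polar angle makes one turn, in the direction of the curve. By continuity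
along the departing arc this follows from the case of points close to the contact, because the two
contacts never coincide. -/
theorem polarAngle_eq (h : IsObstacle R g ε) (hX : X ∈ stringDomain R g)
    (hq : IsTautString R g X q q') {z : ℂ} (hz : z ∈ insideOf g) :
    polarAngle R g z q = polarAngle R g z q' + ε * (2 * Real.pi) := by
  obtain ⟨t₀, s₀⟩ := q'
  have hneg : s₀ < 0 := hq.neg
  have hs₀π : |s₀| < Real.pi * R := hq.abs_lt_depart
  have hXE : larmorArc R g (t₀, s₀) = X := hq.depart
  -- the arriving arcs at the points of the departing arc
  have hY : ∀ r ∈ Set.Ioc (0 : ℝ) 1, larmorArc R g (t₀, r * s₀) ∈ stringDomain R g :=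
    fun r hr => h.larmorArc_mul_mem_stringDomain hneg.ne hs₀π (hXE ▸ hX) hr
  have hex : ∀ r : ℝ, ∃ c : ℝ × ℝ, r ∈ Set.Ioc (0 : ℝ) 1 → (0 < 1 * c.2 ∧ |c.2| < Real.pi * R) ∧
      larmorArc R g c = larmorArc R g (t₀, r * s₀) ∧
        polarAngle R g z c = polarAngle R g z (t₀, r * s₀) := fun r => by
    by_cases hr : r ∈ Set.Ioc (0 : ℝ) 1
    · obtain ⟨c, hc⟩ := h.exists_arc_polarAngle hz (hY r hr) (h.larmorArc_sub_eq hz (t₀, r * s₀))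
        (Or.inl rfl)
      exact ⟨c, fun _ => hc⟩
    · exact ⟨0, fun hr' => absurd hr' hr⟩
  choose c hc using hex
  have hE := (h.contDiff_larmorArc R).continuous
  have hΘ := h.continuous_polarAngle hz
  have hcont : ContinuousOn c (Set.Ioc 0 1) :=
    h.continuousOn_arc hz (Or.inl rfl) (Continuous.continuousOn (by fun_prop))
      (Continuous.continuousOn (by fun_prop)) hc
  have hne : ∀ r ∈ Set.Ioc (0 : ℝ) 1, ∀ k : ℤ, (c r).1 ≠ t₀ + k := fun r hr k => by
    obtain ⟨⟨c1, c2⟩, c3, -⟩ := hc r hr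
    rw [one_mul] at c1
    rw [abs_of_pos c1] at c2
    rw [abs_of_neg hneg] at hs₀π
    refine h.ne_add_int (s := (c r).2) (s' := -(r * s₀)) c1 c2 (by nlinarith [hr.1])
      (by nlinarith [hr.1, hr.2]) ?_ k
    rw [neg_neg]; exact c3
  -- by continuity, the contact of the arriving arc stays between `t₀ - 1` and `t₀`
  obtain ⟨δ, hδ, hloc⟩ := h.lt_of_larmorArc_eq hz t₀
  obtain ⟨r₀, hr₀, hr₀lt⟩ : ∃ r ∈ Set.Ioc (0 : ℝ) 1, t₀ - 1 < (c r).1 ∧ (c r).1 < t₀ := by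
    have hpos : 0 < δ / (2 * -s₀) := div_pos hδ (by linarith)
    have hr : min 1 (δ / (2 * -s₀)) ∈ Set.Ioc (0 : ℝ) 1 := ⟨by positivity, min_le_left _ _⟩
    refine ⟨_, hr, ?_⟩
    obtain ⟨⟨c1, c2⟩, c3, c4⟩ := hc _ hr
    rw [one_mul] at c1
    rw [abs_of_pos c1] at c2
    set r := min 1 (δ / (2 * -s₀))
    have hrle : r ≤ δ / (2 * -s₀) := min_le_right _ _
    rw [le_div_iff₀ (by linarith)] at hrle
    refine hloc (-(r * s₀)) ⟨by nlinarith [hr.1], by nlinarith⟩ _ c1 c2 ?_ ?_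
    · rw [neg_neg]; exact c3
    · rw [neg_neg]; exact c4
  have hone : (1 : ℝ) ∈ Set.Ioc (0 : ℝ) 1 := ⟨one_pos, le_rfl⟩
  have hc1 : ContinuousOn (fun r => (c r).1) (Set.Ioc 0 1) := hcont.fst
  have hpre : IsPreconnected (Set.Ioc (0 : ℝ) 1) := isPreconnected_Ioc
  have hlt : t₀ - 1 < (c 1).1 ∧ (c 1).1 < t₀ := by
    constructor
    · by_contra! hcon
      obtain ⟨r, hr, hr'⟩ := hpre.intermediate_value hone hr₀ hc1 ⟨hcon, hr₀lt.1.le⟩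
      exact hne r hr (-1) (by push_cast; linarith [hr'])
    · by_contra! hcon
      obtain ⟨r, hr, hr'⟩ := hpre.intermediate_value hr₀ hone hc1 ⟨hr₀lt.2.le, hcon⟩
      exact hne r hr 0 (by push_cast; linarith [hr'])
  obtain ⟨⟨c1, c2⟩, c3, c4⟩ := hc 1 hone
  rw [one_mul] at c1 c3 c4
  -- the parameter `q.1` of the same contact lies between `t₀` and `t₀ + 1`
  obtain ⟨⟨k, hk⟩, h2⟩ := h.larmorArc_unique (t := q.1) (t' := (c 1).1) hq.abs_lt_arrive c2
    (mul_pos hq.pos c1) (by rw [Prod.mk.eta, Prod.mk.eta, c3, hXE]; exact hq.arrive)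
  have a1 : t₀ < q.1 := hq.lt
  have a2 : q.1 < t₀ + 1 := hq.lt_add_one
  have b1 : (0 : ℝ) < k := by linarith
  have b2 : (k : ℝ) < 2 := by linarith
  have b1' : 0 < k := by exact_mod_cast b1
  have b2' : k < 2 := by exact_mod_cast b2
  obtain rfl : k = 1 := by omega
  have : q = ((c 1).1 + 1, (c 1).2) := Prod.ext (by simpa using hk) h2
  rw [this, h.polarAngle_add_one hz, Prod.mk.eta, c4]

end IsTautString

namespace IsObstacle

variable {R ε : ℝ} {g : ℝ → ℂ}

theorem exists_isTautString_of_arrive (h : IsObstacle R g ε) {X : ℂ} (hX : X ∈ stringDomain R g)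
    {q : ℝ × ℝ} (hq : larmorArc R g q = X) (hq0 : 0 < q.2) (hqπ : q.2 < Real.pi * R) :
    ∃ q', IsTautString R g X q q' := by
  obtain ⟨t', s', hs', hs'π, hE⟩ := h.exists_larmorArc_eq_of_mem hX (Or.inr rfl : (-1 : ℝ) = 1 ∨ _)
  have hneg : s' < 0 := by linarith
  rw [abs_of_neg hneg] at hs'π
  have hne : ∀ k : ℤ, q.1 ≠ t' + k := h.ne_add_int (s' := -s') hq0 hqπ (by linarith) hs'π
    (by rw [neg_neg, hE]; exact hq)
  refine ⟨(t' + ⌊q.1 - t'⌋, s'), hq, by rw [h.larmorArc_add_int, hE], hq0, hqπ, hneg,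
    by simp only; linarith, ?_, ?_⟩
  · refine lt_of_le_of_ne ?_ (hne _).symm
    have := Int.floor_le (q.1 - t')
    simp only; linarith
  · have := Int.lt_floor_add_one (q.1 - t')
    simp only; linarith

theorem exists_isTautString (h : IsObstacle R g ε) {X : ℂ} (hX : X ∈ stringDomain R g) :
    ∃ q q', IsTautString R g X q q' := by
  obtain ⟨t, s, hs, hsπ, hE⟩ := h.exists_larmorArc_eq_of_mem hX (Or.inl rfl : (1 : ℝ) = 1 ∨ _)
  rw [one_mul] at hs
  rw [abs_of_pos hs] at hsπ
  exact ⟨_, h.exists_isTautString_of_arrive hX (q := (t, s)) hE hs hsπ⟩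

/-- Taut strings can be continued smoothly to the nearby points. -/
theorem exists_local_isTautString (h : IsObstacle R g ε) {X : ℂ} {q q' : ℝ × ℝ}
    (hq : IsTautString R g X q q') :
    ∃ e e' : ℂ → ℝ × ℝ, ContDiffAt ℝ ∞ e X ∧ ContDiffAt ℝ ∞ e' X ∧ e X = q ∧ e' X = q' ∧
      (∀ᶠ r in nhds q, e (larmorArc R g r) = r) ∧ (∀ᶠ r in nhds q', e' (larmorArc R g r) = r) ∧
      ∀ᶠ Y in nhds X, IsTautString R g Y (e Y) (e' Y) := by
  obtain ⟨e, e1, e2, e3, e4⟩ := h.exists_localInverse (t := q.1) hq.pos.ne' hq.abs_lt_arrive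
  obtain ⟨e', e1', e2', e3', e4'⟩ := h.exists_localInverse (t := q'.1) hq.neg.ne hq.abs_lt_depart
  rw [Prod.mk.eta, hq.arrive] at e1 e2 e3
  rw [Prod.mk.eta, hq.depart] at e1' e2' e3'
  refine ⟨e, e', e1, e1', e2, e2', e4, e4', ?_⟩
  have c := e1.continuousAt
  have c' := e1'.continuousAt
  have i1 : ∀ᶠ Y in nhds X, (e Y).2 ∈ Set.Ioo 0 (Real.pi * R) := by
    refine c.snd.eventually_mem (isOpen_Ioo.mem_nhds ?_)
    rw [e2]; exact ⟨hq.pos, hq.lt_pi⟩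
  have i2 : ∀ᶠ Y in nhds X, (e' Y).2 ∈ Set.Ioo (-(Real.pi * R)) 0 := by
    refine c'.snd.eventually_mem (isOpen_Ioo.mem_nhds ?_)
    rw [e2']; exact ⟨hq.neg_pi_lt, hq.neg⟩
  have i3 : ∀ᶠ Y in nhds X, (e Y).1 - (e' Y).1 ∈ Set.Ioo (0 : ℝ) 1 := by
    refine (c.fst.sub c'.fst).eventually_mem (isOpen_Ioo.mem_nhds ?_)
    simp only [Pi.sub_apply, e2, e2']
    exact ⟨by linarith [hq.lt], by linarith [hq.lt_add_one]⟩
  filter_upwards [e3, e3', i1, i2, i3] with Y y1 y2 y3 y4 y5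
  exact ⟨y1, y2, y3.1, y3.2, y4.2, y4.1, by linarith [y5.1], by linarith [y5.2]⟩

end IsObstacle


/-! ### The taut string as a closed path -/

theorem deriv_smoothTransition_eq_zero {x : ℝ} (hx : x ≤ 0 ∨ 1 ≤ x) :
    deriv Real.smoothTransition x = 0 := by
  rcases hx with hx | hx
  · refine IsLocalMin.deriv_eq_zero (Filter.Eventually.of_forall fun y => ?_)
    rw [Real.smoothTransition.zero_of_nonpos hx]
    exact Real.smoothTransition.nonneg y
  · refine IsLocalMax.deriv_eq_zero (Filter.Eventually.of_forall fun y => ?_)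
    rw [Real.smoothTransition.one_of_one_le hx]
    exact Real.smoothTransition.le_one y

theorem deriv_smoothTransition_nonneg (x : ℝ) : 0 ≤ deriv Real.smoothTransition x :=
  Real.smoothTransition.monotone.deriv_nonneg

theorem hasDerivAt_smoothTransition (x : ℝ) :
    HasDerivAt Real.smoothTransition (deriv Real.smoothTransition x) x :=
  ((Real.smoothTransition.contDiff (n := 1)).differentiable one_ne_zero x).hasDerivAt

/-- The coordinates of a moving point of a taut string: backwards along the departing arc to
the curve, along the curve, and forwards along the arriving arc. The motion stops at each of the
two transitions, so that the path is smooth. -/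
noncomputable def stringCoord (q q' : ℝ × ℝ) (s : ℝ) : ℝ × ℝ :=
  (q'.1 + (q.1 - q'.1) * Real.smoothTransition (3 * s - 1),
    q'.2 * (1 - Real.smoothTransition (3 * s)) + q.2 * Real.smoothTransition (3 * s - 2))

theorem contDiff_stringCoord (q q' : ℝ × ℝ) : ContDiff ℝ 1 (stringCoord q q') := by
  have h := Real.smoothTransition.contDiff (n := 1)
  have h1 : ContDiff ℝ 1 fun s : ℝ => Real.smoothTransition (3 * s - 1) := h.comp (by fun_prop)
  have h2 : ContDiff ℝ 1 fun s : ℝ => Real.smoothTransition (3 * s) := h.comp (by fun_prop)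
  have h3 : ContDiff ℝ 1 fun s : ℝ => Real.smoothTransition (3 * s - 2) := h.comp (by fun_prop)
  unfold stringCoord
  fun_prop

theorem hasDerivAt_stringCoord (q q' : ℝ × ℝ) (s : ℝ) :
    HasDerivAt (stringCoord q q')
      ((q.1 - q'.1) * (deriv Real.smoothTransition (3 * s - 1) * 3),
        -q'.2 * (deriv Real.smoothTransition (3 * s) * 3) +
          q.2 * (deriv Real.smoothTransition (3 * s - 2) * 3)) s := by
  have h0 : HasDerivAt (fun s : ℝ => 3 * s) 3 s := by
    simpa using (hasDerivAt_id s).const_mul (3 : ℝ)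
  have h1 := (hasDerivAt_smoothTransition (3 * s - 1)).comp s (h0.sub_const 1)
  have h2 := (hasDerivAt_smoothTransition (3 * s)).comp s h0
  have h3 := (hasDerivAt_smoothTransition (3 * s - 2)).comp s (h0.sub_const 2)
  refine HasDerivAt.prodMk ((h1.const_mul (q.1 - q'.1)).const_add q'.1) ?_
  refine (((h2.const_sub 1).const_mul q'.2).add (h3.const_mul q.2)).congr_deriv ?_
  ring

theorem stringCoord_zero (q q' : ℝ × ℝ) : stringCoord q q' 0 = q' := by
  ext <;> simp [stringCoord, Real.smoothTransition.zero_of_nonpos]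

theorem stringCoord_of_le (q q' : ℝ × ℝ) {s : ℝ} (hs : s ≤ 1 / 3) :
    stringCoord q q' s = (q'.1, (1 - Real.smoothTransition (3 * s)) * q'.2) := by
  rw [stringCoord, Real.smoothTransition.zero_of_nonpos (x := 3 * s - 1) (by linarith),
    Real.smoothTransition.zero_of_nonpos (x := 3 * s - 2) (by linarith)]
  ext <;> simp only <;> ring

theorem stringCoord_of_mem (q q' : ℝ × ℝ) {s : ℝ} (hs : 1 / 3 ≤ s) (hs' : s ≤ 2 / 3) :
    (stringCoord q q' s).2 = 0 := by
  have h2 : Real.smoothTransition (3 * s) = 1 :=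
    Real.smoothTransition.one_of_one_le (by linarith)
  have h3 : Real.smoothTransition (3 * s - 2) = 0 :=
    Real.smoothTransition.zero_of_nonpos (by linarith)
  simp [stringCoord, h2, h3]

theorem stringCoord_of_ge (q q' : ℝ × ℝ) {s : ℝ} (hs : 2 / 3 ≤ s) :
    stringCoord q q' s = (q.1, Real.smoothTransition (3 * s - 2) * q.2) := by
  rw [stringCoord, Real.smoothTransition.one_of_one_le (x := 3 * s - 1) (by linarith),
    Real.smoothTransition.one_of_one_le (x := 3 * s) (by linarith)]
  ext <;> simp only <;> ring

theorem stringCoord_one (q q' : ℝ × ℝ) : stringCoord q q' 1 = q := by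
  rw [stringCoord_of_ge q q' (by norm_num), Real.smoothTransition.one_of_one_le (by norm_num),
    one_mul]

namespace IsObstacle

variable {R ε : ℝ} {g : ℝ → ℂ}

theorem exists_intCast_eq_sign (h : IsObstacle R g ε) : ∃ n : ℤ, (n : ℝ) = ε := by
  rcases h.sign with h1 | h1
  · exact ⟨1, by simp [h1]⟩
  · exact ⟨-1, by simp [h1]⟩

/-- The winding number of the curve about a point inside is its orientation. -/
theorem hasWindingNumber (h : IsObstacle R g ε) {z : ℂ} (hz : z ∈ insideOf g) {n : ℤ}
    (hn : (n : ℝ) = ε) : HasWindingNumber g z n := by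
  have hΘ := h.continuous_polarAngle hz
  refine ⟨fun s => polarAngle R g z (s, 0), Continuous.continuousOn (by fun_prop),
    fun s _ => ?_, ?_⟩
  · have h1 := h.larmorArc_sub_eq hz (s, 0)
    have h2 := h.larmorArc_ne hz (s, 0)
    rw [larmorArc_zero] at h1 h2
    exact ⟨sub_ne_zero.1 h2, h1⟩
  · have h1 := h.polarAngle_add_one hz 0 0
    rw [zero_add] at h1
    simp only [h1, hn]; ring

end IsObstacle

namespace IsTautString

variable {R ε : ℝ} {g : ℝ → ℂ} {X : ℂ} {q q' : ℝ × ℝ}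

/-- The path moves forwards in the direction of `arcVelocity`, hence for it the calibration
inequality `momentum_le` is an equality. -/
theorem hasDerivAt_stringPath (h : IsObstacle R g ε) (hq : IsTautString R g X q q') (s : ℝ) :
    ∃ k : ℝ, 0 ≤ k ∧ HasDerivAt (fun s => larmorArc R g (stringCoord q q' s))
      ((k : ℂ) * arcVelocity R g (stringCoord q q' s)) s ∧
      HasDerivAt (fun s => arcPotential R g (stringCoord q q' s))
        (momentum R (larmorArc R g (stringCoord q q' s)) (arcVelocity R g (stringCoord q q' s))
          ((k : ℂ) * arcVelocity R g (stringCoord q q' s))) s := by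
  have d := hasDerivAt_stringCoord q q' s
  have hE := (h.hasFDerivAt_larmorArc h.pos (stringCoord q q' s)).comp_hasDerivAt s d
  have hW := (h.hasFDerivAt_arcPotential h.pos (stringCoord q q' s)).comp_hasDerivAt s d
  simp only [ContinuousLinearMap.comp_apply] at hW
  have hlt := hq.lt
  have hp := hq.pos
  have hn := hq.neg
  suffices hk : ∃ k : ℝ, 0 ≤ k ∧
      ((ContinuousLinearMap.fst ℝ ℝ ℝ).smulRight (arcVariation R g (stringCoord q q' s)) +
        (ContinuousLinearMap.snd ℝ ℝ ℝ).smulRight (arcVelocity R g (stringCoord q q' s)))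
        ((q.1 - q'.1) * (deriv Real.smoothTransition (3 * s - 1) * 3),
        -q'.2 * (deriv Real.smoothTransition (3 * s) * 3) +
          q.2 * (deriv Real.smoothTransition (3 * s - 2) * 3)) =
        (k : ℂ) * arcVelocity R g (stringCoord q q' s) by
    obtain ⟨k, hk0, hk⟩ := hk
    rw [hk] at hE hW
    exact ⟨k, hk0, hE, hW⟩
  have n1 := deriv_smoothTransition_nonneg (3 * s - 1)
  have n2 := deriv_smoothTransition_nonneg (3 * s)
  have n3 := deriv_smoothTransition_nonneg (3 * s - 2)
  by_cases hs : 1 / 3 < s ∧ s < 2 / 3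
  · have e2 := deriv_smoothTransition_eq_zero (x := 3 * s) (Or.inr (by linarith [hs.1]))
    have e3 := deriv_smoothTransition_eq_zero (x := 3 * s - 2) (Or.inl (by linarith [hs.2]))
    have e0 := stringCoord_of_mem q q' hs.1.le hs.2.le
    rw [e2, e3, show stringCoord q q' s = ((stringCoord q q' s).1, 0) from Prod.ext rfl e0]
    refine ⟨(q.1 - q'.1) * (deriv Real.smoothTransition (3 * s - 1) * 3) *
      speed g (stringCoord q q' s).1, mul_nonneg (mul_nonneg (by linarith) (by linarith))
        (h.speed_pos _).le, ?_⟩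
    simp [arcVariation, arcVelocity_zero]
    ring
  · have e1 : deriv Real.smoothTransition (3 * s - 1) = 0 := by
      refine deriv_smoothTransition_eq_zero ?_
      by_contra! hc
      exact hs ⟨by linarith, by linarith⟩
    rw [e1]
    refine ⟨-q'.2 * (deriv Real.smoothTransition (3 * s) * 3) +
      q.2 * (deriv Real.smoothTransition (3 * s - 2) * 3), add_nonneg (mul_nonneg (by linarith)
        (by linarith)) (mul_nonneg hp.le (by linarith)), ?_⟩
    simp

theorem finslerLength_stringPath (h : IsObstacle R g ε) (hq : IsTautString R g X q q') :
    finslerLength R (fun s => larmorArc R g (stringCoord q q' s)) =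
      arcPotential R g q - arcPotential R g q' := by
  have hc := contDiff_stringCoord q q'
  have hd : ∀ s, HasDerivAt (fun s => arcPotential R g (stringCoord q q' s))
      (magneticLagrangian R (larmorArc R g (stringCoord q q' s))
        (deriv (fun s => larmorArc R g (stringCoord q q' s)) s)) s := fun s => by
    obtain ⟨k, hk, h1, h2⟩ := hq.hasDerivAt_stringPath h s
    refine h2.congr_deriv ?_
    rw [h1.deriv, momentum_apply, magneticLagrangian, inner_ofReal_mul_right,
      real_inner_self_eq_norm_sq, norm_mul, h.norm_arcVelocity, Complex.norm_real,
      Real.norm_of_nonneg hk]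
    ring
  have hcont : Continuous fun s => magneticLagrangian R (larmorArc R g (stringCoord q q' s))
        (deriv (fun s => larmorArc R g (stringCoord q q' s)) s) := by
    have h1 : ContDiff ℝ 1 fun s => arcPotential R g (stringCoord q q' s) :=
      ((h.contDiff_arcPotential R).of_le (by exact_mod_cast le_top)).comp hc
    have h2 := h1.continuous_deriv le_rfl
    rwa [show deriv (fun s => arcPotential R g (stringCoord q q' s)) = _ from
      funext fun s => (hd s).deriv] at h2
  rw [finslerLength, intervalIntegral.integral_eq_sub_of_hasDerivAt (fun s _ => hd s)
    (hcont.intervalIntegrable _ _), stringCoord_zero, stringCoord_one]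

theorem isLoopAround_stringPath (h : IsObstacle R g ε) (hX : X ∈ stringDomain R g)
    (hq : IsTautString R g X q q') :
    IsLoopAround R g X fun s => larmorArc R g (stringCoord q q' s) := by
  have hc := contDiff_stringCoord q q'
  obtain ⟨n, hn⟩ := h.exists_intCast_eq_sign
  refine ⟨(((h.contDiff_larmorArc R).of_le (by exact_mod_cast le_top)).comp hc).contDiffOn,
    by rw [stringCoord_zero, hq.depart], by rw [stringCoord_one, hq.arrive], fun s _ hs =>
      h.larmorArc_ne hs _ (sub_self _), fun z hz => ⟨n, ?_, h.hasWindingNumber hz hn⟩, ?_⟩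
  · have hΘ := h.continuous_polarAngle hz
    refine ⟨fun s => polarAngle R g z (stringCoord q q' s), ?_, fun s _ =>
      ⟨sub_ne_zero.1 (h.larmorArc_ne hz _), h.larmorArc_sub_eq hz _⟩, ?_⟩
    · have := hc.continuous
      exact Continuous.continuousOn (by fun_prop)
    · simp only [stringCoord_zero, stringCoord_one, hq.polarAngle_eq h hX hz, hn]
      ring
  · obtain ⟨-, p, hp, hXp⟩ := hX
    refine ⟨p, hp, ?_⟩
    rintro _ ⟨s, hs, rfl⟩
    simp only
    rcases le_total s (1 / 3) with h1 | h1
    · rw [stringCoord_of_le q q' h1]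
      exact h.larmorArc_mul_mem_ball (hp ⟨_, rfl⟩) hq.abs_lt_depart
        (by rw [Prod.mk.eta, hq.depart]; exact hXp)
        ⟨by linarith [Real.smoothTransition.le_one (3 * s)],
          by linarith [Real.smoothTransition.nonneg (3 * s)]⟩
    rcases le_total s (2 / 3) with h2 | h2
    · rw [show stringCoord q q' s = ((stringCoord q q' s).1, 0) from
        Prod.ext rfl (stringCoord_of_mem q q' h1 h2), larmorArc_zero]
      exact hp ⟨_, rfl⟩
    · rw [stringCoord_of_ge q q' h2]
      exact h.larmorArc_mul_mem_ball (hp ⟨_, rfl⟩) hq.abs_lt_arrive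
        (by rw [Prod.mk.eta, hq.arrive]; exact hXp)
        ⟨Real.smoothTransition.nonneg _, Real.smoothTransition.le_one _⟩

/-- The length of a taut string is the length of a closed path around the obstacle. -/
theorem mem_loopLengths (h : IsObstacle R g ε) (hX : X ∈ stringDomain R g)
    (hq : IsTautString R g X q q') :
    arcPotential R g q - arcPotential R g q' ∈ loopLengths R g X :=
  ⟨_, hq.isLoopAround_stringPath h hX, hq.finslerLength_stringPath h⟩

end IsTautString


/-! ### Lengths of paths -/

theorem hasDerivAt_of_contDiffOn_Icc {γ : ℝ → ℂ} (hγ : ContDiffOn ℝ 1 γ (Set.Icc 0 1)) {s : ℝ}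
    (hs : s ∈ Set.Ioo (0 : ℝ) 1) : HasDerivAt γ (deriv γ s) s :=
  ((hγ.differentiableOn one_ne_zero).differentiableAt (Icc_mem_nhds hs.1 hs.2)).hasDerivAt

theorem integrableOn_comp_deriv {γ : ℝ → ℂ} (hγ : ContDiffOn ℝ 1 γ (Set.Icc 0 1))
    {F : ℂ × ℂ → ℝ} (hF : Continuous F) :
    MeasureTheory.IntegrableOn (fun s => F (γ s, deriv γ s)) (Set.Icc 0 1) := by
  have h1 : ContinuousOn (fun s => F (γ s, derivWithin γ (Set.Icc 0 1) s)) (Set.Icc 0 1) :=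
    hF.comp_continuousOn (hγ.continuousOn.prodMk
      (hγ.continuousOn_derivWithin (uniqueDiffOn_Icc one_pos) le_rfl))
  have h2 := h1.integrableOn_Icc (μ := MeasureTheory.volume)
  rw [integrableOn_Icc_iff_integrableOn_Ioo] at h2 ⊢
  refine h2.congr_fun (fun s hs => ?_) measurableSet_Ioo
  simp only [derivWithin_of_mem_nhds (Icc_mem_nhds hs.1 hs.2)]

theorem continuous_magneticLagrangian (R : ℝ) :
    Continuous fun p : ℂ × ℂ => magneticLagrangian R p.1 p.2 := by
  unfold magneticLagrangian cross
  fun_prop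

theorem integrableOn_lagrangian (R : ℝ) {γ : ℝ → ℂ} (hγ : ContDiffOn ℝ 1 γ (Set.Icc 0 1)) :
    MeasureTheory.IntegrableOn (fun s => magneticLagrangian R (γ s) (deriv γ s)) (Set.Icc 0 1) :=
  integrableOn_comp_deriv hγ (continuous_magneticLagrangian R)

theorem finslerLength_eq_add (R : ℝ) {γ : ℝ → ℂ} (hγ : ContDiffOn ℝ 1 γ (Set.Icc 0 1)) {c : ℝ}
    (hc : c ∈ Set.Icc (0 : ℝ) 1) :
    finslerLength R γ = (∫ s in (0 : ℝ)..c, magneticLagrangian R (γ s) (deriv γ s)) +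
      ∫ s in c..1, magneticLagrangian R (γ s) (deriv γ s) := by
  have h := integrableOn_lagrangian R hγ
  refine (intervalIntegral.integral_add_adjacent_intervals ?_ ?_).symm
  · exact (intervalIntegrable_iff_integrableOn_Icc_of_le hc.1).2
      (h.mono_set (Set.Icc_subset_Icc_right hc.2))
  · exact (intervalIntegrable_iff_integrableOn_Icc_of_le hc.2).2
      (h.mono_set (Set.Icc_subset_Icc_left hc.1))

/-- Calibration: a function whose derivative along the path is bounded by the Lagrangian bounds
the length of the path from below. -/
theorem sub_le_integral_lagrangian {R : ℝ} {γ : ℝ → ℂ} (hγ : ContDiffOn ℝ 1 γ (Set.Icc 0 1))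
    {a b : ℝ} (ha : 0 ≤ a) (hab : a ≤ b) (hb : b ≤ 1) {f f' : ℝ → ℝ}
    (hf : ContinuousOn f (Set.Icc a b)) (hd : ∀ s ∈ Set.Ioo a b, HasDerivAt f (f' s) s)
    (hle : ∀ s ∈ Set.Ioo a b, f' s ≤ magneticLagrangian R (γ s) (deriv γ s)) :
    f b - f a ≤ ∫ s in a..b, magneticLagrangian R (γ s) (deriv γ s) :=
  intervalIntegral.sub_le_integral_of_hasDeriv_right_of_le hab hf
    (fun s hs => (hd s hs).hasDerivWithinAt)
    ((integrableOn_lagrangian R hγ).mono_set (Set.Icc_subset_Icc ha hb)) hle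

/-! ### Free minimality of short Larmor arcs -/

/-- The action of the Larmor arc shorter than a half circle from `X` to `Y`. -/
noncomputable def chordAction (R : ℝ) (X Y : ℂ) : ℝ :=
  R * (Real.arcsin (‖Y - X‖ / (2 * R)) +
    ‖Y - X‖ / (2 * R) * Real.sqrt (1 - (‖Y - X‖ / (2 * R)) ^ 2)) - 1 / (2 * R) * cross X Y

theorem chordAction_self (R : ℝ) (X : ℂ) : chordAction R X X = 0 := by
  simp [chordAction, cross_same]

theorem continuous_chordAction (R : ℝ) (X : ℂ) : Continuous (chordAction R X) := by
  have h1 : Continuous fun Y => Real.arcsin (‖Y - X‖ / (2 * R)) :=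
    Real.continuous_arcsin.comp (by fun_prop)
  have h2 : Continuous fun Y => cross X Y := (crossCLM X).continuous
  unfold chordAction
  fun_prop

theorem hasDerivAt_arcsin_add {x : ℝ} (h1 : -1 < x) (h2 : x < 1) :
    HasDerivAt (fun x => Real.arcsin x + x * Real.sqrt (1 - x ^ 2)) (2 * Real.sqrt (1 - x ^ 2))
      x := by
  have hpos : 0 < 1 - x ^ 2 := by nlinarith
  have hs := Real.sqrt_pos.2 hpos
  have hsq := Real.sq_sqrt hpos.le
  have d1 := Real.hasDerivAt_arcsin h1.ne' h2.ne
  have d2 : HasDerivAt (fun x : ℝ => 1 - x ^ 2) (-(2 * x)) x := by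
    simpa using (hasDerivAt_pow 2 x).const_sub 1
  refine (d1.add ((hasDerivAt_id x).mul (d2.sqrt hpos.ne'))).congr_deriv ?_
  simp only [id]
  field_simp
  linear_combination -hsq

/-- The action of the short arcs from a fixed point is a calibration: by the Cauchy-Schwarz
inequality its derivative is bounded by the Lagrangian. -/
theorem hasDerivAt_chordAction {R : ℝ} (hR : 0 < R) {X : ℂ} {γ : ℝ → ℂ} {w : ℂ} {s : ℝ}
    (hγ : HasDerivAt γ w s) (h0 : γ s ≠ X) (h2 : ‖γ s - X‖ < 2 * R) :
    ∃ d ≤ magneticLagrangian R (γ s) w, HasDerivAt (fun s => chordAction R X (γ s)) d s := by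
  have hn : 0 < ‖γ s - X‖ := norm_pos_iff.2 (sub_ne_zero.2 h0)
  have d0 := hγ.sub_const X
  have d1 : HasDerivAt (fun s => ‖γ s - X‖) (inner ℝ (γ s - X) w / ‖γ s - X‖) s := by
    have := (d0.norm_sq).sqrt (by positivity)
    simp only [Real.sqrt_sq (norm_nonneg _)] at this
    refine this.congr_deriv ?_
    field_simp
  have hρ0 : 0 < ‖γ s - X‖ / (2 * R) := by positivity
  have hρ1 : ‖γ s - X‖ / (2 * R) < 1 := by rwa [div_lt_one (by positivity)]
  have d2 := (hasDerivAt_arcsin_add (by linarith) hρ1).comp s (d1.div_const (2 * R))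
  have d3 : HasDerivAt (fun s => cross X (γ s)) (cross X w) s :=
    (crossCLM X).hasFDerivAt.comp_hasDerivAt s hγ
  have d4 := (d2.const_mul R).sub (d3.const_mul (1 / (2 * R)))
  refine ⟨_, ?_, d4⟩
  have hsq := Real.sq_sqrt (show 0 ≤ 1 - (‖γ s - X‖ / (2 * R)) ^ 2 by nlinarith)
  have hs0 := Real.sqrt_nonneg (1 - (‖γ s - X‖ / (2 * R)) ^ 2)
  set S := Real.sqrt (1 - (‖γ s - X‖ / (2 * R)) ^ 2)
  set r := ‖γ s - X‖ with hr
  have hcs : (inner ℝ (γ s - X) w) ^ 2 + (cross (γ s - X) w) ^ 2 = (r * ‖w‖) ^ 2 := by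
    rw [hr, mul_pow, Complex.sq_norm, Complex.sq_norm, inner_eq_re]
    simp only [cross, Complex.normSq_apply]
    ring
  -- `(S, r / (2R))` are the cosine and the sine of the half-angle of the arc
  have hle : S * inner ℝ (γ s - X) w + r / (2 * R) * cross (γ s - X) w ≤ r * ‖w‖ := by
    refine le_of_sq_le_sq ?_ (by positivity)
    nlinarith [sq_nonneg (S * cross (γ s - X) w - r / (2 * R) * inner ℝ (γ s - X) w)]
  have hc : cross X w = cross (γ s) w - cross (γ s - X) w := by
    rw [cross_sub_left]; ring
  rw [magneticLagrangian, cross_comm w (γ s), hc]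
  have hle' : S * inner ℝ (γ s - X) w / r + 1 / (2 * R) * cross (γ s - X) w ≤ ‖w‖ := by
    rw [← mul_le_mul_iff_of_pos_left hn]
    refine le_trans (le_of_eq ?_) hle
    field_simp
  refine le_trans (le_of_eq ?_) (add_le_add_left hle' (1 / (2 * R) * -cross (γ s) w))
  field_simp
  ring

/-- In an open disc of radius `R`, the Larmor arc shorter than a half circle is the shortest path
between two points. -/
theorem chordAction_le_integral {R : ℝ} (hR : 0 < R) {γ : ℝ → ℂ}
    (hγ : ContDiffOn ℝ 1 γ (Set.Icc 0 1)) {p : ℂ} (hp : ∀ s ∈ Set.Icc (0 : ℝ) 1,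
      γ s ∈ Metric.ball p R) {b : ℝ} (hb : b ∈ Set.Icc (0 : ℝ) 1) :
    chordAction R (γ 0) (γ b) ≤ ∫ s in (0 : ℝ)..b, magneticLagrangian R (γ s) (deriv γ s) := by
  have hcont := hγ.continuousOn
  have hcb : ContinuousOn γ (Set.Icc 0 b) := hcont.mono (Set.Icc_subset_Icc_right hb.2)
  -- `chordAction` is not differentiable at the starting point, so that the path is divided at its
  -- last visit there
  obtain ⟨c, ⟨hc, hcX⟩, hmax⟩ : ∃ c, IsGreatest (Set.Icc 0 b ∩ γ ⁻¹' {γ 0}) c := by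
    refine IsCompact.exists_isGreatest ?_ ⟨0, ⟨le_rfl, hb.1⟩, rfl⟩
    exact isCompact_Icc.of_isClosed_subset
      (hcb.preimage_isClosed_of_isClosed isClosed_Icc isClosed_singleton) Set.inter_subset_left
  have hcX : γ c = γ 0 := hcX
  -- closed paths in the disc have nonnegative length, by comparison with a linear function
  have i1 : 0 ≤ ∫ s in (0 : ℝ)..c, magneticLagrangian R (γ s) (deriv γ s) := by
    have hlin : ∀ z w : ℂ, ∀ s, HasDerivAt γ w s → HasDerivAt (fun s => 1 / (2 * R) * cross (γ s) z)
        (1 / (2 * R) * cross w z) s := fun z w s hs =>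
      ((crossCLM.flip z).hasFDerivAt.comp_hasDerivAt s hs).const_mul _
    have := sub_le_integral_lagrangian (R := R) hγ le_rfl hc.1 (hc.2.trans hb.2)
      (f := fun s => 1 / (2 * R) * cross (γ s) p)
      (f' := fun s => 1 / (2 * R) * cross (deriv γ s) p) ?_
      (fun s hs => hlin p _ s (hasDerivAt_of_contDiffOn_Icc hγ ⟨hs.1, hs.2.trans_le
        (hc.2.trans hb.2)⟩)) ?_
    · simp only [hcX, sub_self] at this
      exact this
    · have h1 : Continuous fun y => cross y p := (crossCLM.flip p).continuous
      exact continuousOn_const.mul (h1.comp_continuousOn (hcb.mono (Set.Icc_subset_Icc_right hc.2)))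
    · intro s hs
      have hb' := hp s ⟨hs.1.le, hs.2.le.trans (hc.2.trans hb.2)⟩
      rw [Metric.mem_ball, dist_eq_norm] at hb'
      have h1 : |cross (deriv γ s) (γ s - p)| ≤ ‖deriv γ s‖ * R :=
        (abs_cross_le _ _).trans (by gcongr)
      have h2 : 1 / (2 * R) * cross (deriv γ s) (γ s - p) ≥ -(‖deriv γ s‖ / 2) := by
        have h3 := (abs_le.1 h1).1
        calc -(‖deriv γ s‖ / 2) = 1 / (2 * R) * -(‖deriv γ s‖ * R) := by field_simp
          _ ≤ _ := by gcongr
      rw [magneticLagrangian]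
      rw [cross_sub_right, mul_sub] at h2
      linarith [norm_nonneg (deriv γ s)]
  have i2 : chordAction R (γ 0) (γ b) ≤ ∫ s in c..b, magneticLagrangian R (γ s) (deriv γ s) := by
    have hex : ∀ s ∈ Set.Ioo c b, ∃ d ≤ magneticLagrangian R (γ s) (deriv γ s),
        HasDerivAt (fun s => chordAction R (γ 0) (γ s)) d s := fun s hs => by
      have hs01 : s ∈ Set.Ioo (0 : ℝ) 1 := ⟨hc.1.trans_lt hs.1, hs.2.trans_le hb.2⟩
      refine hasDerivAt_chordAction hR (hasDerivAt_of_contDiffOn_Icc hγ hs01) (fun h0 => ?_) ?_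
      · exact absurd (hmax ⟨⟨hs01.1.le, hs.2.le⟩, h0⟩) (not_le.2 hs.1)
      · have h1 := hp s ⟨hs01.1.le, hs01.2.le⟩
        have h2 := hp 0 ⟨le_rfl, zero_le_one⟩
        rw [Metric.mem_ball] at h1 h2
        rw [← dist_eq_norm]
        linarith [dist_triangle_right (γ s) (γ 0) p]
    choose! d hd hd' using hex
    have := sub_le_integral_lagrangian hγ hc.1 hc.2 hb.2
      ((continuous_chordAction R (γ 0)).comp_continuousOn
        (hcb.mono (Set.Icc_subset_Icc_left hc.1))) hd' hd
    simpa only [Function.comp_apply, hcX, chordAction_self, sub_zero] using this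
  have h := integrableOn_lagrangian R hγ
  rw [← intervalIntegral.integral_add_adjacent_intervals (b := c)
    ((intervalIntegrable_iff_integrableOn_Icc_of_le hc.1).2
      (h.mono_set (Set.Icc_subset_Icc_right (hc.2.trans hb.2))))
    ((intervalIntegrable_iff_integrableOn_Icc_of_le hc.2).2
      (h.mono_set (Set.Icc_subset_Icc hc.1 hb.2)))]
  linarith

/-- For two points of a Larmor arc, on one or on both sides of the contact, the difference of the
potentials is the action of the part between them. -/
theorem IsObstacle.chordAction_larmorArc {R ε : ℝ} {g : ℝ → ℂ} (h : IsObstacle R g ε)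
    {t s s' : ℝ} (hs : s' < s) (hsum : s - s' < Real.pi * R) :
    chordAction R (larmorArc R g (t, s')) (larmorArc R g (t, s)) =
      arcPotential R g (t, s) - arcPotential R g (t, s') := by
  have hR := h.pos
  set a := (s - s') / (2 * R) with ha
  have ha0 : 0 < a := div_pos (by linarith) (by positivity)
  have ha1 : a < Real.pi / 2 := by
    rw [ha, div_lt_iff₀ (by positivity)]; linarith
  have hsa : 0 < Real.sin a := Real.sin_pos_of_pos_of_lt_pi ha0 (by linarith)
  have hca : 0 < Real.cos a := Real.cos_pos_of_mem_Ioo ⟨by linarith, ha1⟩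
  set v := arcVelocity R g (t, s)
  set v' := arcVelocity R g (t, s')
  have hvv : v = v' * Complex.exp ((2 * a : ℝ) * Complex.I) := by
    simp only [v, v', arcVelocity]
    rw [mul_assoc, ← Complex.exp_add]
    congr 2
    rw [← add_mul, ← Complex.ofReal_add]
    congr 2
    rw [ha]; field_simp; ring
  have hv' : ‖v'‖ = 1 := h.norm_arcVelocity R _
  have hcr : cross v' v = 2 * Real.sin a * Real.cos a := by
    rw [hvv, cross_mul_exp, hv', Real.sin_two_mul]; ring
  have hY : larmorArc R g (t, s) = larmorCenter R g t - R * (Complex.I * v) := rfl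
  have hX : larmorArc R g (t, s') = larmorCenter R g t - R * (Complex.I * v') := rfl
  have hr : ‖larmorArc R g (t, s) - larmorArc R g (t, s')‖ / (2 * R) = Real.sin a := by
    have h1 : larmorArc R g (t, s) - larmorArc R g (t, s') =
        -(R * (Complex.I * (v' * (Complex.exp ((2 * a : ℝ) * Complex.I) - 1)))) := by
      rw [hY, hX, hvv]; ring
    have h2 : ‖Complex.exp ((2 * a : ℝ) * Complex.I) - 1‖ = 2 * Real.sin a := by
      rw [mul_comm (_ : ℂ) Complex.I, Complex.norm_exp_I_mul_ofReal_sub_one, mul_div_cancel_left₀ _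
        two_ne_zero, Real.norm_of_nonneg (by positivity)]
    rw [h1, norm_neg, norm_mul, norm_mul, norm_mul, h2, hv', Complex.norm_I, Complex.norm_real,
      Real.norm_of_nonneg hR.le]
    field_simp
  have hRa : R * a = (s - s') / 2 := by rw [ha]; field_simp
  rw [chordAction, hr, Real.arcsin_sin (by linarith) ha1.le,
    ← Real.cos_eq_sqrt_one_sub_sin_sq (by linarith) ha1.le, arcPotential, arcPotential, hX, hY]
  simp only [cross] at hcr
  simp [cross]
  field_simp
  linear_combination (2 * R) * hRa - R ^ 2 * hcr


/-! ### The taut string is the shortest loop -/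

theorem HasWindingNumber.unique {γ : ℝ → ℂ} {z : ℂ} {m n : ℤ} (hm : HasWindingNumber γ z m)
    (hn : HasWindingNumber γ z n) : m = n := by
  have key : ∀ {m n : ℤ}, HasWindingNumber γ z m → HasWindingNumber γ z n → n ≤ m := by
    rintro m n ⟨θ, hθ, hθz, hθ1⟩ ⟨η, hη, hηz, hη1⟩
    by_contra! hlt
    -- the difference of the two polar angles takes only values in `2πℤ`
    have hint : ∀ s ∈ Set.Icc (0 : ℝ) 1, ∃ k : ℤ, η s - θ s = k * (2 * Real.pi) := fun s hs => by
      have h1 := (hθz s hs).2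
      have h0 : (‖γ s - z‖ : ℂ) ≠ 0 := by
        exact_mod_cast norm_ne_zero_iff.2 (sub_ne_zero.2 (hθz s hs).1)
      obtain ⟨k, hk⟩ := Complex.exp_eq_exp_iff_exists_int.1
        (mul_left_cancel₀ h0 ((hηz s hs).2.symm.trans h1))
      refine ⟨k, ?_⟩
      have h3 : (η s : ℂ) * Complex.I = ((θ s + k * (2 * Real.pi) : ℝ) : ℂ) * Complex.I := by
        rw [hk]; push_cast; ring
      have h4 : η s = θ s + k * (2 * Real.pi) := by
        exact_mod_cast mul_right_cancel₀ Complex.I_ne_zero h3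
      linarith
    have hπ := Real.pi_pos
    have hlt' : (m : ℝ) + 1 ≤ n := by exact_mod_cast hlt
    obtain ⟨s, hs, hs'⟩ := intermediate_value_Icc zero_le_one (hη.sub hθ)
      (show η 0 - θ 0 + Real.pi ∈ Set.Icc (η 0 - θ 0) (η 1 - θ 1) from
        ⟨by linarith, by nlinarith⟩)
    obtain ⟨k, hk⟩ := hint s hs
    obtain ⟨j, hj⟩ := hint 0 ⟨le_rfl, zero_le_one⟩
    have hs'' : η s - θ s = η 0 - θ 0 + Real.pi := hs'
    rw [hk, hj] at hs''
    have h5 : (2 * k : ℝ) = 2 * j + 1 := by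
      have : Real.pi * (2 * k) = Real.pi * (2 * j + 1) := by linarith
      exact mul_left_cancel₀ hπ.ne' this
    have h6 : 2 * k = 2 * j + 1 := by exact_mod_cast h5
    omega
  exact le_antisymm (key hn hm) (key hm hn)

namespace IsObstacle

variable {R ε : ℝ} {g : ℝ → ℂ}

/-- The action of the tangent arcs to the points of a path changes at the rate of the momentum. -/
theorem hasDerivAt_arcPotential_comp (h : IsObstacle R g ε) {c : ℝ → ℝ × ℝ} {β : ℝ → ℂ} {w : ℂ}
    {s : ℝ} (hc : ContinuousAt c s) (h0 : (c s).2 ≠ 0) (hπ : |(c s).2| < Real.pi * R)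
    (hE : ∀ᶠ u in nhds s, larmorArc R g (c u) = β u) (hβ : HasDerivAt β w s) :
    HasDerivAt (fun u => arcPotential R g (c u))
      (momentum R (β s) (arcVelocity R g (c s)) w) s := by
  obtain ⟨e, e1, e2, -, e4⟩ := h.exists_localInverse (t := (c s).1) h0 hπ
  rw [Prod.mk.eta, hE.self_of_nhds] at e1 e2
  rw [Prod.mk.eta] at e4
  have hcd : HasDerivAt c (fderiv ℝ e (β s) w) s := by
    have h1 := (e1.differentiableAt (by simp)).hasFDerivAt.comp_hasDerivAt s hβ
    refine h1.congr_of_eventuallyEq ?_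
    filter_upwards [hE, hc.eventually e4] with u h2 h3
    rw [Function.comp_apply, ← h2, h3]
  have hEd := (h.hasFDerivAt_larmorArc h.pos (c s)).comp_hasDerivAt s hcd
  have hw := (hEd.congr_of_eventuallyEq (f₁ := β) (by
    filter_upwards [hE] with u h2; exact h2.symm)).unique hβ
  have hW := (h.hasFDerivAt_arcPotential h.pos (c s)).comp_hasDerivAt s hcd
  rw [ContinuousLinearMap.comp_apply, hw, hE.self_of_nhds] at hW
  exact hW

end IsObstacle

namespace IsTautString

variable {R ε : ℝ} {g : ℝ → ℂ} {X : ℂ} {q q' : ℝ × ℝ}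

theorem sub_eq_sub (h : IsObstacle R g ε) (hq : IsTautString R g X q q') {r r' : ℝ × ℝ}
    (hr : IsTautString R g X r r') : arcPotential R g q - arcPotential R g q' =
      arcPotential R g r - arcPotential R g r' := by
  obtain ⟨k, rfl, rfl⟩ := hq.unique h hr
  rw [h.arcPotential_add_int, h.arcPotential_add_int]
  ring

/-- A loop that does not touch the obstacle is at least as long as the taut string: up to the moment
at which the arriving arc to the moving point has the same contact as the departing arc to `X`, by
the minimality of Larmor arcs, and after this moment by the calibration with the arriving arcs. -/
theorem le_finslerLength_of_notMem_hull (h : IsObstacle R g ε) (hq : IsTautString R g X q q')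
    {z : ℂ} (hz : z ∈ insideOf g) {p : ℂ} (hp : Set.range g ⊆ Metric.ball p R) {β : ℝ → ℂ}
    (hβ : ContDiffOn ℝ 1 β (Set.Icc 0 1)) (hβp : ∀ s ∈ Set.Icc (0 : ℝ) 1, β s ∈ Metric.ball p R)
    (hβK : ∀ s ∈ Set.Icc (0 : ℝ) 1, β s ∉ convexHull ℝ (Set.range g)) (h0 : β 0 = X) (h1 : β 1 = X)
    {θ : ℝ → ℝ} (hθ : ContinuousOn θ (Set.Icc 0 1)) (hθz : ∀ s ∈ Set.Icc (0 : ℝ) 1,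
      β s - z = (‖β s - z‖ : ℂ) * Complex.exp ((θ s : ℂ) * Complex.I))
    (hθ1 : θ 1 = θ 0 + ε * (2 * Real.pi)) :
    arcPotential R g q - arcPotential R g q' ≤ finslerLength R β := by
  have hX : ∀ s ∈ Set.Icc (0 : ℝ) 1, β s ∈ stringDomain R g := fun s hs =>
    ⟨hβK s hs, p, hp, hβp s hs⟩
  have m0 : (0 : ℝ) ∈ Set.Icc (0 : ℝ) 1 := ⟨le_rfl, zero_le_one⟩
  have m1 : (1 : ℝ) ∈ Set.Icc (0 : ℝ) 1 := ⟨zero_le_one, le_rfl⟩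
  have hex : ∀ s : ℝ, ∃ c : ℝ × ℝ, s ∈ Set.Icc (0 : ℝ) 1 → (0 < 1 * c.2 ∧ |c.2| < Real.pi * R) ∧
      larmorArc R g c = β s ∧ polarAngle R g z c = θ s := fun s => by
    by_cases hs : s ∈ Set.Icc (0 : ℝ) 1
    · obtain ⟨c, hc⟩ := h.exists_arc_polarAngle hz (hX s hs) (hθz s hs) (Or.inl rfl)
      exact ⟨c, fun _ => hc⟩
    · exact ⟨0, fun hs' => absurd hs' hs⟩
  -- `c` is the lift of the loop to arriving arcs; one turn of the loop shifts the contact by `1`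
  choose c hc using hex
  have hcont : ContinuousOn c (Set.Icc 0 1) :=
    h.continuousOn_arc hz (Or.inl rfl) hβ.continuousOn hθ hc
  have hc01 : c 1 = ((c 0).1 + 1, (c 0).2) := by
    obtain ⟨a1, a2, a3⟩ := hc 0 m0
    obtain ⟨b1, b2, b3⟩ := hc 1 m1
    refine h.arc_polarAngle_unique hz (Or.inl rfl) b1 a1 ?_ ?_
    · have := h.larmorArc_add_int R (c 0).1 (c 0).2 1
      rw [Int.cast_one] at this
      rw [b2, this, Prod.mk.eta, a2, h0, h1]
    · rw [h.polarAngle_add_one hz, Prod.mk.eta, a3, b3, hθ1]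
  -- the taut string that ends with the arriving arc of the lift
  obtain ⟨⟨a1, a2⟩, a3, -⟩ := hc 1 m1
  rw [one_mul] at a1
  rw [abs_of_pos a1] at a2
  obtain ⟨r', hr⟩ := h.exists_isTautString_of_arrive (hX 1 m1) a3 a1 a2
  rw [h1] at hr
  rw [hq.sub_eq_sub h hr]
  have hlt := hr.lt
  have hlt1 := hr.lt_add_one
  have hc01' : (c 1).1 = (c 0).1 + 1 := by rw [hc01]
  -- at the time `s` the arriving arc has the contact of the departing arc `r'`
  obtain ⟨s, hs, hs'⟩ := intermediate_value_Icc zero_le_one hcont.fst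
    (show r'.1 ∈ Set.Icc (c 0).1 (c 1).1 from ⟨by linarith, hlt.le⟩)
  obtain ⟨⟨b1, b2⟩, b3, -⟩ := hc s hs
  rw [one_mul] at b1
  rw [abs_of_pos b1] at b2
  have hcs : c s = (r'.1, (c s).2) := Prod.ext hs' rfl
  have hX' : larmorArc R g (r'.1, r'.2) = β 0 := by rw [Prod.mk.eta, hr.depart, h0]
  have i1 : arcPotential R g (c s) - arcPotential R g r' ≤
      ∫ u in (0 : ℝ)..s, magneticLagrangian R (β u) (deriv β u) := by
    have hsum := h.add_lt_of_mem_ball (hp ⟨r'.1, rfl⟩) b1 b2 (s' := -r'.2) (by linarith [hr.neg])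
      (by linarith [hr.neg_pi_lt]) (by rw [← hcs, b3]; exact hβp s hs)
      (by rw [neg_neg, hX']; exact hβp 0 m0)
    have := h.chordAction_larmorArc (t := r'.1) (s := (c s).2) (s' := r'.2)
      (by linarith [hr.neg]) (by linarith)
    rw [hX', ← hcs, b3, Prod.mk.eta] at this
    rw [← this]
    exact chordAction_le_integral h.pos hβ hβp hs
  have i2 : arcPotential R g (c 1) - arcPotential R g (c s) ≤
      ∫ u in s..1, magneticLagrangian R (β u) (deriv β u) := by
    have hsub : Set.Icc s 1 ⊆ Set.Icc 0 1 := Set.Icc_subset_Icc_left hs.1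
    refine sub_le_integral_lagrangian hβ hs.1 hs.2 le_rfl (f := fun u => arcPotential R g (c u))
      (f' := fun u => momentum R (β u) (arcVelocity R g (c u)) (deriv β u))
      ((h.contDiff_arcPotential R).continuous.comp_continuousOn (hcont.mono hsub))
      (fun u hu => ?_) fun u hu => momentum_le R _ (h.norm_arcVelocity R _) _
    have hu01 : u ∈ Set.Ioo (0 : ℝ) 1 := ⟨hs.1.trans_lt hu.1, hu.2⟩
    have hnh : Set.Icc (0 : ℝ) 1 ∈ nhds u := Icc_mem_nhds hu01.1 hu01.2
    obtain ⟨⟨d1, d2⟩, d3, -⟩ := hc u ⟨hu01.1.le, hu01.2.le⟩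
    rw [one_mul] at d1
    exact h.hasDerivAt_arcPotential_comp (hcont.continuousAt hnh) d1.ne' d2
      (by filter_upwards [hnh] with y hy; exact (hc y hy).2.1)
      (hasDerivAt_of_contDiffOn_Icc hβ hu01)
  rw [finslerLength_eq_add R hβ hs]
  linarith

/-- The difference of the actions of the two arcs of a taut string depends continuously on the
point. -/
theorem exists_continuousAt (h : IsObstacle R g ε) (hq : IsTautString R g X q q') :
    ∃ F : ℂ → ℝ, ContinuousAt F X ∧ F X = arcPotential R g q - arcPotential R g q' ∧
      ∀ᶠ Y in nhds X, ∃ r r', IsTautString R g Y r r' ∧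
        F Y = arcPotential R g r - arcPotential R g r' := by
  obtain ⟨e, e', e1, e1', e2, e2', -, -, e5⟩ := h.exists_local_isTautString hq
  have hW := (h.contDiff_arcPotential R).continuous
  refine ⟨fun Y => arcPotential R g (e Y) - arcPotential R g (e' Y), ?_, by simp only [e2, e2'],
    e5.mono fun Y hY => ⟨_, _, hY, rfl⟩⟩
  exact (hW.continuousAt.comp e1.continuousAt).sub (hW.continuousAt.comp e1'.continuousAt)

/-- The general case of a loop that may touch the obstacle is reduced to the preceding one by
dilations from an inner point of the obstacle. -/
theorem le_finslerLength (h : IsObstacle R g ε) (hq : IsTautString R g X q q') {γ : ℝ → ℂ}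
    (hγ : IsLoopAround R g X γ) :
    arcPotential R g q - arcPotential R g q' ≤ finslerLength R γ := by
  obtain ⟨z, hz⟩ := h.insideOf_nonempty
  obtain ⟨p, hp, hγp⟩ := hγ.small
  obtain ⟨n, hn, hn'⟩ := hγ.winding z hz
  obtain ⟨m, hm⟩ := h.exists_intCast_eq_sign
  obtain rfl : n = m := hn'.unique (h.hasWindingNumber hz hm)
  obtain ⟨θ, hθ, hθz, hθ1⟩ := hn
  have hc := hγ.contDiffOn
  set β : ℝ → ℝ → ℂ := fun μ s => z + ((1 + μ : ℝ) : ℂ) * (γ s - z) with hβ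
  have hβd : ∀ μ s, deriv (β μ) s = ((1 + μ : ℝ) : ℂ) * deriv γ s := fun μ s => by
    simp only [hβ, deriv_const_add, deriv_const_mul_field, deriv_sub_const]
  -- the length is a polynomial in the parameter of the dilation
  obtain ⟨L, hL, hL'⟩ : ∃ L : ℝ → ℝ, Continuous L ∧ ∀ μ, 0 ≤ μ → finslerLength R (β μ) = L μ := by
    set A := ∫ s in (0 : ℝ)..1, ‖deriv γ s‖
    set B := ∫ s in (0 : ℝ)..1, cross (deriv γ s) z
    set D := ∫ s in (0 : ℝ)..1, cross (deriv γ s) (γ s - z)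
    have hint : ∀ {F : ℂ × ℂ → ℝ}, Continuous F →
        IntervalIntegrable (fun s => F (γ s, deriv γ s)) MeasureTheory.volume 0 1 := fun hF =>
      (intervalIntegrable_iff_integrableOn_Icc_of_le zero_le_one).2 (integrableOn_comp_deriv hc hF)
    have iA : IntervalIntegrable (fun s => ‖deriv γ s‖) MeasureTheory.volume 0 1 :=
      hint (F := fun y => ‖y.2‖) (by fun_prop)
    have iB : IntervalIntegrable (fun s => cross (deriv γ s) z) MeasureTheory.volume 0 1 :=
      hint (F := fun y => cross y.2 z) (by unfold cross; fun_prop)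
    have iD : IntervalIntegrable (fun s => cross (deriv γ s) (γ s - z)) MeasureTheory.volume 0 1 :=
      hint (F := fun y => cross y.2 (y.1 - z)) (by unfold cross; fun_prop)
    refine ⟨fun μ => (1 + μ) * A + (1 + μ) / (2 * R) * B + (1 + μ) ^ 2 / (2 * R) * D, by fun_prop,
      fun μ hμ => ?_⟩
    simp only
    rw [← intervalIntegral.integral_const_mul, ← intervalIntegral.integral_const_mul,
      ← intervalIntegral.integral_const_mul, ← intervalIntegral.integral_add (iA.const_mul _)
        (iB.const_mul _), ← intervalIntegral.integral_add ((iA.const_mul _).add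
        (iB.const_mul _)) (iD.const_mul _), finslerLength]
    congr 1
    ext s
    rw [magneticLagrangian, hβd, norm_mul, Complex.norm_real, Real.norm_of_nonneg (by linarith)]
    simp only [hβ, cross_add_right, cross_smul_left, cross_smul_right]
    ring
  have hβ0 : β 0 = γ := by ext s; simp [hβ]
  rw [← hβ0, hL' 0 le_rfl]
  obtain ⟨F, hF, hFX, hFe⟩ := hq.exists_continuousAt h
  have hXt : Filter.Tendsto (fun μ : ℝ => z + ((1 + μ : ℝ) : ℂ) * (X - z))
      (nhdsWithin 0 (Set.Ioi 0)) (nhds X) := by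
    have h1 : Continuous fun μ : ℝ => z + ((1 + μ : ℝ) : ℂ) * (X - z) := by fun_prop
    have h2 := h1.tendsto 0
    simp only [add_zero, Complex.ofReal_one, one_mul, add_sub_cancel] at h2
    exact h2.mono_left nhdsWithin_le_nhds
  rw [← hFX]
  refine le_of_tendsto_of_tendsto (hF.tendsto.comp hXt)
    ((hL.tendsto 0).mono_left nhdsWithin_le_nhds) ?_
  -- for small parameters the dilated loop stays in the disc
  have hball : ∀ᶠ μ : ℝ in nhdsWithin 0 (Set.Ioi 0), ∀ s ∈ Set.Icc (0 : ℝ) 1,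
      β μ s ∈ Metric.ball p R := by
    have hK : IsCompact (γ '' Set.Icc 0 1) := isCompact_Icc.image_of_continuousOn hc.continuousOn
    have h1 : ∀ᶠ μ : ℝ in nhds 0, ∀ y ∈ γ '' Set.Icc 0 1,
        z + ((1 + μ : ℝ) : ℂ) * (y - z) ∈ Metric.ball p R := by
      refine hK.eventually_forall_of_forall_eventually fun y hy => ?_
      have h2 : Continuous fun w : ℝ × ℂ => z + ((1 + w.1 : ℝ) : ℂ) * (w.2 - z) := by fun_prop
      refine h2.continuousAt.eventually_mem (Metric.isOpen_ball.mem_nhds ?_)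
      simpa using hγp hy
    exact (h1.filter_mono nhdsWithin_le_nhds).mono fun μ hμ s hs => hμ _ ⟨s, hs, rfl⟩
  filter_upwards [hXt.eventually hFe, hball, self_mem_nhdsWithin] with μ ⟨r, r', hr, hFr⟩ hμp hμ
  have hμ : 0 < μ := hμ
  have hμ1 : (0 : ℝ) < 1 + μ := by linarith
  rw [Function.comp_apply, hFr, ← hL' μ hμ.le]
  have hsub : ∀ s, β μ s - z = ((1 + μ : ℝ) : ℂ) * (γ s - z) := fun s => by
    simp only [hβ, add_sub_cancel_left]
  refine hr.le_finslerLength_of_notMem_hull h hz hp ?_ hμp (fun s hs hmem => ?_) ?_ ?_ hθ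
    (fun s hs => ?_) (by rw [← hm]; linarith)
  · exact contDiffOn_const.add (contDiffOn_const.mul (hc.sub contDiffOn_const))
  · refine hγ.avoids s hs ?_
    have h1 := (convex_convexHull ℝ (Set.range g)).combo_interior_self_mem_interior hz hmem
      (a := μ / (1 + μ)) (b := 1 / (1 + μ)) (by positivity) (by positivity) (by field_simp; ring)
    have h2 : γ s = (μ / (1 + μ)) • z + (1 / (1 + μ)) • β μ s := by
      rw [Complex.real_smul, Complex.real_smul]
      simp only [hβ]
      have : ((1 : ℂ) + μ) ≠ 0 := by exact_mod_cast hμ1.ne'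
      push_cast
      field_simp
      ring
    rwa [insideOf, h2]
  · simp only [hβ, hγ.source]
  · simp only [hβ, hγ.target]
  · rw [hsub, norm_mul, Complex.norm_real, Real.norm_of_nonneg hμ1.le, (hθz s hs).2]
    push_cast
    rw [norm_mul, Complex.norm_exp_ofReal_mul_I, Complex.norm_real, norm_norm]
    push_cast
    ring

/-- The shortest loop around the obstacle is the taut string. -/
theorem isLeast (h : IsObstacle R g ε) (hX : X ∈ stringDomain R g)
    (hq : IsTautString R g X q q') :
    IsLeast (loopLengths R g X) (arcPotential R g q - arcPotential R g q') := by
  refine ⟨hq.mem_loopLengths h hX, ?_⟩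
  rintro _ ⟨γ, hγ, rfl⟩
  exact hq.le_finslerLength h hγ

theorem stringFunction_eq (h : IsObstacle R g ε) (hX : X ∈ stringDomain R g)
    (hq : IsTautString R g X q q') :
    stringFunction R g X = arcPotential R g q - arcPotential R g q' :=
  (hq.isLeast h hX).csInf_eq

end IsTautString

theorem IsObstacle.isLeast_stringFunction {R ε : ℝ} {g : ℝ → ℂ} (h : IsObstacle R g ε) {X : ℂ}
    (hX : X ∈ stringDomain R g) : IsLeast (loopLengths R g X) (stringFunction R g X) := by
  obtain ⟨q, q', hq⟩ := h.exists_isTautString hX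
  rw [hq.stringFunction_eq h hX]
  exact hq.isLeast h hX


/-! ### The differential of the string function -/

namespace IsObstacle

variable {R ε : ℝ} {g : ℝ → ℂ}

/-- The differential of the action of a smooth family of tangent arcs, in terms of the end
point. -/
theorem hasFDerivAt_arcPotential_comp (h : IsObstacle R g ε) {e : ℂ → ℝ × ℝ} {X : ℂ}
    (he : ContDiffAt ℝ ∞ e X) (hE : ∀ᶠ Y in nhds X, larmorArc R g (e Y) = Y) :
    HasFDerivAt (fun Y => arcPotential R g (e Y)) (momentum R X (arcVelocity R g (e X))) X := by
  have he' := (he.differentiableAt (by simp)).hasFDerivAt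
  have h1 := ((h.hasFDerivAt_larmorArc h.pos (e X)).comp X he').congr_of_eventuallyEq
    (f₁ := id) (by filter_upwards [hE] with Y hY; exact hY.symm)
  have h2 := h1.unique (hasFDerivAt_id X)
  have h3 := (h.hasFDerivAt_arcPotential h.pos (e X)).comp X he'
  rw [ContinuousLinearMap.comp_assoc, h2, ContinuousLinearMap.comp_id, hE.self_of_nhds] at h3
  exact h3

end IsObstacle

namespace IsTautString

variable {R ε : ℝ} {g : ℝ → ℂ} {X : ℂ} {q q' : ℝ × ℝ}

theorem contDiffAt_stringFunction (h : IsObstacle R g ε) (hX : X ∈ stringDomain R g)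
    (hq : IsTautString R g X q q') : ContDiffAt ℝ ∞ (stringFunction R g) X := by
  obtain ⟨e, e', e1, e1', -, -, -, -, e5⟩ := h.exists_local_isTautString hq
  have hW := h.contDiff_arcPotential R
  refine ((hW.contDiffAt.comp X e1).sub (hW.contDiffAt.comp X e1')).congr_of_eventuallyEq ?_
  filter_upwards [e5, h.isOpen_stringDomain.mem_nhds hX] with Y hY hYΩ
  exact hY.stringFunction_eq h hYΩ

/-- First variation of the length of the taut string. -/
theorem hasFDerivAt_stringFunction (h : IsObstacle R g ε) (hX : X ∈ stringDomain R g)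
    (hq : IsTautString R g X q q') :
    HasFDerivAt (stringFunction R g) (innerSL ℝ (arcVelocity R g q - arcVelocity R g q')) X := by
  obtain ⟨e, e', e1, e1', e2, e2', -, -, e5⟩ := h.exists_local_isTautString hq
  have h1 := (h.hasFDerivAt_arcPotential_comp e1 (e5.mono fun Y hY => hY.arrive)).sub
    (h.hasFDerivAt_arcPotential_comp e1' (e5.mono fun Y hY => hY.depart))
  rw [e2, e2'] at h1
  refine (h1.congr_of_eventuallyEq ?_).congr_fderiv ?_
  · filter_upwards [e5, h.isOpen_stringDomain.mem_nhds hX] with Y hY hYΩ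
    exact hY.stringFunction_eq h hYΩ
  · ext w; all_goals simp [momentum_apply]

end IsTautString

namespace IsObstacle

variable {R ε : ℝ} {g : ℝ → ℂ}

/-- The length of the taut string increases along the arriving arcs. -/
theorem stringFunction_lt (h : IsObstacle R g ε) {t s₁ s₂ : ℝ} (h1 : 0 < s₁) (h12 : s₁ < s₂)
    (h2 : s₂ < Real.pi * R) (hΩ : larmorArc R g (t, s₂) ∈ stringDomain R g) :
    stringFunction R g (larmorArc R g (t, s₁)) < stringFunction R g (larmorArc R g (t, s₂)) := by
  have hmem : ∀ s ∈ Set.Icc s₁ s₂, larmorArc R g (t, s) ∈ stringDomain R g := fun s hs => by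
    have hs2 : 0 < s₂ := h1.trans h12
    have := h.larmorArc_mul_mem_stringDomain hs2.ne' (by rwa [abs_of_pos hs2]) hΩ
      (r := s / s₂) ⟨div_pos (h1.trans_le hs.1) hs2, (div_le_one hs2).2 hs.2⟩
    rwa [div_mul_cancel₀ _ hs2.ne'] at this
  have hd : ∀ s ∈ Set.Icc s₁ s₂, ∃ d > 0,
      HasDerivAt (fun s => stringFunction R g (larmorArc R g (t, s))) d s := fun s hs => by
    obtain ⟨q', hq⟩ := h.exists_isTautString_of_arrive (hmem s hs) rfl (h1.trans_le hs.1)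
      (hs.2.trans_lt h2)
    have hd := (hq.hasFDerivAt_stringFunction h (hmem s hs)).comp_hasDerivAt s
      (h.hasDerivAt_larmorArc_snd t s)
    refine ⟨_, ?_, hd⟩
    have := hq.inner_lt_one h
    rw [innerSL_apply_apply, inner_sub_left, real_inner_self_eq_norm_sq, h.norm_arcVelocity,
      real_inner_comm]
    linarith
  refine strictMonoOn_of_deriv_pos (f := fun s => stringFunction R g (larmorArc R g (t, s)))
    (convex_Icc s₁ s₂) (fun s hs => ?_) (fun s hs => ?_) (Set.left_mem_Icc.2 h12.le)
    (Set.right_mem_Icc.2 h12.le) h12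
  · obtain ⟨d, -, hd⟩ := hd s hs
    exact hd.continuousAt.continuousWithinAt
  · obtain ⟨d, hd0, hd⟩ := hd s (interior_subset hs)
    rw [hd.deriv]
    exact hd0

/-! ### Level sets for a counterclockwise curve -/

/-- The center of a disc as in the definition of the domain is the midpoint of the centers of the
two tangent Larmor circles through the point. -/
theorem mem_stringDomain_of_norm_sub_lt (h : IsObstacle R g 1) {X : ℂ}
    (hX : X ∉ convexHull ℝ (Set.range g)) (hd : ∀ t, ‖X - g t‖ < 2 * R) :
    X ∈ stringDomain R g := by
  obtain ⟨t, s, hs, hsπ, hE⟩ := h.exists_larmorArc_eq hX hd (Or.inl rfl)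
  obtain ⟨t', s', hs', hsπ', hE'⟩ := h.exists_larmorArc_eq hX hd (Or.inr rfl)
  have hR := h.pos
  rw [one_mul] at hs
  have hP : larmorCenter R g t - larmorCenter R g t' ≠ 0 := fun h0 => by
    have h0 := sub_eq_zero.1 h0
    have h1 : g t = g t' := by
      refine h.eq_of_norm_sub_larmorCenter (IsConvexClosedCurve.mem_hull g t) ?_
      rw [← h0, h.norm_sub_larmorCenter]
    obtain ⟨k, rfl⟩ := h.eq_add_int h1
    rw [h.larmorArc_add_int, ← hE'] at hE
    rw [abs_lt] at hsπ hsπ'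
    have := h.eq_of_larmorArc_eq (by
      rw [abs_lt]; constructor <;> linarith [hsπ.1, hsπ.2, hsπ'.1, hsπ'.2]) hE
    linarith
  have hP2 : 0 < ‖larmorCenter R g t - larmorCenter R g t'‖ ^ 2 := by
    have := norm_pos_iff.2 hP; positivity
  have key : ∀ y : ℂ, ‖y - larmorCenter R g t‖ ≤ R → ‖y - larmorCenter R g t'‖ ≤ R →
      y ∈ Metric.ball ((larmorCenter R g t + larmorCenter R g t') / 2) R := fun y h1 h2 => by
    rw [Metric.mem_ball, dist_eq_norm, ← sq_lt_sq₀ (norm_nonneg _) hR.le]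
    have h3 : ‖y - (larmorCenter R g t + larmorCenter R g t') / 2‖ ^ 2 =
        (‖y - larmorCenter R g t‖ ^ 2 + ‖y - larmorCenter R g t'‖ ^ 2) / 2 -
          ‖larmorCenter R g t - larmorCenter R g t'‖ ^ 2 / 4 := by
      simp only [Complex.sq_norm, Complex.normSq_apply]
      simp
      ring
    have h4 := pow_le_pow_left₀ (norm_nonneg _) h1 2
    have h5 := pow_le_pow_left₀ (norm_nonneg _) h2 2
    linarith
  refine ⟨hX, _, ?_, key X ?_ ?_⟩
  · rintro _ ⟨u, rfl⟩
    have hu := fun t => h.disc_nonneg t (IsConvexClosedCurve.mem_hull g u)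
    exact key _ (by linarith [hu t]) (by linarith [hu t'])
  · rw [← hE, h.norm_larmorArc_sub hR]
  · rw [← hE', h.norm_larmorArc_sub hR]

/-- A curve inside a Larmor circle is run around once by this circle. -/
theorem polarAngle_lt (h : IsObstacle R g 1) {z : ℂ} (hz : z ∈ insideOf g) (t : ℝ) {s s' : ℝ}
    (hs : s < s') : polarAngle R g z (t, s) < polarAngle R g z (t, s') := by
  have hR := h.pos
  have hv := (h.contDiff_arcVelocity R).continuous
  have hE := (h.contDiff_larmorArc R).continuous
  have hd : ∀ s, HasDerivAt (fun s => polarAngle R g z (t, s))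
      (arcVelocity R g (t, s) / (larmorArc R g (t, s) - z)).im s := fun s => by
    have hc : Continuous fun u => arcVelocity R g (t, u) / (larmorArc R g (t, u) - z) :=
      Continuous.div (by fun_prop) (by fun_prop) fun u => h.larmorArc_ne hz _
    have h1 : HasDerivAt (fun s => arcLog R g z (t, s))
        (arcVelocity R g (t, s) / (larmorArc R g (t, s) - z)) s := by
      simp only [arcLog]
      exact (hc.integral_hasStrictDerivAt 0 s).hasDerivAt.const_add _
    exact Complex.imCLM.hasFDerivAt.comp_hasDerivAt s h1
  refine strictMono_of_deriv_pos (f := fun s => polarAngle R g z (t, s)) (fun s => ?_) hs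
  rw [(hd s).deriv, Complex.div_im, ← sub_div]
  refine div_pos ?_ (Complex.normSq_pos.2 (h.larmorArc_ne hz _))
  have h1 : cross (larmorArc R g (t, s) - z) (arcVelocity R g (t, s)) =
      R - cross (arcVelocity R g (t, s)) (larmorCenter R g t - z) := by
    have hn := Complex.sq_norm (arcVelocity R g (t, s))
    rw [h.norm_arcVelocity, Complex.normSq_apply] at hn
    rw [larmorArc]
    simp [cross]
    linear_combination (-R) * hn
  have h2 : ‖larmorCenter R g t - z‖ < R := by
    have h3 := h.disc_nonneg t (interior_subset hz)
    have h4 := h.norm_sub_ne_of_mem_insideOf t hz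
    rw [norm_sub_rev]
    exact lt_of_le_of_ne (by linarith) h4
  have h3 := abs_cross_le (arcVelocity R g (t, s)) (larmorCenter R g t - z)
  rw [h.norm_arcVelocity, one_mul] at h3
  have h4 := (abs_le.1 h3).2
  have h5 : 0 < cross (larmorArc R g (t, s) - z) (arcVelocity R g (t, s)) := by
    rw [h1]; linarith
  rw [cross] at h5
  linarith

end IsObstacle


/-! ### Limits of taut strings -/

namespace IsObstacle

variable {R ε : ℝ} {g : ℝ → ℂ}

/-- By compactness, a limit of taut strings is a string, possibly with degenerate arcs. -/
theorem exists_limit_isTautString (h : IsObstacle R g ε) {Y : ℕ → ℂ} {X : ℂ}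
    (hY : ∀ n, Y n ∈ stringDomain R g) (hX : Filter.Tendsto Y Filter.atTop (nhds X)) :
    ∃ q q' : ℝ × ℝ, larmorArc R g q = X ∧ larmorArc R g q' = X ∧ q.2 ∈ Set.Icc 0 (Real.pi * R) ∧
      q'.2 ∈ Set.Icc (-(Real.pi * R)) 0 ∧ q.1 ∈ Set.Icc q'.1 (q'.1 + 1) ∧
      (∃ φ : ℕ → ℕ, Filter.Tendsto (fun n => stringFunction R g (Y (φ n))) Filter.atTop
        (nhds (arcPotential R g q - arcPotential R g q'))) ∧
      ∀ z ∈ insideOf g, polarAngle R g z q = polarAngle R g z q' + ε * (2 * Real.pi) := by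
  have hex : ∀ n, ∃ r : (ℝ × ℝ) × ℝ × ℝ, IsTautString R g (Y n) r.1 r.2 ∧
      0 ≤ r.2.1 ∧ r.2.1 ≤ 1 := fun n => by
    obtain ⟨r, r', hr⟩ := h.exists_isTautString (hY n)
    refine ⟨((r.1 + (-⌊r'.1⌋ : ℤ), r.2), (r'.1 + (-⌊r'.1⌋ : ℤ), r'.2)),
      hr.add_int h (-⌊r'.1⌋), ?_, ?_⟩
    · have := Int.floor_le r'.1
      push_cast; linarith
    · have := Int.lt_floor_add_one r'.1
      push_cast; linarith
  choose r hr hr0 hr1 using hex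
  have hK : ∀ n, r n ∈ Set.Icc (((0 : ℝ), (0 : ℝ)), ((0 : ℝ), -(Real.pi * R)))
      (((2 : ℝ), Real.pi * R), ((1 : ℝ), (0 : ℝ))) := fun n => by
    have a := hr n
    have a1 := a.lt; have a2 := a.lt_add_one; have a3 := a.pos; have a4 := a.lt_pi
    have a5 := a.neg; have a6 := a.neg_pi_lt
    exact ⟨⟨⟨by simp only; linarith [hr0 n], a3.le⟩, hr0 n, a6.le⟩,
      ⟨by simp only; linarith [hr1 n], a4.le⟩, hr1 n, a5.le⟩
  obtain ⟨⟨q, q'⟩, hq, φ, hφ, hlim⟩ := isCompact_Icc.tendsto_subseq hK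
  have l1 : Filter.Tendsto (fun n => (r (φ n)).1) Filter.atTop (nhds q) :=
    (continuous_fst.tendsto _).comp hlim
  have l2 : Filter.Tendsto (fun n => (r (φ n)).2) Filter.atTop (nhds q') :=
    (continuous_snd.tendsto _).comp hlim
  have hE := (h.contDiff_larmorArc R).continuous
  have hW := (h.contDiff_arcPotential R).continuous
  have hXφ := hX.comp hφ.tendsto_atTop
  refine ⟨q, q', ?_, ?_, ⟨hq.1.1.2, hq.2.1.2⟩, ⟨hq.1.2.2, hq.2.2.2⟩, ⟨?_, ?_⟩, ?_, fun z hz => ?_⟩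
  · exact tendsto_nhds_unique ((hE.tendsto q).comp l1)
      (hXφ.congr fun n => (hr (φ n)).arrive.symm)
  · exact tendsto_nhds_unique ((hE.tendsto q').comp l2)
      (hXφ.congr fun n => (hr (φ n)).depart.symm)
  · exact le_of_tendsto_of_tendsto' ((continuous_fst.tendsto _).comp l2)
      ((continuous_fst.tendsto _).comp l1) fun n => (hr (φ n)).lt.le
  · exact le_of_tendsto_of_tendsto' ((continuous_fst.tendsto _).comp l1)
      (((continuous_fst.tendsto _).comp l2).add_const 1) fun n => (hr (φ n)).lt_add_one.le
  · exact ⟨φ, (((hW.tendsto q).comp l1).sub ((hW.tendsto q').comp l2)).congr fun n =>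
      ((hr (φ n)).stringFunction_eq h (hY _)).symm⟩
  · have hΘ := h.continuous_polarAngle hz
    exact tendsto_nhds_unique ((hΘ.tendsto q).comp l1)
      ((((hΘ.tendsto q').comp l2).add_const _).congr fun n =>
        ((hr (φ n)).polarAngle_eq h (hY _) hz).symm)

/-- At the obstacle, the length of the taut string tends to the length of the curve. -/
theorem exists_tendsto_of_mem_hull (h : IsObstacle R g ε) {Y : ℕ → ℂ} {X : ℂ}
    (hY : ∀ n, Y n ∈ stringDomain R g) (hX : Filter.Tendsto Y Filter.atTop (nhds X))
    (hXK : X ∈ convexHull ℝ (Set.range g)) :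
    ∃ φ : ℕ → ℕ, Filter.Tendsto (fun n => stringFunction R g (Y (φ n))) Filter.atTop
      (nhds (∫ u in (0 : ℝ)..1, magneticLagrangian R (g u) (deriv g u))) := by
  obtain ⟨⟨t, s⟩, ⟨t', s'⟩, e, e', hs, hs', -, ⟨φ, hφ⟩, hΘ⟩ :=
    h.exists_limit_isTautString hY hX
  have hR := h.pos
  have hπR := mul_pos Real.pi_pos hR
  have hs0 : s = 0 := by
    by_contra h0
    exact h.larmorArc_notMem_hull h0 (by rw [abs_of_nonneg hs.1]; linarith [hs.2]) (e ▸ hXK)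
  have hs0' : s' = 0 := by
    by_contra h0
    exact h.larmorArc_notMem_hull h0 (by rw [abs_of_nonpos hs'.2]; linarith [hs'.1]) (e' ▸ hXK)
  subst hs0 hs0'
  rw [larmorArc_zero] at e e'
  obtain ⟨k, rfl⟩ := h.eq_add_int (e.trans e'.symm)
  obtain ⟨z, hz⟩ := h.insideOf_nonempty
  have h1 := hΘ z hz
  rw [h.polarAngle_add_int hz] at h1
  have h2 : ε * (2 * Real.pi) ≠ 0 := by
    have := Real.two_pi_pos
    rcases h.sign with h3 | h3 <;> simp [h3]
  have h3 : (k : ℝ) = 1 := by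
    have : ((k : ℝ) - 1) * (ε * (2 * Real.pi)) = 0 := by linarith
    have := (mul_eq_zero.1 this).resolve_right h2
    linarith
  rw [h.arcPotential_add_int, h3, one_mul, add_sub_cancel_left] at hφ
  exact ⟨φ, hφ⟩

theorem norm_larmorArc_sub_contact (h : IsObstacle R g ε) (t s : ℝ) :
    ‖larmorArc R g (t, s) - g t‖ ^ 2 = 2 * R ^ 2 * (1 - Real.cos (s / R)) := by
  have h1 : larmorArc R g (t, s) - g t = R * (Complex.I * (unitTangent g t *
      (1 - Complex.exp ((s / R : ℝ) * Complex.I)))) := by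
    rw [larmorArc, arcVelocity, larmorCenter]; ring
  have h2 : ‖1 - Complex.exp ((s / R : ℝ) * Complex.I)‖ ^ 2 = 2 * (1 - Real.cos (s / R)) := by
    rw [Complex.sq_norm, Complex.normSq_apply]
    simp only [Complex.sub_re, Complex.sub_im, Complex.exp_ofReal_mul_I_re,
      Complex.exp_ofReal_mul_I_im, Complex.one_re, Complex.one_im]
    linear_combination Real.sin_sq_add_cos_sq (s / R)
  rw [h1, norm_mul, norm_mul, norm_mul, Complex.norm_I, h.norm_unitTangent, one_mul, one_mul,
    mul_pow, h2, Complex.norm_real, Real.norm_of_nonneg h.pos.le]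
  ring

/-- Only a half circle reaches the distance `2 * R` from the contact. -/
theorem norm_larmorArc_sub_eq_iff (h : IsObstacle R g ε) {t s : ℝ} (hs : |s| ≤ Real.pi * R) :
    2 * R ≤ ‖larmorArc R g (t, s) - g t‖ ↔ |s| = Real.pi * R := by
  have hR := h.pos
  rw [← sq_le_sq₀ (by positivity) (norm_nonneg _), h.norm_larmorArc_sub_contact, ← Real.cos_abs,
    abs_div, abs_of_pos hR]
  have hle : |s| / R ≤ Real.pi := (div_le_iff₀ hR).2 hs
  constructor
  · intro h1
    have h2 : Real.cos (|s| / R) = -1 := by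
      refine le_antisymm ?_ (Real.neg_one_le_cos _)
      by_contra! hcon
      nlinarith [mul_pos hR hR]
    have h3 : |s| / R = Real.pi :=
      Real.injOn_cos ⟨by positivity, hle⟩ ⟨Real.pi_pos.le, le_rfl⟩ (by rw [h2, Real.cos_pi])
    rwa [div_eq_iff hR.ne'] at h3
  · intro h1
    rw [h1, mul_div_cancel_right₀ _ hR.ne', Real.cos_pi]
    linarith

/-- At the antipodes of the points of the curve on the Larmor circles, the length of the taut
string tends to `πR`, which is the action of a full Larmor circle. -/
theorem exists_tendsto_of_norm_sub (h : IsObstacle R g 1) {Y : ℕ → ℂ} {X : ℂ}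
    (hY : ∀ n, Y n ∈ stringDomain R g) (hX : Filter.Tendsto Y Filter.atTop (nhds X)) {t₀ : ℝ}
    (hX₀ : 2 * R ≤ ‖X - g t₀‖) :
    ∃ φ : ℕ → ℕ, Filter.Tendsto (fun n => stringFunction R g (Y (φ n))) Filter.atTop
      (nhds (Real.pi * R)) := by
  obtain ⟨⟨t, s⟩, ⟨t', s'⟩, e, e', hs, hs', ht, ⟨φ, hφ⟩, hΘ⟩ :=
    h.exists_limit_isTautString hY hX
  have hR := h.pos
  -- a point at distance `2R` from the Larmor circle through `X` is the contact
  have key : ∀ t s, larmorArc R g (t, s) = X → |s| ≤ Real.pi * R →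
      (∃ k : ℤ, t = t₀ + k) ∧ |s| = Real.pi * R := fun t s hE hsπ => by
    have h1 : ‖X - larmorCenter R g t‖ = R := by rw [← hE]; exact h.norm_larmorArc_sub hR (t, s)
    have h2 := h.disc_nonneg t (IsConvexClosedCurve.mem_hull g t₀)
    have h3 : ‖X - g t₀‖ ≤ ‖X - larmorCenter R g t‖ + ‖g t₀ - larmorCenter R g t‖ := by
      rw [← dist_eq_norm, ← dist_eq_norm, ← dist_eq_norm]; exact dist_triangle_right _ _ _
    have h4 := h.eq_of_norm_sub_larmorCenter (t := t) (IsConvexClosedCurve.mem_hull g t₀)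
      (by linarith)
    refine ⟨h.eq_add_int h4.symm, (h.norm_larmorArc_sub_eq_iff (t := t) hsπ).1 ?_⟩
    rw [hE, ← h4]; exact hX₀
  obtain ⟨⟨k, rfl⟩, k2⟩ := key t s e (by rw [abs_of_nonneg hs.1]; exact hs.2)
  obtain ⟨⟨k', rfl⟩, k2'⟩ := key t' s' e' (by rw [abs_of_nonpos hs'.2]; linarith [hs'.1])
  rw [abs_of_nonneg hs.1] at k2
  rw [abs_of_nonpos hs'.2] at k2'
  obtain ⟨z, hz⟩ := h.insideOf_nonempty
  have h1 := hΘ z hz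
  have hlt := h.polarAngle_lt hz t₀ (s := s') (s' := s) (by
    have := mul_pos Real.pi_pos hR; linarith)
  rw [h.polarAngle_add_int hz, h.polarAngle_add_int hz] at h1
  have hk1 : (k : ℝ) < k' + 1 := by
    by_contra! hcon
    nlinarith [Real.two_pi_pos]
  have hk2 : (k' : ℝ) ≤ k := by
    have := ht.1; simp only at this; linarith
  have hk1' : k < k' + 1 := by exact_mod_cast hk1
  have hk2' : k' ≤ k := by exact_mod_cast hk2
  obtain rfl : k = k' := by omega
  have hE : larmorArc R g (t₀ + k, s) = larmorArc R g (t₀ + k, s') := e.trans e'.symm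
  refine ⟨φ, ?_⟩
  convert hφ using 2
  simp only [arcPotential, hE]
  linarith

/-- The length of the taut string increases along the arriving arc, starting from the length of the
curve. -/
theorem lt_stringFunction (h : IsObstacle R g ε) {X : ℂ} (hX : X ∈ stringDomain R g) :
    ∫ u in (0 : ℝ)..1, magneticLagrangian R (g u) (deriv g u) < stringFunction R g X := by
  obtain ⟨⟨t, s⟩, q', hq⟩ := h.exists_isTautString hX
  have hs : 0 < s := hq.pos
  have hsπ : s < Real.pi * R := hq.lt_pi
  obtain rfl : larmorArc R g (t, s) = X := hq.arrive
  have hY : ∀ n : ℕ, larmorArc R g (t, s / (n + 2)) ∈ stringDomain R g := fun n => by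
    have := h.larmorArc_mul_mem_stringDomain hs.ne' (by rwa [abs_of_pos hs]) hX
      (r := 1 / (n + 2)) ⟨by positivity, (div_le_one (by positivity)).2 (by
        have : (0 : ℝ) ≤ n := n.cast_nonneg
        linarith)⟩
    rwa [one_div_mul_eq_div] at this
  have hlim : Filter.Tendsto (fun n : ℕ => larmorArc R g (t, s / (n + 2))) Filter.atTop
      (nhds (g t)) := by
    have h1 : Filter.Tendsto (fun n : ℕ => s / ((n : ℝ) + 2)) Filter.atTop (nhds 0) :=
      tendsto_const_nhds.div_atTop
        (Filter.tendsto_atTop_add_const_right _ 2 tendsto_natCast_atTop_atTop)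
    have h2 : Continuous fun u => larmorArc R g (t, u) :=
      (h.contDiff_larmorArc R).continuous.comp (by fun_prop)
    have := (h2.tendsto 0).comp h1
    rwa [larmorArc_zero] at this
  obtain ⟨φ, hφ⟩ := h.exists_tendsto_of_mem_hull hY hlim (IsConvexClosedCurve.mem_hull g t)
  refine lt_of_le_of_lt (le_of_tendsto' hφ fun n => ?_)
    (h.stringFunction_lt (half_pos hs) (half_lt_self hs) hsπ hX)
  have hn : (0 : ℝ) ≤ (φ n : ℝ) := Nat.cast_nonneg _
  rcases (show s / (φ n + 2) ≤ s / 2 by gcongr; linarith).eq_or_lt with h1 | h1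
  · rw [h1]
  · exact (h.stringFunction_lt (by positivity) h1 (by linarith) (by
      simpa using hY 0)).le

/-- The length of the taut string increases along the arriving arc until the arc leaves the domain,
at an antipode, where the limit is `πR`. -/
theorem stringFunction_lt_pi (h : IsObstacle R g 1) {X : ℂ} (hX : X ∈ stringDomain R g) :
    stringFunction R g X < Real.pi * R := by
  have hR := h.pos
  obtain ⟨⟨t, s⟩, q', hq⟩ := h.exists_isTautString hX
  have hs : 0 < s := hq.pos
  have hsπ : s < Real.pi * R := hq.lt_pi
  obtain rfl : larmorArc R g (t, s) = X := hq.arrive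
  have hcont : Continuous fun u => larmorArc R g (t, u) :=
    (h.contDiff_larmorArc R).continuous.comp (by fun_prop)
  -- the first time at which the arc leaves the domain
  obtain ⟨s₁, ⟨⟨hs1, hs1π⟩, hs1Ω⟩, hmin⟩ : ∃ s₁, IsLeast (Set.Icc s (Real.pi * R) ∩
      (fun u => larmorArc R g (t, u)) ⁻¹' (stringDomain R g)ᶜ) s₁ := by
    refine (isCompact_Icc.inter_right
      (h.isOpen_stringDomain.isClosed_compl.preimage hcont)).exists_isLeast
        ⟨Real.pi * R, ⟨hsπ.le, le_rfl⟩, fun hmem => ?_⟩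
    have h1 := norm_sub_lt_of_mem_stringDomain hmem t
    rw [← not_le, h.norm_larmorArc_sub_eq_iff (by rw [abs_of_nonneg (by linarith)])] at h1
    exact h1 (abs_of_nonneg (by linarith))
  have hs1' : s < s₁ := lt_of_le_of_ne hs1 fun h0 => hs1Ω (h0 ▸ hX)
  have hin : ∀ u ∈ Set.Ico s s₁, larmorArc R g (t, u) ∈ stringDomain R g := fun u hu => by
    by_contra hcon
    exact absurd (hmin ⟨⟨hu.1, hu.2.le.trans hs1π⟩, hcon⟩) (not_le.2 hu.2)
  have hu : ∀ n : ℕ, s₁ - (s₁ - s) / (n + 2) ∈ Set.Ico ((s + s₁) / 2) s₁ := fun n => by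
    have hn : (0 : ℝ) ≤ (n : ℝ) := Nat.cast_nonneg _
    have h1 : (s₁ - s) / (n + 2) ≤ (s₁ - s) / 2 :=
      div_le_div_of_nonneg_left (by linarith) two_pos (by linarith)
    have h2 : 0 < (s₁ - s) / (n + 2) := div_pos (by linarith) (by positivity)
    exact ⟨by linarith, by linarith⟩
  have hY : ∀ n : ℕ, larmorArc R g (t, s₁ - (s₁ - s) / (n + 2)) ∈ stringDomain R g := fun n =>
    hin _ ⟨by linarith [(hu n).1], (hu n).2⟩
  have hlim : Filter.Tendsto (fun n : ℕ => larmorArc R g (t, s₁ - (s₁ - s) / (n + 2)))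
      Filter.atTop (nhds (larmorArc R g (t, s₁))) := by
    have h1 : Filter.Tendsto (fun n : ℕ => (s₁ - s) / ((n : ℝ) + 2)) Filter.atTop (nhds 0) :=
      tendsto_const_nhds.div_atTop
        (Filter.tendsto_atTop_add_const_right _ 2 tendsto_natCast_atTop_atTop)
    have h2 := h1.const_sub s₁
    rw [sub_zero] at h2
    exact (hcont.tendsto s₁).comp h2
  obtain ⟨t₀, ht₀⟩ : ∃ t₀, 2 * R ≤ ‖larmorArc R g (t, s₁) - g t₀‖ := by
    by_contra! hcon
    refine hs1Ω (h.mem_stringDomain_of_norm_sub_lt (h.larmorArc_notMem_hull ?_ ?_) hcon)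
    · linarith
    · rw [abs_of_pos (by linarith)]; linarith
  obtain ⟨φ, hφ⟩ := h.exists_tendsto_of_norm_sub hY hlim ht₀
  have hmid : (s + s₁) / 2 < s₁ := by linarith
  refine lt_of_lt_of_le (h.stringFunction_lt hs (s₂ := (s + s₁) / 2) (by linarith) (by linarith)
    (hin _ ⟨by linarith, hmid⟩)) (ge_of_tendsto' hφ fun n => ?_)
  rcases (hu (φ n)).1.eq_or_lt with h1 | h1
  · rw [h1]
  · exact (h.stringFunction_lt (by linarith) h1 (by linarith [(hu (φ n)).2]) (hY _)).le

/-- The limits of the string function at the boundary of the domain are not among its values. -/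
theorem isCompact_stringLevel (h : IsObstacle R g 1) (c : ℝ) : IsCompact (stringLevel R g c) := by
  refine Metric.isCompact_of_isClosed_isBounded ?_ ?_
  · refine isClosed_of_closure_subset fun X hX => ?_
    obtain ⟨Y, hY, hlim⟩ := mem_closure_iff_seq_limit.1 hX
    have hYF : ∀ n, stringFunction R g (Y n) = c := fun n => (hY n).2
    have hYΩ : ∀ n, Y n ∈ stringDomain R g := fun n => (hY n).1
    have hXΩ : X ∈ stringDomain R g := by
      refine h.mem_stringDomain_of_norm_sub_lt (fun hmem => ?_) fun t => ?_
      · obtain ⟨φ, hφ⟩ := h.exists_tendsto_of_mem_hull hYΩ hlim hmem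
        simp only [hYF] at hφ
        have := h.lt_stringFunction (hYΩ 0)
        rw [tendsto_nhds_unique tendsto_const_nhds hφ] at hYF
        linarith [hYF 0]
      · by_contra! hcon
        obtain ⟨φ, hφ⟩ := h.exists_tendsto_of_norm_sub hYΩ hlim hcon
        simp only [hYF] at hφ
        have := h.stringFunction_lt_pi (hYΩ 0)
        rw [tendsto_nhds_unique tendsto_const_nhds hφ] at hYF
        linarith [hYF 0]
    refine ⟨hXΩ, ?_⟩
    obtain ⟨q, q', hq⟩ := h.exists_isTautString hXΩ
    have h1 := (hq.contDiffAt_stringFunction h hXΩ).continuousAt.tendsto.comp hlim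
    exact tendsto_nhds_unique h1 (tendsto_const_nhds.congr fun n => (hYF n).symm)
  · refine Metric.isBounded_ball.subset fun X (hX : X ∈ stringLevel R g c) =>
      (?_ : X ∈ Metric.ball (g 0) (2 * R))
    rw [Metric.mem_ball, dist_eq_norm]
    exact norm_sub_lt_of_mem_stringDomain hX.1 0

end IsObstacle


/-! ### Magnetic trajectories and reflections -/

namespace IsMagneticTrajectory

variable {R : ℝ} {q r : ℝ → ℂ}

theorem deriv_eq (hq : IsMagneticTrajectory R q) (b s : ℝ) :
    deriv q s = deriv q b * Complex.exp (((s - b) / R : ℝ) * Complex.I) := by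
  have hd : ∀ s, HasDerivAt (fun s => deriv q s * Complex.exp ((-((s - b) / R) : ℝ) * Complex.I))
      0 s := fun s => by
    have h1 : HasDerivAt (fun s : ℝ => -((s - b) / R)) (-(1 / R)) s :=
      (((hasDerivAt_id s).sub_const b).div_const R).neg
    refine ((hq.equation s).mul (h1.ofReal_comp.mul_const Complex.I).cexp).congr_deriv ?_
    push_cast
    ring
  have h1 := is_const_of_deriv_eq_zero (fun s => (hd s).differentiableAt)
    (fun s => (hd s).deriv) s b
  simp only [sub_self, zero_div, neg_zero, Complex.ofReal_zero, zero_mul, Complex.exp_zero,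
    mul_one] at h1
  rw [← h1, mul_assoc, ← Complex.exp_add]
  push_cast
  rw [← add_mul, neg_add_cancel, zero_mul, Complex.exp_zero, mul_one]

/-- The Larmor center is a constant of motion. -/
theorem add_eq (hq : IsMagneticTrajectory R q) (hR : R ≠ 0) (b s : ℝ) :
    q s + R * (Complex.I * deriv q s) = q b + R * (Complex.I * deriv q b) := by
  have hR' : (R : ℂ) ≠ 0 := by exact_mod_cast hR
  have hd : ∀ s, HasDerivAt (fun s => q s + R * (Complex.I * deriv q s)) 0 s := fun s => by
    refine ((hq.differentiable s).hasDerivAt.add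
      (((hq.equation s).const_mul Complex.I).const_mul (R : ℂ))).congr_deriv ?_
    push_cast
    field_simp
    linear_combination deriv q s * Complex.I_sq
  exact is_const_of_deriv_eq_zero (fun s => (hd s).differentiableAt) (fun s => (hd s).deriv) s b

theorem unique (hq : IsMagneticTrajectory R q) (hr : IsMagneticTrajectory R r) (hR : R ≠ 0) {b : ℝ}
    (h0 : q b = r b) (h1 : deriv q b = deriv r b) : q = r := by
  ext s
  have e1 := hq.add_eq hR b s
  have e2 := hr.add_eq hR b s
  rw [hq.deriv_eq b s, h0, h1] at e1
  rw [hr.deriv_eq b s] at e2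
  exact add_right_cancel (e1.trans e2.symm)

end IsMagneticTrajectory

theorem exists_isMagneticTrajectory {R : ℝ} (hR : R ≠ 0) (X : ℂ) {w : ℂ} (hw : ‖w‖ = 1) (b : ℝ) :
    ∃ q, IsMagneticTrajectory R q ∧ q b = X ∧ deriv q b = w := by
  have hR' : (R : ℂ) ≠ 0 := by exact_mod_cast hR
  have he : ∀ s, HasDerivAt (fun s : ℝ => Complex.exp (((s - b) / R : ℝ) * Complex.I))
      (Complex.exp (((s - b) / R : ℝ) * Complex.I) * ((1 / R : ℝ) * Complex.I)) s := fun s =>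
    ((((hasDerivAt_id s).sub_const b).div_const R).ofReal_comp.mul_const Complex.I).cexp
  have hd : ∀ s, HasDerivAt (fun s : ℝ => X + R * (Complex.I * w) -
      R * (Complex.I * (w * Complex.exp (((s - b) / R : ℝ) * Complex.I))))
      (w * Complex.exp (((s - b) / R : ℝ) * Complex.I)) s := fun s => by
    refine (((((he s).const_mul w).const_mul Complex.I).const_mul (R : ℂ)).const_sub _).congr_deriv
      ?_
    push_cast
    field_simp
    linear_combination (-w) * Complex.I_sq
  have hd' := funext fun s => (hd s).deriv
  refine ⟨_, ⟨fun s => (hd s).differentiableAt, fun s => ?_, fun s => ?_⟩, ?_, ?_⟩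
  · rw [(hd s).deriv, norm_mul, hw, Complex.norm_exp_ofReal_mul_I, one_mul]
  · rw [hd']
    refine ((he s).const_mul w).congr_deriv ?_
    ring
  · simp
  · rw [(hd b).deriv]
    simp

namespace IsObstacle

variable {R ε : ℝ} {g : ℝ → ℂ}

theorem hasDerivAt_larmorArc_sub (h : IsObstacle R g ε) (t s₀ s : ℝ) :
    HasDerivAt (fun s => larmorArc R g (t, s - s₀)) (arcVelocity R g (t, s - s₀)) s :=
  (h.hasDerivAt_larmorArc_snd t (s - s₀)).comp_sub_const s s₀

theorem isMagneticTrajectory_larmorArc (h : IsObstacle R g ε) (t s₀ : ℝ) :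
    IsMagneticTrajectory R fun s => larmorArc R g (t, s - s₀) := by
  have hd := h.hasDerivAt_larmorArc_sub t s₀
  refine ⟨fun s => (hd s).differentiableAt, fun s => ?_, fun s => ?_⟩
  · rw [(hd s).deriv, h.norm_arcVelocity]
  · rw [funext fun s => (hd s).deriv]
    have he : HasDerivAt (fun s : ℝ => Complex.exp (((s - s₀) / R : ℝ) * Complex.I))
        (Complex.exp (((s - s₀) / R : ℝ) * Complex.I) * ((1 / R : ℝ) * Complex.I)) s :=
      ((((hasDerivAt_id s).sub_const s₀).div_const R).ofReal_comp.mul_const Complex.I).cexp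
    refine (he.const_mul (unitTangent g t)).congr_deriv ?_
    simp only [arcVelocity]
    ring

/-- A trajectory that is tangent to the curve is a tangent Larmor arc. -/
theorem eq_larmorArc_of_tangent (h : IsObstacle R g ε) {q : ℝ → ℂ}
    (hq : IsMagneticTrajectory R q) {s₀ t k : ℝ} (h0 : q s₀ = g t) (hk : 0 < k)
    (h1 : deriv g t = (k : ℂ) * deriv q s₀) : q = fun s => larmorArc R g (t, s - s₀) := by
  refine hq.unique (h.isMagneticTrajectory_larmorArc t s₀) h.pos.ne' (b := s₀) ?_ ?_
  · rw [sub_self, larmorArc_zero, h0]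
  · rw [(h.hasDerivAt_larmorArc_sub t s₀ s₀).deriv, sub_self, arcVelocity_zero, unitTangent]
    have hn : speed g t = k := by
      rw [speed, h1, norm_mul, hq.speed, mul_one, Complex.norm_real, Real.norm_of_nonneg hk.le]
    have hk' : (k : ℂ) ≠ 0 := by exact_mod_cast hk.ne'
    rw [hn, h1]
    field_simp

end IsObstacle

theorem inner_I_mul_right (v x : ℂ) : inner ℝ v (Complex.I * x) = -cross v x := by
  rw [inner_eq_re, cross]; simp; ring

theorem eq_of_inner_eq_of_cross_eq {τ v w : ℂ} (hτ : τ ≠ 0) (h1 : inner ℝ v τ = inner ℝ w τ)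
    (h2 : cross v τ = cross w τ) : v = w := by
  have hn : 0 < τ.re ^ 2 + τ.im ^ 2 := by
    have := Complex.normSq_pos.2 hτ
    rw [Complex.normSq_apply] at this
    nlinarith
  rw [inner_eq_re, inner_eq_re] at h1
  rw [cross, cross] at h2
  apply Complex.ext
  · have : (τ.re ^ 2 + τ.im ^ 2) * (v.re - w.re) = 0 := by
      linear_combination τ.re * h1 + τ.im * h2
    linarith [(mul_eq_zero.1 this).resolve_left hn.ne']
  · have : (τ.re ^ 2 + τ.im ^ 2) * (v.im - w.im) = 0 := by
      linear_combination τ.im * h1 - τ.re * h2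
    linarith [(mul_eq_zero.1 this).resolve_left hn.ne']

theorem isElasticReflection_iff {τ v w : ℂ} :
    IsElasticReflection τ v w ↔ inner ℝ w τ = inner ℝ v τ ∧ cross w τ = -cross v τ := by
  rw [IsElasticReflection, inner_I_mul_right, inner_I_mul_right]
  constructor <;> rintro ⟨h1, h2⟩ <;> exact ⟨h1, by linarith⟩

theorem IsElasticReflection.unique {τ v w w' : ℂ} (hτ : τ ≠ 0) (h : IsElasticReflection τ v w)
    (h' : IsElasticReflection τ v w') : w = w' := by
  rw [isElasticReflection_iff] at h h'
  exact eq_of_inner_eq_of_cross_eq hτ (h.1.trans h'.1.symm) (h.2.trans h'.2.symm)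

theorem inner_sq_add_cross_sq (v τ : ℂ) :
    inner ℝ v τ ^ 2 + cross v τ ^ 2 = ‖v‖ ^ 2 * ‖τ‖ ^ 2 := by
  rw [inner_eq_re, cross, Complex.sq_norm, Complex.sq_norm, Complex.normSq_apply,
    Complex.normSq_apply]
  ring

/-- Two different unit vectors with the same tangential component are reflections of each other. -/
theorem isElasticReflection_of_inner_eq {τ v w : ℂ} (hτ : τ ≠ 0) (hv : ‖v‖ = 1) (hw : ‖w‖ = 1)
    (hne : v ≠ w) (h : inner ℝ v τ = inner ℝ w τ) : IsElasticReflection τ v w := by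
  rw [isElasticReflection_iff]
  refine ⟨h.symm, ?_⟩
  have h1 := inner_sq_add_cross_sq v τ
  have h2 := inner_sq_add_cross_sq w τ
  rw [hv] at h1
  rw [hw, ← h, ← h1] at h2
  rcases sq_eq_sq_iff_eq_or_eq_neg.1 (add_left_cancel h2) with h3 | h3
  · exact absurd (eq_of_inner_eq_of_cross_eq hτ h h3.symm) hne
  · exact h3

theorem exists_isElasticReflection {τ v : ℂ} (hτ : τ ≠ 0) (hv : ‖v‖ = 1) :
    ∃ w, ‖w‖ = 1 ∧ IsElasticReflection τ v w := by
  have hc : starRingEnd ℂ τ ≠ 0 := (map_ne_zero _).2 hτ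
  have hn : τ.re ^ 2 + τ.im ^ 2 ≠ 0 := by
    have := Complex.normSq_pos.2 hτ
    rw [Complex.normSq_apply] at this
    nlinarith
  have key : τ / starRingEnd ℂ τ * starRingEnd ℂ v * starRingEnd ℂ τ = τ * starRingEnd ℂ v := by
    field_simp
  have hre := congrArg Complex.re key
  have him := congrArg Complex.im key
  refine ⟨τ / starRingEnd ℂ τ * starRingEnd ℂ v, ?_, ?_⟩
  · rw [norm_mul, norm_div, Complex.norm_conj, Complex.norm_conj, hv,
      div_self (norm_ne_zero_iff.2 hτ), one_mul]
  · set w := τ / starRingEnd ℂ τ * starRingEnd ℂ v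
    rw [isElasticReflection_iff, inner_eq_re, inner_eq_re, cross, cross]
    simp only [Complex.mul_re, Complex.mul_im, Complex.conj_re, Complex.conj_im] at hre him
    constructor <;> linarith


/-! ### Monotonicity along departing arcs -/

namespace IsObstacle

variable {R ε : ℝ} {g : ℝ → ℂ}

theorem exists_isTautString_of_depart (h : IsObstacle R g ε) {X : ℂ} (hX : X ∈ stringDomain R g)
    {q' : ℝ × ℝ} (hq : larmorArc R g q' = X) (hq0 : q'.2 < 0) (hqπ : -(Real.pi * R) < q'.2) :
    ∃ q, IsTautString R g X q q' := by
  obtain ⟨r, r', hr⟩ := h.exists_isTautString hX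
  obtain ⟨⟨k, hk⟩, h2⟩ := h.larmorArc_unique (t := q'.1) (t' := r'.1) (s := q'.2)
    (by rw [abs_of_neg hq0]; linarith) hr.abs_lt_depart (mul_pos_of_neg_of_neg hq0 hr.neg)
    (hq.trans hr.depart.symm)
  have := hr.add_int h k
  rw [← hk, ← h2] at this
  exact ⟨_, this⟩

/-- The length of the taut string decreases along the departing arcs. -/
theorem stringFunction_depart_lt (h : IsObstacle R g ε) {t s₁ s₂ : ℝ} (h1 : 0 < s₁)
    (h12 : s₁ < s₂) (h2 : s₂ < Real.pi * R) (hΩ : larmorArc R g (t, -s₂) ∈ stringDomain R g) :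
    stringFunction R g (larmorArc R g (t, -s₁)) < stringFunction R g (larmorArc R g (t, -s₂)) := by
  have hs2 : 0 < s₂ := h1.trans h12
  have hmem : ∀ s ∈ Set.Icc s₁ s₂, larmorArc R g (t, -s) ∈ stringDomain R g := fun s hs => by
    have := h.larmorArc_mul_mem_stringDomain (neg_ne_zero.2 hs2.ne')
      (by rwa [abs_neg, abs_of_pos hs2]) hΩ
      (r := s / s₂) ⟨div_pos (h1.trans_le hs.1) hs2, (div_le_one hs2).2 hs.2⟩
    rwa [mul_neg, div_mul_cancel₀ _ hs2.ne'] at this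
  have hd : ∀ s ∈ Set.Icc s₁ s₂, ∃ d > 0,
      HasDerivAt (fun s => stringFunction R g (larmorArc R g (t, -s))) d s := fun s hs => by
    obtain ⟨q, hq⟩ := h.exists_isTautString_of_depart (hmem s hs) rfl
      (by have := hs.1; simp only; linarith) (by have := hs.2; simp only; linarith)
    have hd := (hq.hasFDerivAt_stringFunction h (hmem s hs)).comp_hasDerivAt s
      ((h.hasDerivAt_larmorArc_snd t (-s)).scomp s (hasDerivAt_neg s))
    refine ⟨_, ?_, hd⟩
    have := hq.inner_lt_one h
    rw [neg_smul, one_smul, innerSL_apply_apply, inner_neg_right, inner_sub_left,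
      real_inner_self_eq_norm_sq, h.norm_arcVelocity]
    linarith
  refine strictMonoOn_of_deriv_pos (f := fun s => stringFunction R g (larmorArc R g (t, -s)))
    (convex_Icc s₁ s₂) (fun s hs => ?_) (fun s hs => ?_) (Set.left_mem_Icc.2 h12.le)
    (Set.right_mem_Icc.2 h12.le) h12
  · obtain ⟨d, -, hd⟩ := hd s hs
    exact hd.continuousAt.continuousWithinAt
  · obtain ⟨d, hd0, hd⟩ := hd s (interior_subset hs)
    rw [hd.deriv]
    exact hd0

end IsObstacle

/-! ### Regions swept out by arriving arcs -/

/-- The union of the obstacle and of the arriving arcs of length less than `σ t` from the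
points `g t`. -/
def sweptRegion (R : ℝ) (g : ℝ → ℂ) (σ : ℝ → ℝ) : Set ℂ :=
  convexHull ℝ (Set.range g) ∪ {Y | ∃ t s, 0 < s ∧ s < σ t ∧ larmorArc R g (t, s) = Y}

namespace IsObstacle

variable {R ε : ℝ} {g : ℝ → ℂ} {σ : ℝ → ℝ}

theorem isOpen_sweptRegion (h : IsObstacle R g ε) (hσ : Continuous σ)
    (hper : Function.Periodic σ 1) (h0 : ∀ t, 0 < σ t) (hπ : ∀ t, σ t < Real.pi * R) {p : ℂ}
    (hp : Set.range g ⊆ Metric.ball p R) : IsOpen (sweptRegion R g σ) := by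
  have hE := (h.contDiff_larmorArc R).continuous
  have hπR := mul_pos Real.pi_pos h.pos
  rw [isOpen_iff_mem_nhds]
  rintro Y (hY | ⟨t, s, hs0, hs, rfl⟩)
  · -- close to the obstacle the arriving arcs are shorter than the minimum `m` of `σ`
    obtain ⟨m, hm0, hm⟩ : ∃ m > 0, ∀ t, m ≤ σ t := by
      obtain ⟨t₀, -, ht₀⟩ := (isCompact_Icc (a := (0 : ℝ)) (b := 1)).exists_isMinOn
        ⟨0, by simp⟩ hσ.continuousOn
      refine ⟨σ t₀, h0 t₀, fun t => ?_⟩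
      obtain ⟨u, hu, hu'⟩ := hper.exists_mem_Ico₀ one_pos t
      rw [hu']
      exact ht₀ ⟨hu.1, hu.2.le⟩
    have hC : IsCompact (larmorArc R g '' (Set.Icc 0 1 ×ˢ Set.Icc m (Real.pi * R))) :=
      (isCompact_Icc.prod isCompact_Icc).image hE
    have hYC : Y ∉ larmorArc R g '' (Set.Icc 0 1 ×ˢ Set.Icc m (Real.pi * R)) := by
      rintro ⟨⟨t, s⟩, ⟨-, hs1, hs2⟩, rfl⟩
      simp only at hs1 hs2
      refine h.larmorArc_notMem_hull (t := t) (s := s) (by linarith) ?_ hY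
      rw [abs_of_pos (by linarith)]; linarith
    filter_upwards [hC.isClosed.isOpen_compl.mem_nhds hYC,
      Metric.isOpen_ball.mem_nhds (hull_subset_ball hp hY)] with Z hZC hZp
    by_cases hZ : Z ∈ convexHull ℝ (Set.range g)
    · exact Or.inl hZ
    · obtain ⟨t, s, hs0, hsπ, hE⟩ := h.exists_larmorArc_eq_of_mem ⟨hZ, p, hp, hZp⟩
        (Or.inl rfl : (1 : ℝ) = 1 ∨ _)
      rw [one_mul] at hs0
      rw [abs_of_pos hs0] at hsπ
      refine Or.inr ⟨t, s, hs0, ?_, hE⟩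
      by_contra! hcon
      refine hZC ⟨(t + (-⌊t⌋ : ℤ), s), ⟨⟨?_, ?_⟩, (hm t).trans hcon, hsπ.le⟩, ?_⟩
      · have := Int.floor_le t
        push_cast; linarith
      · have := Int.lt_floor_add_one t
        push_cast; linarith
      · rw [h.larmorArc_add_int, hE]
  · have hsπ : |s| < Real.pi * R := by rw [abs_of_pos hs0]; exact hs.trans (hπ t)
    obtain ⟨e, e1, e2, e3, -⟩ := h.exists_localInverse (t := t) hs0.ne' hsπ
    have hopen : IsOpen {r : ℝ × ℝ | 0 < r.2 ∧ r.2 < σ r.1} :=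
      IsOpen.and (isOpen_lt continuous_const continuous_snd)
        (isOpen_lt continuous_snd (hσ.comp continuous_fst))
    filter_upwards [e3, e1.continuousAt.eventually_mem (hopen.mem_nhds (by
      rw [e2]; exact ⟨hs0, hs⟩))]
      with Z hZ1 hZ2
    exact Or.inr ⟨_, _, hZ2.1, hZ2.2, hZ1⟩

theorem isConnected_sweptRegion (h : IsObstacle R g ε) (σ : ℝ → ℝ) :
    IsConnected (sweptRegion R g σ) := by
  have hE := (h.contDiff_larmorArc R).continuous
  have hK := (convex_convexHull ℝ (Set.range g)).isPreconnected
  refine ⟨⟨g 0, Or.inl (IsConvexClosedCurve.mem_hull g 0)⟩,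
    isPreconnected_of_forall (g 0) fun Y hY => ?_⟩
  rcases hY with hY | ⟨t, s, hs0, hs, rfl⟩
  · exact ⟨_, Set.subset_union_left, IsConvexClosedCurve.mem_hull g 0, hY, hK⟩
  · refine ⟨convexHull ℝ (Set.range g) ∪ (fun u => larmorArc R g (t, u)) '' Set.Icc 0 s,
      ?_, Or.inl (IsConvexClosedCurve.mem_hull g 0), Or.inr ⟨s, ⟨hs0.le, le_rfl⟩, rfl⟩, ?_⟩
    · rintro Z (hZ | ⟨u, hu, rfl⟩)
      · exact Or.inl hZ
      · rcases hu.1.eq_or_lt with h1 | h1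
        · rw [← h1]
          simp only [larmorArc_zero]
          exact Or.inl (IsConvexClosedCurve.mem_hull g t)
        · exact Or.inr ⟨t, u, h1, hu.2.trans_lt hs, rfl⟩
    · refine IsPreconnected.union (g t) (IsConvexClosedCurve.mem_hull g t)
        ⟨0, ⟨le_rfl, hs0.le⟩, larmorArc_zero R g t⟩ hK
        (isPreconnected_Icc.image _ (Continuous.continuousOn (by fun_prop)))

theorem isCompact_union_image_larmorArc (h : IsObstacle R g ε) (hσ : Continuous σ) :
    IsCompact (convexHull ℝ (Set.range g) ∪ (fun r : ℝ × ℝ => larmorArc R g (r.1, r.2 * σ r.1)) ''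
      (Set.Icc 0 1 ×ˢ Set.Icc 0 1)) := by
  have hE := (h.contDiff_larmorArc R).continuous
  exact h.isCompact_hull.union ((isCompact_Icc.prod isCompact_Icc).image (by fun_prop))

theorem sweptRegion_subset (h : IsObstacle R g ε) (hper : Function.Periodic σ 1) :
    sweptRegion R g σ ⊆ convexHull ℝ (Set.range g) ∪
      (fun r : ℝ × ℝ => larmorArc R g (r.1, r.2 * σ r.1)) '' (Set.Icc 0 1 ×ˢ Set.Icc 0 1) := by
  rintro Y (hY | ⟨t, s, hs0, hs, rfl⟩)
  · exact Or.inl hY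
  · have hper' := hper.int_mul (-⌊t⌋) t
    rw [mul_one] at hper'
    refine Or.inr ⟨(t + (-⌊t⌋ : ℤ), s / σ t), ⟨⟨?_, ?_⟩, ?_, ?_⟩, ?_⟩
    · have := Int.floor_le t
      push_cast; linarith
    · have := Int.lt_floor_add_one t
      push_cast; linarith
    · exact (div_pos hs0 (hs0.trans hs)).le
    · exact ((div_lt_one (hs0.trans hs)).2 hs).le
    · simp only
      rw [h.larmorArc_add_int, hper', div_mul_cancel₀ _ (hs0.trans hs).ne']

theorem isBounded_sweptRegion (h : IsObstacle R g ε) (hσ : Continuous σ)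
    (hper : Function.Periodic σ 1) : Bornology.IsBounded (sweptRegion R g σ) :=
  (h.isCompact_union_image_larmorArc hσ).isBounded.subset (h.sweptRegion_subset hper)

theorem larmorArc_notMem_sweptRegion (h : IsObstacle R g ε) (hper : Function.Periodic σ 1)
    (h0 : ∀ t, 0 < σ t) (hπ : ∀ t, σ t < Real.pi * R) (t : ℝ) :
    larmorArc R g (t, σ t) ∉ sweptRegion R g σ := by
  rintro (hmem | ⟨t', s, hs0, hs, hE⟩)
  · refine h.larmorArc_notMem_hull (h0 t).ne' ?_ hmem
    rw [abs_of_pos (h0 t)]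
    linarith [hπ t, h0 t]
  · obtain ⟨⟨k, rfl⟩, rfl⟩ := h.larmorArc_unique (by rw [abs_of_pos hs0]; exact hs.trans (hπ t'))
      (by rw [abs_of_pos (h0 t)]; exact hπ t) (mul_pos hs0 (h0 t)) hE
    have hper' := hper.int_mul k t
    rw [mul_one] at hper'
    rw [hper'] at hs
    exact lt_irrefl _ hs

/-- The swept region is bounded by the end points of the arcs. -/
theorem frontier_sweptRegion (h : IsObstacle R g ε) (hσ : Continuous σ)
    (hper : Function.Periodic σ 1) (h0 : ∀ t, 0 < σ t) (hπ : ∀ t, σ t < Real.pi * R) {p : ℂ}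
    (hp : Set.range g ⊆ Metric.ball p R) :
    frontier (sweptRegion R g σ) = Set.range fun t => larmorArc R g (t, σ t) := by
  have hE := (h.contDiff_larmorArc R).continuous
  rw [(h.isOpen_sweptRegion hσ hper h0 hπ hp).frontier_eq]
  apply Set.Subset.antisymm
  · rintro Y ⟨hY, hYA⟩
    rcases closure_minimal (h.sweptRegion_subset hper)
      (h.isCompact_union_image_larmorArc hσ).isClosed hY with hY | ⟨⟨t, r⟩, ⟨-, hr0, hr1⟩, rfl⟩
    · exact absurd (Or.inl hY) hYA
    · simp only at hr0 hr1 hYA ⊢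
      rcases hr0.eq_or_lt with h1 | h1
      · rw [← h1, zero_mul, larmorArc_zero] at hYA
        exact absurd (Or.inl (IsConvexClosedCurve.mem_hull g t)) hYA
      rcases hr1.eq_or_lt with h2 | h2
      · exact ⟨t, by rw [h2, one_mul]⟩
      · exact absurd (Or.inr ⟨t, r * σ t, mul_pos h1 (h0 t), by nlinarith [h0 t], rfl⟩) hYA
  · rintro _ ⟨t, rfl⟩
    refine ⟨?_, h.larmorArc_notMem_sweptRegion hper h0 hπ t⟩
    have hc : ContinuousWithinAt (fun s => larmorArc R g (t, s)) (Set.Ioo 0 (σ t)) (σ t) :=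
      Continuous.continuousWithinAt (by fun_prop)
    refine closure_mono ?_ (hc.mem_closure_image (by
      rw [closure_Ioo (h0 t).ne]; exact ⟨(h0 t).le, le_rfl⟩))
    rintro _ ⟨s, hs, rfl⟩
    exact Or.inr ⟨t, s, hs.1, hs.2, rfl⟩

end IsObstacle


/-! ### Compact level sets are caustic tables -/

namespace IsObstacle

variable {R ε : ℝ} {g : ℝ → ℂ}

/-- By monotonicity, an arriving arc meets a level set at most once. -/
theorem mem_stringLevel_unique (h : IsObstacle R g ε) {c t s s' : ℝ} (hs0 : 0 < s)
    (hs : s < Real.pi * R) (hs0' : 0 < s') (hs' : s' < Real.pi * R)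
    (hE : larmorArc R g (t, s) ∈ stringLevel R g c)
    (hE' : larmorArc R g (t, s') ∈ stringLevel R g c) : s = s' := by
  rcases lt_trichotomy s s' with h1 | h1 | h1
  · have := h.stringFunction_lt hs0 h1 hs' hE'.1
    rw [hE.2, hE'.2] at this
    exact absurd this (lt_irrefl _)
  · exact h1
  · have := h.stringFunction_lt hs0' h1 hs hE.1
    rw [hE.2, hE'.2] at this
    exact absurd this (lt_irrefl _)

/-- The implicit function theorem, applied to the string function on the arriving arcs. -/
theorem exists_local_level (h : IsObstacle R g ε) {c t₀ s₀ : ℝ} (hs0 : 0 < s₀)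
    (hs : s₀ < Real.pi * R) (hE : larmorArc R g (t₀, s₀) ∈ stringLevel R g c) :
    ∃ ρ : ℝ → ℝ, ContDiffAt ℝ ∞ ρ t₀ ∧ ρ t₀ = s₀ ∧ ∀ᶠ t in nhds t₀, 0 < ρ t ∧
      ρ t < Real.pi * R ∧ larmorArc R g (t, ρ t) ∈ stringLevel R g c := by
  obtain ⟨q', hq⟩ := h.exists_isTautString_of_arrive hE.1 (q := (t₀, s₀)) rfl hs0 hs
  have cdf : ContDiffAt ℝ ∞ (fun r => stringFunction R g (larmorArc R g r)) (t₀, s₀) :=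
    (hq.contDiffAt_stringFunction h hE.1).comp (t₀, s₀) (h.contDiff_larmorArc R).contDiffAt
  have hd := (hq.hasFDerivAt_stringFunction h hE.1).comp (t₀, s₀)
    (h.hasFDerivAt_larmorArc h.pos (t₀, s₀))
  have hd0 : 1 - inner ℝ (arcVelocity R g (t₀, s₀)) (arcVelocity R g q') ≠ 0 := by
    have := hq.inner_lt_one h
    linarith
  have hinv : (fderiv ℝ (fun r => stringFunction R g (larmorArc R g r)) (t₀, s₀) ∘L
      .inr ℝ ℝ ℝ).IsInvertible := by
    refine ⟨ContinuousLinearEquiv.unitsEquivAut ℝ (Units.mk0 _ hd0), ?_⟩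
    have hd' : fderiv ℝ (fun r => stringFunction R g (larmorArc R g r)) (t₀, s₀) = _ := hd.fderiv
    rw [hd']
    ext
    simp [h.norm_arcVelocity, real_inner_comm]
  have h1 := cdf.contDiffAt_implicitFunction (by simp) hinv
  have h2 := cdf.implicitFunction_apply_self (by simp) hinv
  have h3 := cdf.eventually_apply_implicitFunction (by simp) hinv
  set ρ := cdf.implicitFunction (by simp) hinv
  simp only at h1 h2 h3
  refine ⟨ρ, h1, h2, ?_⟩
  have hc := h1.continuousAt
  have hcE : ContinuousAt (fun t => larmorArc R g (t, ρ t)) t₀ :=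
    (h.contDiff_larmorArc R).continuous.continuousAt.comp (continuousAt_id.prodMk hc)
  filter_upwards [h3, hc.eventually_mem (isOpen_Ioo.mem_nhds (show ρ t₀ ∈ Set.Ioo 0 (Real.pi * R) by
    rw [h2]; exact ⟨hs0, hs⟩)), hcE.eventually_mem (h.isOpen_stringDomain.mem_nhds (by
      simp only [h2]; exact hE.1))] with t a1 a2 a3
  exact ⟨a2.1, a2.2, a3, a1.trans hE.2⟩

/-- A compact level set meets every arriving arc: the contacts of the arcs that meet it form an open
and closed set of parameters. So it is a graph over the curve. -/
theorem exists_level_section (h : IsObstacle R g ε) {c : ℝ} (hne : (stringLevel R g c).Nonempty)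
    (hc : IsCompact (stringLevel R g c)) :
    ∃ σ : ℝ → ℝ, ContDiff ℝ ∞ σ ∧ Function.Periodic σ 1 ∧ (∀ t, 0 < σ t) ∧
      (∀ t, σ t < Real.pi * R) ∧ ∀ t, larmorArc R g (t, σ t) ∈ stringLevel R g c := by
  have hE := (h.contDiff_larmorArc R).continuous
  set U : Set ℝ := {t | ∃ s, 0 < s ∧ s < Real.pi * R ∧ larmorArc R g (t, s) ∈ stringLevel R g c}
    with hU
  have hopen : IsOpen U := by
    rw [isOpen_iff_mem_nhds]
    rintro t₀ ⟨s₀, hs0, hs, hE⟩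
    obtain ⟨ρ, -, -, h3⟩ := h.exists_local_level hs0 hs hE
    filter_upwards [h3] with t ht
    exact ⟨_, ht⟩
  have hclosed : IsClosed U := by
    refine isClosed_of_closure_subset fun t ht => ?_
    obtain ⟨u, hu, hlim⟩ := mem_closure_iff_seq_limit.1 ht
    choose s hs0 hsπ hs using hu
    obtain ⟨s', ⟨hs'0, hs'π⟩, φ, hφ, hφlim⟩ := (isCompact_Icc (a := 0)
      (b := Real.pi * R)).tendsto_subseq (fun n => ⟨(hs0 n).le, (hsπ n).le⟩)
    have hlim' := (hE.tendsto (t, s')).comp ((hlim.comp hφ.tendsto_atTop).prodMk_nhds hφlim)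
    have hmem : larmorArc R g (t, s') ∈ stringLevel R g c :=
      hc.isClosed.mem_of_tendsto hlim' (Filter.Eventually.of_forall fun n => hs (φ n))
    refine ⟨s', lt_of_le_of_ne hs'0 fun h0 => ?_, lt_of_le_of_ne hs'π fun h0 => ?_, hmem⟩
    · rw [← h0, larmorArc_zero] at hmem
      exact hmem.1.1 (IsConvexClosedCurve.mem_hull g t)
    · have := norm_sub_lt_of_mem_stringDomain hmem.1 t
      rw [← not_le, h.norm_larmorArc_sub_eq_iff (by rw [abs_of_nonneg hs'0]; exact hs'π)] at this
      exact this (by rw [abs_of_nonneg hs'0, h0])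
  have hUne : U.Nonempty := by
    obtain ⟨X, hX⟩ := hne
    obtain ⟨q, q', hq⟩ := h.exists_isTautString hX.1
    exact ⟨q.1, q.2, hq.pos, hq.lt_pi, by rw [Prod.mk.eta, hq.arrive]; exact hX⟩
  have hall : ∀ t, t ∈ U := fun t => by
    rw [IsClopen.eq_univ ⟨hclosed, hopen⟩ hUne]; trivial
  choose σ h0 hπ hσ using hall
  refine ⟨σ, contDiff_iff_contDiffAt.2 fun t => ?_, fun t => ?_, h0, hπ, hσ⟩
  · obtain ⟨ρ, h1, -, h3⟩ := h.exists_local_level (h0 t) (hπ t) (hσ t)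
    refine h1.congr_of_eventuallyEq ?_
    filter_upwards [h3] with u hu
    exact h.mem_stringLevel_unique (h0 u) (hπ u) hu.1 hu.2.1 (hσ u) hu.2.2
  · refine h.mem_stringLevel_unique (t := t) (h0 _) (hπ _) (h0 t) (hπ t) ?_ (hσ t)
    have := h.larmorArc_add_int R t (σ (t + 1)) 1
    rw [Int.cast_one] at this
    rw [← this]
    exact hσ (t + 1)

variable {σ : ℝ → ℝ}

theorem hasDerivAt_section (h : IsObstacle R g ε) {t d : ℝ} (hσ : HasDerivAt σ d t) :
    HasDerivAt (fun t => larmorArc R g (t, σ t))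
      (arcVariation R g (t, σ t) + (d : ℂ) * arcVelocity R g (t, σ t)) t := by
  have := (h.hasFDerivAt_larmorArc h.pos (t, σ t)).comp_hasDerivAt t ((hasDerivAt_id t).prodMk hσ)
  simpa [Function.comp_def] using this

theorem isSmoothSimpleClosedCurve_section (h : IsObstacle R g ε) (hσ : ContDiff ℝ ∞ σ)
    (hper : Function.Periodic σ 1) (h0 : ∀ t, 0 < σ t) (hπ : ∀ t, σ t < Real.pi * R) :
    IsSmoothSimpleClosedCurve fun t => larmorArc R g (t, σ t) where
  smooth := (h.contDiff_larmorArc R).comp (contDiff_id.prodMk hσ)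
  periodic t := by
    have := h.larmorArc_add_int R t (σ t) 1
    rw [Int.cast_one] at this
    simp only [hper t, this]
  regular t hd := by
    rw [(h.hasDerivAt_section (hσ.differentiable (by simp) t).hasDerivAt).deriv] at hd
    have h1 := h.cross_arcVariation_ne_zero (t := t) (h0 t).ne'
      (by rw [abs_of_pos (h0 t)]; exact hπ t)
    have h2 := congrArg (fun w => cross w (arcVelocity R g (t, σ t))) hd
    simp only [cross_add_left, cross_smul_left, cross_same, cross_zero_left, mul_zero,
      add_zero] at h2
    exact h1 h2
  injOn t ht u hu heq := by
    obtain ⟨⟨k, hk⟩, -⟩ := h.larmorArc_unique (by rw [abs_of_pos (h0 t)]; exact hπ t)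
      (by rw [abs_of_pos (h0 u)]; exact hπ u) (mul_pos (h0 t) (h0 u)) heq
    have k1 : (k : ℝ) < 1 := by linarith [ht.2, hu.1]
    have k2 : -1 < (k : ℝ) := by linarith [ht.1, hu.2]
    have k1' : k < 1 := by exact_mod_cast k1
    have k2' : -1 < k := by exact_mod_cast k2
    rw [hk, show k = 0 by omega]; simp

theorem range_section (h : IsObstacle R g ε) {c : ℝ} (h0 : ∀ t, 0 < σ t)
    (hπ : ∀ t, σ t < Real.pi * R) (hσ : ∀ t, larmorArc R g (t, σ t) ∈ stringLevel R g c) :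
    Set.range (fun t => larmorArc R g (t, σ t)) = stringLevel R g c := by
  apply Set.Subset.antisymm
  · rintro _ ⟨t, rfl⟩
    exact hσ t
  · intro X hX
    obtain ⟨⟨t, s⟩, q', hq⟩ := h.exists_isTautString hX.1
    have hs : s = σ t := h.mem_stringLevel_unique (t := t) hq.pos hq.lt_pi (h0 t) (hπ t)
      (by rw [hq.arrive]; exact hX) (hσ t)
    exact ⟨t, by simp only [← hs]; exact hq.arrive⟩

/-- The sublevel sets of the string function, together with the obstacle, are swept regions. -/
theorem mem_sweptRegion_of_lt (h : IsObstacle R g ε) {c : ℝ}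
    (hσ : ∀ t, larmorArc R g (t, σ t) ∈ stringLevel R g c) (h0 : ∀ t, 0 < σ t) {X : ℂ}
    (hX : X ∈ stringDomain R g) (hF : stringFunction R g X < c) : X ∈ sweptRegion R g σ := by
  obtain ⟨⟨t, s⟩, q', hq⟩ := h.exists_isTautString hX
  have hE : larmorArc R g (t, s) = X := hq.arrive
  refine Or.inr ⟨t, s, hq.pos, ?_, hE⟩
  by_contra! hcon
  rw [← (hσ t).2, ← hE] at hF
  rcases hcon.eq_or_lt with h1 | h1
  · rw [h1] at hF; exact lt_irrefl _ hF
  · exact lt_asymm hF (h.stringFunction_lt (h0 t) h1 hq.lt_pi (hE ▸ hX))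

theorem larmorArc_mem_sweptRegion {t s : ℝ} (hs0 : 0 ≤ s) (hs : s < σ t) :
    larmorArc R g (t, s) ∈ sweptRegion R g σ := by
  rcases hs0.eq_or_lt with h1 | h1
  · rw [← h1, larmorArc_zero]
    exact Or.inl (IsConvexClosedCurve.mem_hull g t)
  · exact Or.inr ⟨t, s, h1, hs, rfl⟩

/-- As the string function is constant on the boundary, its differential vanishes on the tangent
vectors, which is the reflection law for the arriving and the departing arc. -/
theorem hasCaustic_sweptRegion (h : IsObstacle R g ε) {c : ℝ} (hσ : ContDiff ℝ ∞ σ)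
    (hper : Function.Periodic σ 1) (h0 : ∀ t, 0 < σ t) (hπ : ∀ t, σ t < Real.pi * R)
    (hσc : ∀ t, larmorArc R g (t, σ t) ∈ stringLevel R g c) :
    HasCaustic R (sweptRegion R g σ) (fun t => larmorArc R g (t, σ t)) g := by
  obtain ⟨-, p, hp, -⟩ := (hσc 0).1
  have hN := h.isSmoothSimpleClosedCurve_section hσ hper h0 hπ
  have hfr := h.frontier_sweptRegion hσ.continuous hper h0 hπ hp
  have hopen := h.isOpen_sweptRegion hσ.continuous hper h0 hπ hp
  refine ⟨Set.subset_union_left, ?_⟩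
  rintro q a b ⟨hq, hab, hqa, hqb, hin⟩ ⟨s₀, hs₀, t, k, hst, hk, hd⟩ q' u hq' hu hqq' hrefl
  obtain rfl := h.eq_larmorArc_of_tangent hq hst hk hd
  simp only at hqb hin hu hqq'
  -- the segment ends at the first point of the arc outside the region
  have hb : b - s₀ = σ t := by
    rcases lt_trichotomy (b - s₀) (σ t) with h1 | h1 | h1
    · rw [hopen.frontier_eq] at hqb
      exact absurd (larmorArc_mem_sweptRegion (by linarith [hs₀.2]) h1) hqb.2
    · exact h1
    · have := hin (s₀ + σ t) ⟨by linarith [hs₀.1, h0 t], by linarith⟩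
      rw [add_sub_cancel_left] at this
      exact absurd this (h.larmorArc_notMem_sweptRegion hper h0 hπ t)
  rw [(h.hasDerivAt_larmorArc_sub t s₀ b).deriv] at hrefl
  rw [hb] at hqq' hrefl hu
  have hX := hσc t
  obtain ⟨⟨t', s'⟩, hr⟩ := h.exists_isTautString_of_arrive hX.1 (q := (t, σ t)) rfl (h0 t) (hπ t)
  have hs'0 : s' < 0 := hr.neg
  have hs'π : -(Real.pi * R) < s' := hr.neg_pi_lt
  have hr' : larmorArc R g (t', s') = larmorArc R g (t, σ t) := hr.depart
  -- the string function is constant along the boundary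
  have hdN : inner ℝ (arcVelocity R g (t, σ t) - arcVelocity R g (t', s'))
      (deriv (fun t => larmorArc R g (t, σ t)) u) = 0 := by
    have h1 := hr.hasFDerivAt_stringFunction h hX.1
    rw [← hu] at h1
    have h2 := h1.comp_hasDerivAt u (hN.hasDerivAt u)
    have h3 : stringFunction R g ∘ (fun t => larmorArc R g (t, σ t)) = fun _ => c :=
      funext fun t => (hσc t).2
    rw [h3] at h2
    exact h2.unique (hasDerivAt_const u c)
  rw [inner_sub_left, sub_eq_zero] at hdN
  have hw : deriv q' b = arcVelocity R g (t', s') :=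
    hrefl.unique (hN.regular u) (isElasticReflection_of_inner_eq (hN.regular u)
      (h.norm_arcVelocity R _) (h.norm_arcVelocity R _) (hr.arcVelocity_ne h) hdN)
  have hq'E : q' = fun s => larmorArc R g (t', s - (b - s')) := by
    refine hq'.unique (h.isMagneticTrajectory_larmorArc t' (b - s')) h.pos.ne' (b := b) ?_ ?_
    · simp only [sub_sub_cancel]
      rw [hqq', hr']
    · rw [(h.hasDerivAt_larmorArc_sub t' _ b).deriv, sub_sub_cancel, hw]
  have hE0 : larmorArc R g (t', b - s' - (b - s')) = g t' := by rw [sub_self, larmorArc_zero]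
  subst hq'E
  refine ⟨b - s' + σ t', ⟨hq', by linarith [h0 t'], ?_, ?_, fun s hs => ?_⟩, b - s',
    ⟨by linarith, by linarith [h0 t']⟩, t', speed g t', hE0, h.speed_pos t', ?_⟩
  · simp only [sub_sub_cancel]
    rw [hr', hfr]
    exact ⟨t, rfl⟩
  · simp only [add_sub_cancel_left]
    rw [hfr]
    exact ⟨t', rfl⟩
  · rcases lt_or_ge s (b - s') with h1 | h1
    · -- before the contact, the length of the taut string is smaller than at the boundary
      have h2 : larmorArc R g (t', -(-s')) ∈ stringDomain R g := by
        rw [neg_neg, hr']; exact hX.1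
      have h3 := h.stringFunction_depart_lt (s₁ := b - s' - s) (s₂ := -s') (by linarith)
        (by linarith [hs.1]) (by linarith) h2
      have h4 := h.larmorArc_mul_mem_stringDomain (r := (b - s' - s) / -s') hs'0.ne
        (by rw [abs_of_neg hs'0]; linarith) (by rw [hr']; exact hX.1)
        ⟨div_pos (by linarith) (by linarith), (div_le_one (by linarith)).2 (by linarith [hs.1])⟩
      have h5 : (b - s' - s) / -s' * s' = s - (b - s') := by
        have := hs'0.ne
        field_simp
        ring
      rw [neg_neg, hr', hX.2, neg_sub] at h3
      rw [h5] at h4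
      exact h.mem_sweptRegion_of_lt hσc h0 h4 h3
    · exact larmorArc_mem_sweptRegion (by linarith) (by linarith [hs.2])
  · rw [(h.hasDerivAt_larmorArc_sub t' _ _).deriv, sub_self, arcVelocity_zero, h.deriv_eq]

/-- A nonempty compact level set of the string function bounds a table with the caustic `g`. -/
theorem exists_isBilliardTable (h : IsObstacle R g ε) {c : ℝ} (hne : (stringLevel R g c).Nonempty)
    (hc : IsCompact (stringLevel R g c)) :
    ∃ (T : Set ℂ) (N : ℝ → ℂ), IsBilliardTable T N ∧ frontier T = stringLevel R g c ∧
      HasCaustic R T N g := by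
  obtain ⟨σ, hσ, hper, h0, hπ, hσc⟩ := h.exists_level_section hne hc
  obtain ⟨-, p, hp, -⟩ := (hσc 0).1
  have hfr := h.frontier_sweptRegion hσ.continuous hper h0 hπ hp
  exact ⟨sweptRegion R g σ, fun t => larmorArc R g (t, σ t),
    ⟨h.isOpen_sweptRegion hσ.continuous hper h0 hπ hp, h.isBounded_sweptRegion hσ.continuous hper,
      h.isConnected_sweptRegion σ, h.isSmoothSimpleClosedCurve_section hσ hper h0 hπ, hfr⟩,
    hfr.trans (h.range_section h0 hπ hσc), h.hasCaustic_sweptRegion hσ hper h0 hπ hσc⟩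

end IsObstacle


/-! ### Tables with the caustic `g` are bounded by level sets -/

/-- The first exit of a path from an open set. -/
theorem exists_first_exit {T : Set ℂ} (hT : IsOpen T) {f : ℝ → ℂ} (hf : Continuous f) {a : ℝ}
    (ha : 0 < a) (h0 : f 0 ∈ T) (h1 : f a ∉ closure T) :
    ∃ s, 0 < s ∧ s < a ∧ f s ∈ frontier T ∧ ∀ u, 0 ≤ u → u < s → f u ∈ T := by
  obtain ⟨s, ⟨⟨hs0, hsa⟩, hsT⟩, hmin⟩ : ∃ s, IsLeast (Set.Icc 0 a ∩ f ⁻¹' Tᶜ) s :=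
    (isCompact_Icc.inter_right (hT.isClosed_compl.preimage hf)).exists_isLeast
      ⟨a, ⟨ha.le, le_rfl⟩, fun h => h1 (subset_closure h)⟩
  have hs0' : 0 < s := lt_of_le_of_ne hs0 fun h => hsT (h ▸ h0)
  have hin : ∀ u, 0 ≤ u → u < s → f u ∈ T := fun u hu0 hu => by
    by_contra hcon
    exact absurd (hmin ⟨⟨hu0, hu.le.trans hsa⟩, hcon⟩) (not_le.2 hu)
  have hcl : f s ∈ closure T := by
    refine closure_mono ?_ ((hf.continuousWithinAt (s := Set.Ioo 0 s)).mem_closure_image (by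
      rw [closure_Ioo hs0'.ne]; exact ⟨hs0, le_rfl⟩))
    rintro _ ⟨u, hu, rfl⟩
    exact hin u hu.1.le hu.2
  refine ⟨s, hs0', lt_of_le_of_ne hsa fun h => h1 (h ▸ hcl), ?_, hin⟩
  rw [hT.frontier_eq]
  exact ⟨hcl, hsT⟩

namespace IsObstacle

variable {R ε : ℝ} {g N : ℝ → ℂ} {T : Set ℂ}

/-- The union of the discs of radius `R` around the curve is star-shaped, hence contains a table
if it contains its boundary. -/
theorem exists_ball_of_mem_closure (hT : IsBilliardTable T N)
    (hΩ : frontier T ⊆ stringDomain R g) {X : ℂ} (hX : X ∈ closure T) :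
    ∃ p, Set.range g ⊆ Metric.ball p R ∧ X ∈ Metric.ball p R := by
  by_cases hXT : X ∈ T
  · by_cases hX0 : X = g 0
    · obtain ⟨-, p, hp, -⟩ := hΩ (hT.boundary ▸ ⟨0, rfl⟩ : N 0 ∈ frontier T)
      exact ⟨p, hp, hX0 ▸ hp ⟨0, rfl⟩⟩
    have hn : 0 < ‖X - g 0‖ := norm_pos_iff.2 (sub_ne_zero.2 hX0)
    obtain ⟨M, hM⟩ := hT.isBounded.closure.subset_closedBall 0
    have hM0 : 0 ≤ M := dist_nonneg.trans (hM hX)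
    -- the ray from `g 0` through `X` leaves the table at a point of one of the discs
    obtain ⟨s, hs0, -, hs, -⟩ := exists_first_exit hT.isOpen
      (f := fun r : ℝ => X + (r : ℂ) * (X - g 0)) (by fun_prop)
      (a := (M + ‖X‖ + 1) / ‖X - g 0‖) (by positivity) (by simpa using hXT) (fun hmem => by
        have h1 := hM hmem
        have h2 := norm_sub_le (X + (((M + ‖X‖ + 1) / ‖X - g 0‖ : ℝ) : ℂ) * (X - g 0)) X
        rw [add_sub_cancel_left, norm_mul, Complex.norm_real,
          Real.norm_of_nonneg (by positivity), div_mul_cancel₀ _ hn.ne'] at h2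
        rw [mem_closedBall_zero_iff] at h1
        linarith)
    obtain ⟨-, p, hp, hYp⟩ := hΩ hs
    refine ⟨p, hp, ?_⟩
    have ha : 0 ≤ 1 / (1 + s) := by positivity
    have hb : 0 ≤ s / (1 + s) := by positivity
    have h1 := convex_ball p R hYp (hp ⟨0, rfl⟩) ha hb (by field_simp)
    have h2 : X = (1 / (1 + s)) • (X + (s : ℂ) * (X - g 0)) + (s / (1 + s)) • g 0 := by
      have : (1 + s : ℂ) ≠ 0 := by exact_mod_cast (by positivity : 1 + s ≠ 0)
      rw [Complex.real_smul, Complex.real_smul]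
      push_cast
      field_simp
      ring
    rwa [← h2] at h1
  · exact (hΩ (by rw [hT.isOpen.frontier_eq]; exact ⟨hX, hXT⟩)).2

/-- The table ends before the antipodes of the contacts. -/
theorem larmorArc_pi_notMem_closure (h : IsObstacle R g ε) (hT : IsBilliardTable T N)
    (hΩ : frontier T ⊆ stringDomain R g) (t : ℝ) {s : ℝ} (hs : |s| = Real.pi * R) :
    larmorArc R g (t, s) ∉ closure T := fun hmem => by
  obtain ⟨p, hp, hXp⟩ := exists_ball_of_mem_closure hT hΩ hmem
  have h1 := (h.norm_larmorArc_sub_eq_iff (t := t) hs.le).2 hs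
  have h2 := hp ⟨t, rfl⟩
  rw [Metric.mem_ball] at h2 hXp
  rw [← dist_eq_norm] at h1
  linarith [dist_triangle_right (larmorArc R g (t, s)) (g t) p]

/-- The caustic property makes the boundary of the table orthogonal to the differential of the
string function, and transversal to the arriving arc, at the end of the arc. -/
theorem exists_isTautString_of_hasCaustic (h : IsObstacle R g ε) (hT : IsBilliardTable T N)
    (hΩ : frontier T ⊆ stringDomain R g) (hc : HasCaustic R T N g) {t s u : ℝ} (hs0 : 0 < s)
    (hs : s < Real.pi * R) (hin : ∀ r, 0 ≤ r → r < s → larmorArc R g (t, r) ∈ T)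
    (hu : N u = larmorArc R g (t, s)) :
    ∃ q', IsTautString R g (N u) (t, s) q' ∧
      inner ℝ (arcVelocity R g (t, s) - arcVelocity R g q') (deriv N u) = 0 ∧
      cross (deriv N u) (arcVelocity R g (t, s)) ≠ 0 := by
  have hE := (h.contDiff_larmorArc R).continuous
  have hπR := mul_pos Real.pi_pos h.pos
  have hfr : N u ∈ frontier T := by rw [hT.boundary]; exact ⟨u, rfl⟩
  have hgT : ∀ t, g t ∈ T := fun t => hc.1 (IsConvexClosedCurve.mem_hull g t)
  obtain ⟨a, ha0, -, hafr, hain⟩ := exists_first_exit hT.isOpen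
    (f := fun r => larmorArc R g (t, -r)) (by fun_prop) hπR
    (by rw [neg_zero, larmorArc_zero]; exact hgT t)
    (h.larmorArc_pi_notMem_closure hT hΩ t (by rw [abs_neg, abs_of_pos hπR]))
  obtain ⟨w, hw, hrefl⟩ := exists_isElasticReflection (hT.curve.regular u)
    (h.norm_arcVelocity R (t, s))
  obtain ⟨q', hq', hq's, hq'w⟩ := exists_isMagneticTrajectory h.pos.ne' (N u) hw s
  have hseg : IsSegment R T (fun r => larmorArc R g (t, r - 0)) (-a) s := by
    refine ⟨h.isMagneticTrajectory_larmorArc t 0, by linarith, ?_, ?_, fun r hr => ?_⟩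
    · rw [sub_zero]; exact hafr
    · rw [sub_zero, ← hu]; exact hfr
    · simp only [sub_zero]
      rcases le_total 0 r with h1 | h1
      · exact hin r h1 hr.2
      · have := hain (-r) (by linarith) (by linarith [hr.1])
        rwa [neg_neg] at this
  obtain ⟨b, hseg', s₁, hs₁, t₁, k, h1, hk, h2⟩ := hc.2 _ _ _ hseg
    ⟨0, ⟨by linarith, hs0⟩, t, speed g t, by simp only [sub_self, larmorArc_zero], h.speed_pos t, by
      rw [(h.hasDerivAt_larmorArc_sub t 0 0).deriv, sub_self, arcVelocity_zero, h.deriv_eq]⟩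
    q' u hq' (by rw [sub_zero]; exact hu) (by rw [sub_zero, hq's, hu])
    (by rw [(h.hasDerivAt_larmorArc_sub t 0 s).deriv, sub_zero, hq'w]; exact hrefl)
  obtain rfl := h.eq_larmorArc_of_tangent hq' h1 hk h2
  simp only at hq's
  rw [(h.hasDerivAt_larmorArc_sub t₁ s₁ s).deriv] at hq'w
  -- the reflected arc touches the curve before a half circle
  have hlt : s₁ - s < Real.pi * R := by
    by_contra! hcon
    refine h.larmorArc_pi_notMem_closure hT hΩ t₁ (s := -(Real.pi * R))
      (by rw [abs_neg, abs_of_pos hπR]) ?_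
    rcases hcon.eq_or_lt with h3 | h3
    · rw [h3, neg_sub, hq's]
      exact frontier_subset_closure hfr
    · have := hseg'.inside (s₁ - Real.pi * R) ⟨by linarith, by linarith [hs₁.2]⟩
      simp only [sub_sub_cancel_left] at this
      exact subset_closure this
  obtain ⟨q', hr⟩ := h.exists_isTautString_of_arrive (hΩ hfr) (q := (t, s)) hu.symm hs0 hs
  have hv : arcVelocity R g q' = w := by
    obtain ⟨⟨m, hm⟩, hm'⟩ := h.larmorArc_unique (t := q'.1) (s := q'.2) (t' := t₁) (s' := s - s₁)
      hr.abs_lt_depart (by rw [abs_of_neg (by linarith [hs₁.1])]; linarith)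
      (mul_pos_of_neg_of_neg hr.neg (by linarith [hs₁.1])) (by rw [Prod.mk.eta, hr.depart, hq's])
    rw [← hq'w, show q' = (t₁ + m, s - s₁) from Prod.ext hm hm', h.arcVelocity_add_int]
  have hne := hr.arcVelocity_ne h
  rw [hv] at hne
  have hrefl' := isElasticReflection_iff.1 hrefl
  refine ⟨q', hr, ?_, fun h0 => hne ?_⟩
  · rw [hv, inner_sub_left, hrefl'.1, sub_self]
  · refine eq_of_inner_eq_of_cross_eq (hT.curve.regular u) hrefl'.1.symm ?_
    rw [hrefl'.2, cross_comm (arcVelocity R g (t, s)), h0, neg_zero, neg_zero]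

/-- By the transversality, the exit times depend continuously on the contact. -/
theorem continuous_exit (h : IsObstacle R g ε) (hT : IsBilliardTable T N)
    (hΩ : frontier T ⊆ stringDomain R g) (hc : HasCaustic R T N g) {σ : ℝ → ℝ}
    (h0 : ∀ t, 0 < σ t) (hπ : ∀ t, σ t < Real.pi * R)
    (hfr : ∀ t, larmorArc R g (t, σ t) ∈ frontier T)
    (hin : ∀ t s, 0 ≤ s → s < σ t → larmorArc R g (t, s) ∈ T) : Continuous σ := by
  have hE := (h.contDiff_larmorArc R).continuous
  have hnot : ∀ Y ∈ frontier T, Y ∉ T := fun Y hY hY' => by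
    rw [hT.isOpen.frontier_eq] at hY
    exact hY.2 hY'
  refine continuous_iff_continuousAt.2 fun t₀ => tendsto_order.2 ⟨fun m hm => ?_, fun m hm => ?_⟩
  · have h1 : ∀ᶠ t in nhds t₀, ∀ s ∈ Set.Icc 0 m, larmorArc R g (t, s) ∈ T := by
      refine isCompact_Icc.eventually_forall_of_forall_eventually fun s hs => ?_
      exact hE.continuousAt.eventually_mem (hT.isOpen.mem_nhds (hin t₀ s hs.1 (hs.2.trans_lt hm)))
    filter_upwards [h1] with t ht
    by_contra! hcon
    exact hnot _ (hfr t) (ht _ ⟨(h0 t).le, hcon⟩)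
  · obtain ⟨u₀, hu₀⟩ : larmorArc R g (t₀, σ t₀) ∈ Set.range N := hT.boundary ▸ hfr t₀
    obtain ⟨q', -, -, htr⟩ :=
      h.exists_isTautString_of_hasCaustic hT hΩ hc (h0 t₀) (hπ t₀) (hin t₀) hu₀
    obtain ⟨e, e1, e2, e3, -⟩ := h.exists_localInverse (t := t₀) (h0 t₀).ne'
      (by rw [abs_of_pos (h0 t₀)]; exact hπ t₀)
    rw [← hu₀] at e1 e2 e3
    have hNc := hT.curve.smooth.continuous.continuousAt (x := u₀)
    have hcd : ContDiffAt ℝ ∞ (fun u => e (N u)) u₀ := e1.comp u₀ hT.curve.smooth.contDiffAt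
    have hs := hcd.hasStrictDerivAt (by simp)
    set d := deriv (fun u => e (N u)) u₀
    have hs1 : HasStrictDerivAt (fun u => (e (N u)).1) d.1 u₀ := by
      have := (ContinuousLinearMap.fst ℝ ℝ ℝ).hasStrictFDerivAt.comp_hasStrictDerivAt u₀ hs
      exact this
    have hd1 : d.1 ≠ 0 := fun hd1 => by
      have h1 := (h.hasFDerivAt_larmorArc h.pos (e (N u₀))).comp_hasDerivAt u₀ hs.hasDerivAt
      have h2 := (h1.congr_of_eventuallyEq (f₁ := N) (by
        filter_upwards [hNc.eventually e3] with u hu; exact hu.symm)).unique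
          (hT.curve.hasDerivAt u₀)
      rw [e2] at h2
      apply htr
      rw [← h2]
      simp [hd1, cross_smul_left]
    -- the contacts of the boundary points near `N u₀` fill a neighbourhood of `t₀`
    have hmap := hs1.map_nhds_eq hd1
    simp only [e2] at hmap
    have hev : ∀ᶠ u in nhds u₀, larmorArc R g (e (N u)) = N u ∧ 0 < (e (N u)).2 ∧
        (e (N u)).2 < m := by
      have hcs : ContinuousAt (fun u => (e (N u)).2) u₀ := hcd.continuousAt.snd
      filter_upwards [hNc.eventually e3, hcs.eventually_mem (isOpen_Ioo.mem_nhds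
        (show (e (N u₀)).2 ∈ Set.Ioo 0 m by rw [e2]; exact ⟨h0 t₀, hm⟩))] with u a1 a2
      exact ⟨a1, a2.1, a2.2⟩
    rw [← hmap, Filter.eventually_map]
    filter_upwards [hev] with u ⟨a1, a2, a3⟩
    by_contra! hcon
    refine hnot (N u) (by rw [hT.boundary]; exact ⟨u, rfl⟩) ?_
    rw [← a1]
    exact hin (e (N u)).1 (e (N u)).2 a2.le (a3.trans_le hcon)

/-- The boundary of a table with the caustic `g` is a level set of the string function. -/
theorem exists_eq_stringLevel (h : IsObstacle R g ε) (hT : IsBilliardTable T N)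
    (hΩ : frontier T ⊆ stringDomain R g) (hc : HasCaustic R T N g) :
    ∃ c, frontier T = stringLevel R g c := by
  have hE := (h.contDiff_larmorArc R).continuous
  have hπR := mul_pos Real.pi_pos h.pos
  have hex : ∀ t, ∃ s, 0 < s ∧ s < Real.pi * R ∧ larmorArc R g (t, s) ∈ frontier T ∧
      ∀ r, 0 ≤ r → r < s → larmorArc R g (t, r) ∈ T := fun t =>
    exists_first_exit hT.isOpen (f := fun r => larmorArc R g (t, r)) (by fun_prop) hπR
      (by rw [larmorArc_zero]; exact hc.1 (IsConvexClosedCurve.mem_hull g t))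
      (h.larmorArc_pi_notMem_closure hT hΩ t (abs_of_pos hπR))
  choose σ h0 hπ hfr hin using hex
  have hnot : ∀ Y ∈ frontier T, Y ∉ T := fun Y hY hY' => by
    rw [hT.isOpen.frontier_eq] at hY
    exact hY.2 hY'
  have hper : Function.Periodic σ 1 := fun t => by
    have h1 := fun s => h.larmorArc_add_int R t s 1
    simp only [Int.cast_one] at h1
    rcases lt_trichotomy (σ (t + 1)) (σ t) with h2 | h2 | h2
    · exact absurd (hin t _ (h0 _).le h2) (hnot _ (h1 _ ▸ hfr (t + 1)))
    · exact h2
    · have h3 := hin (t + 1) _ (h0 _).le h2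
      rw [h1] at h3
      exact absurd h3 (hnot _ (hfr t))
  have hσ := h.continuous_exit hT hΩ hc h0 hπ hfr hin
  obtain ⟨-, p, hp, -⟩ := hΩ (hfr 0)
  have hfrA := h.frontier_sweptRegion hσ hper h0 hπ hp
  -- the table is the region swept out by the arriving arcs
  have hAT : sweptRegion R g σ ⊆ T := by
    rintro Y (hY | ⟨t, s, hs0, hs, rfl⟩)
    · exact hc.1 hY
    · exact hin t s hs0.le hs
  have hTA : T = sweptRegion R g σ := by
    refine Set.Subset.antisymm (hT.isConnected.isPreconnected.subset_left_of_subset_union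
      (h.isOpen_sweptRegion hσ hper h0 hπ hp) isClosed_closure.isOpen_compl
      (disjoint_compl_right.mono_left subset_closure) (fun Y hY => ?_)
      ⟨g 0, hc.1 (IsConvexClosedCurve.mem_hull g 0), Or.inl (IsConvexClosedCurve.mem_hull g 0)⟩) hAT
    by_cases hYA : Y ∈ sweptRegion R g σ
    · exact Or.inl hYA
    · refine Or.inr fun hYc => ?_
      have hYf : Y ∈ frontier (sweptRegion R g σ) := by
        rw [(h.isOpen_sweptRegion hσ hper h0 hπ hp).frontier_eq]
        exact ⟨hYc, hYA⟩
      rw [hfrA] at hYf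
      obtain ⟨t, rfl⟩ := hYf
      exact hnot _ (hfr t) hY
  have hfrT : frontier T = Set.range fun t => larmorArc R g (t, σ t) := by rw [hTA, hfrA]
  have hmem : ∀ u, N u ∈ frontier T := fun u => by rw [hT.boundary]; exact ⟨u, rfl⟩
  have hd : ∀ u, HasDerivAt (fun u => stringFunction R g (N u)) 0 u := fun u => by
    obtain ⟨t, ht⟩ : N u ∈ Set.range fun t => larmorArc R g (t, σ t) := hfrT ▸ hmem u
    obtain ⟨q', hq, h1, -⟩ := h.exists_isTautString_of_hasCaustic hT hΩ hc (h0 t) (hπ t) (hin t)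
      ht.symm
    have h2 := (hq.hasFDerivAt_stringFunction h (hΩ (hmem u))).comp_hasDerivAt u
      (hT.curve.hasDerivAt u)
    rw [innerSL_apply_apply, h1] at h2
    exact h2
  refine ⟨stringFunction R g (N 0), ?_⟩
  rw [hfrT]
  refine h.range_section h0 hπ fun t => ⟨hΩ (hfr t), ?_⟩
  obtain ⟨u, hu⟩ : larmorArc R g (t, σ t) ∈ Set.range N := hT.boundary ▸ hfr t
  rw [← hu]
  exact is_const_of_deriv_eq_zero (fun u => (hd u).differentiableAt) (fun u => (hd u).deriv) u 0

end IsObstacle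

/-! ### Level sets and caustics -/

theorem mainTheorem9 (R : ℝ) (hR : 0 < R) (Γ : ℝ → ℂ) (hΓ : IsConvexClosedCurve Γ)
    (hcurv : IsCounterclockwise Γ → ∀ t, 1 / R < signedCurvature Γ t) :
    (∀ X ∈ stringDomain R Γ, IsLeast (loopLengths R Γ X) (stringFunction R Γ X)) ∧
    (IsCounterclockwise Γ → ∀ c, IsCompact (stringLevel R Γ c)) ∧
    (∀ S : Set ℂ,
      (S.Nonempty ∧ IsCompact S ∧ ∃ c, S = stringLevel R Γ c) ↔
        S ⊆ stringDomain R Γ ∧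
          ∃ (T : Set ℂ) (N : ℝ → ℂ), IsBilliardTable T N ∧ frontier T = S ∧
            HasCaustic R T N Γ) := by
  obtain ⟨ε, h, hε⟩ := exists_isObstacle hR hΓ hcurv
  refine ⟨fun X hX => h.isLeast_stringFunction hX, fun hccw c => ?_, fun S => ⟨?_, ?_⟩⟩
  · obtain rfl := hε hccw
    exact h.isCompact_stringLevel c
  · rintro ⟨hne, hc, c, rfl⟩
    exact ⟨fun X hX => hX.1, h.exists_isBilliardTable hne hc⟩
  · rintro ⟨hΩ, T, N, hT, rfl, hcau⟩
    refine ⟨hT.boundary ▸ Set.range_nonempty N, ?_, h.exists_eq_stringLevel hT hΩ hcau⟩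
    exact Metric.isCompact_of_isClosed_isBounded isClosed_frontier
      (hT.isBounded.closure.subset frontier_subset_closure)
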